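/- Let $H\in(0,1/2)$, let $c_H>0$ be a constant, and let $K$ be the Volterra kernel of fractional Brownian motion, $$K(t,u)=c_H\Big[\Big(\frac ut\Big)^{\frac12-H}(t-u)^{H-\frac12}+\Big(\tfrac12-H\Big)u^{\frac12-H}\int_u^t v^{H-\frac32}(v-u)^{H-\frac12}\,dv\Big]\mathbf 1_{\{0<u<t\}} .$$ Let $W=(W(1),\dots,W(d))$ be a $d$-dimensional Wiener process. For $T>0$, indices $i_1,\dots,i_n\in\{1,\dots,d\}$ and $f\in L^2([0,T]^n)$, the multiple Stratonovich integral $\int f(u)\,dW_{u_1}(i_1)\cdots dW_{u_n}(i_n)$ is the limit in $L^2(\Omega)$, if it exists, as the mesh of the partition $\{\Delta_k\}$ of $[0,T]$ into intervals tends to $0$, of $$\sum_{k_1,\dots,k_n}\frac{1}{|\Delta_{k_1}|\cdots|\Delta_{k_n}|}\int_{\Delta_{k_1}\times\cdots\times\Delta_{k_n}}f(u)\,du\ \prod_{l=1}^nW(\Delta_{k_l})(i_l),$$ where $W(\Delta)(i)$ is the increment of $W(i)$ over $\Delta$. For $0\le s<t\le T$, $1\le j\le n$ and $i_1,\dots,i_n\in\{1,\dots,d\}$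 put $$\hat{\mathbf B}^{\mathbf n,j}_{st}(i_1,\dots,i_n)=(-1)^{j-1}\int_{A_j^n}\prod_{l=1}^{j-1}K(s,u_l)\,[K(t,u_j)-K(s,u_j)]\prod_{l=j+1}^nK(t,u_l)\,dW_{u_1}(i_1)\cdots dW_{u_n}(i_n)$$ (Stratonovich integral), where $$A_j^n=\{u\in[0,t]^n:\ u_j=\min(u_1,\dots,u_n),\ u_1>\cdots>u_{j-1},\ u_{j+1}<\cdots<u_n\},$$ and put $\mathbf B^{\mathbf n}_{st}(i_1,\dots,i_n)=\sum_{j=1}^n\hat{\mathbf B}^{\mathbf n,j}_{st}(i_1,\dots,i_n)$, and $|\mathbf B^{\mathbf n}_{st}|^2=\sum_{i_1,\dots,i_n=1}^d\mathbf B^{\mathbf n}_{st}(i_1,\dots,i_n)^2$. **Proposition.** Let $1\le n\le\lfloor 1/H\rfloor$ with $n\neq 1/H$ (that is, $n\ge 1$ and $nH<1$). There is a constant $C>0$, depending only on $H$, $c_H$, $d$ and $n$, such that for all $0\le s<t\le T$ all the Stratonovich integrals above exist, each $\mathbf B^{\mathbf n}_{st}(i_1,\dots,i_n)$ belongs to $L^2(\Omega)$,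 and $$\mathbf E\big[|\mathbf B^{\mathbf n}_{st}|^2\big]\le C\,(t-s)^{2nH}.$$ -/

import Mathlib

open MeasureTheory ProbabilityTheory Filter Topology
open scoped NNReal ENNReal

noncomputable section

/-- A `d`-dimensional Wiener process: its components are independent standard Brownian motions
(with continuous sample paths). -/
structure IsWienerProcess {Ω : Type*} [MeasurableSpace Ω] {d : ℕ}
    (W : Fin d → ℝ≥0 → Ω → ℝ) (P : Measure Ω) : Prop where
  isBrownian : ∀ i, IsBrownianReal (W i) P
  indep : iIndepFun (fun (i : Fin d) (ω : Ω) (t : ℝ≥0) => W i t ω) P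

/-- A partition `0 = τ₀ < τ₁ < ⋯ < τ_N = T` of the interval `[0, T]`. -/
structure IntervalPartition (T : ℝ≥0) where
  N : ℕ
  pt : Fin (N + 1) → ℝ≥0
  strictMono : StrictMono pt
  pt_zero : pt 0 = 0
  pt_last : pt (Fin.last N) = T

namespace IntervalPartition

variable {T : ℝ≥0}

/-- The length of the `k`-th interval of the partition. -/
def len (π : IntervalPartition T) (k : Fin π.N) : ℝ :=
  (π.pt k.succ : ℝ) - (π.pt k.castSucc : ℝ)

/-- The `k`-th interval `(τ_k, τ_{k+1}]` of the partition. -/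
def cell (π : IntervalPartition T) (k : Fin π.N) : Set ℝ :=
  Set.Ioc (π.pt k.castSucc : ℝ) (π.pt k.succ : ℝ)

/-- The mesh of the partition, i.e. the maximal length of its intervals. -/
def mesh (π : IntervalPartition T) : ℝ := ⨆ k, π.len k

/-- The filter on partitions of `[0, T]` that describes the limit "mesh tends to zero". -/
def meshToZero (T : ℝ≥0) : Filter (IntervalPartition T) := comap mesh (𝓝 0)

lemma mesh_nonneg (π : IntervalPartition T) : 0 ≤ π.mesh :=
  Real.iSup_nonneg fun k => sub_nonneg.2
    (NNReal.coe_le_coe.2 (π.strictMono (Fin.castSucc_lt_succ (i := k))).le)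

/-- The partition of `[0, T]` into `m + 1` intervals of equal length. -/
def uniform (hT : 0 < T) (m : ℕ) : IntervalPartition T where
  N := m + 1
  pt k := (k : ℕ) * (T / (m + 1))
  strictMono := fun a b hab =>
    mul_lt_mul_of_pos_right (Nat.cast_lt.2 hab) (by positivity)
  pt_zero := by simp
  pt_last := by
    have : (m : ℝ≥0) + 1 ≠ 0 := by positivity
    simp only [Fin.val_last]
    push_cast
    field_simp

lemma mesh_uniform_le (hT : 0 < T) (m : ℕ) : (uniform hT m).mesh ≤ T / ((m : ℝ) + 1) := by
  refine Real.iSup_le (fun k => le_of_eq ?_) (by positivity)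
  change (((k.succ : ℕ) * (T / (m + 1)) : ℝ≥0) : ℝ) -
    (((k.castSucc : ℕ) * (T / (m + 1)) : ℝ≥0) : ℝ) = T / ((m : ℝ) + 1)
  rw [Fin.val_succ, Fin.val_castSucc]
  push_cast
  ring

lemma meshToZero_neBot (hT : 0 < T) : (meshToZero T).NeBot := by
  refine comap_neBot fun s hs => ?_
  have h : Tendsto (fun m : ℕ => (uniform hT m).mesh) atTop (𝓝 0) := by
    refine squeeze_zero (fun m => mesh_nonneg _) (fun m => mesh_uniform_le hT m) ?_
    have := (tendsto_one_div_add_atTop_nhds_zero_nat (𝕜 := ℝ)).const_mul (T : ℝ)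
    simpa [div_eq_mul_inv] using this
  obtain ⟨m, hm⟩ := (h.eventually hs).exists
  exact ⟨_, hm⟩

end IntervalPartition

section Stratonovich

variable {Ω : Type*} [MeasurableSpace Ω] {d n : ℕ}

/-- The Stratonovich sum of `f` along the partition `π` of `[0, T]`:
`∑_{k₁,…,kₙ} (∏ₗ |Δ_{kₗ}|)⁻¹ (∫_{Δ_{k₁} × ⋯ × Δ_{kₙ}} f(u) du) ∏ₗ W(Δ_{kₗ})(iₗ)`,
where `W(Δ)(i)` is the increment of the `i`-th component of `W` over `Δ`.
Diagonal cells are included. -/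
def stratonovichSum (W : Fin d → ℝ≥0 → Ω → ℝ) {T : ℝ≥0} (i : Fin n → Fin d)
    (f : (Fin n → ℝ) → ℝ) (π : IntervalPartition T) (ω : Ω) : ℝ :=
  ∑ k : Fin n → Fin π.N,
    (∏ l, π.len (k l))⁻¹ * (∫ u in Set.univ.pi (fun l => π.cell (k l)), f u) *
      ∏ l, (W (i l) (π.pt (k l).succ) ω - W (i l) (π.pt (k l).castSucc) ω)

/-- `I` is the multiple Stratonovich integral
`∫_{[0,T]^n} f(u₁,…,uₙ) dW_{u₁}(i₁) ⋯ dW_{uₙ}(iₙ)` of the square integrable function `f`: it is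
the `L²(Ω)`-limit of the Stratonovich sums as the mesh of the partition tends to zero. -/
def IsStratonovichIntegral (P : Measure Ω) (W : Fin d → ℝ≥0 → Ω → ℝ) (T : ℝ≥0)
    (i : Fin n → Fin d) (f : (Fin n → ℝ) → ℝ) (I : Ω → ℝ) : Prop :=
  MemLp f 2 (volume.restrict (Set.Icc 0 (fun _ => (T : ℝ)))) ∧
  MemLp I 2 P ∧
  Tendsto (fun π : IntervalPartition T =>
    eLpNorm (fun ω => stratonovichSum W i f π ω - I ω) 2 P)
    (IntervalPartition.meshToZero T) (𝓝 0)

/-- The function `f` is Stratonovich integrable (with respect to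
`dW_{u₁}(i₁) ⋯ dW_{uₙ}(iₙ)`, on `[0,T]^n`). -/
def StratonovichIntegrable (P : Measure Ω) (W : Fin d → ℝ≥0 → Ω → ℝ) (T : ℝ≥0)
    (i : Fin n → Fin d) (f : (Fin n → ℝ) → ℝ) : Prop :=
  ∃ I : Ω → ℝ, IsStratonovichIntegral P W T i f I

open Classical in
/-- The multiple Stratonovich integral of `f` (and `0` if `f` is not Stratonovich integrable). -/
def stratonovichIntegral (P : Measure Ω) (W : Fin d → ℝ≥0 → Ω → ℝ) (T : ℝ≥0)
    (i : Fin n → Fin d) (f : (Fin n → ℝ) → ℝ) : Ω → ℝ :=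
  if h : StratonovichIntegrable P W T i f then h.choose else 0

lemma stratonovichSum_aemeasurable {P : Measure Ω} {W : Fin d → ℝ≥0 → Ω → ℝ}
    (hW : IsWienerProcess W P) {T : ℝ≥0} (i : Fin n → Fin d) (f : (Fin n → ℝ) → ℝ)
    (π : IntervalPartition T) : AEMeasurable (stratonovichSum W i f π) P := by
  have hm : ∀ j t, AEMeasurable (W j t) P := fun j t =>
    (hW.isBrownian j).toIsPreBrownianReal.aemeasurable t
  unfold stratonovichSum
  refine Finset.aemeasurable_fun_sum _ fun k _ => AEMeasurable.const_mul ?_ _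
  exact Finset.aemeasurable_fun_prod _ fun l _ => (hm _ _).sub (hm _ _)

/-- The multiple Stratonovich integral is unique up to almost sure equality. -/
lemma IsStratonovichIntegral.ae_eq {P : Measure Ω} {W : Fin d → ℝ≥0 → Ω → ℝ}
    (hW : IsWienerProcess W P) {T : ℝ≥0} (hT : 0 < T) {i : Fin n → Fin d}
    {f : (Fin n → ℝ) → ℝ} {I J : Ω → ℝ} (hI : IsStratonovichIntegral P W T i f I)
    (hJ : IsStratonovichIntegral P W T i f J) : I =ᵐ[P] J := by
  have := IntervalPartition.meshToZero_neBot hT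
  obtain ⟨-, hI1, hI2⟩ := hI
  obtain ⟨-, hJ1, hJ2⟩ := hJ
  have hle : ∀ π : IntervalPartition T, eLpNorm (I - J) 2 P ≤
      eLpNorm (fun ω => stratonovichSum W i f π ω - J ω) 2 P +
        eLpNorm (fun ω => stratonovichSum W i f π ω - I ω) 2 P := by
    intro π
    have hS := (stratonovichSum_aemeasurable hW i f π).aestronglyMeasurable
    have e : I - J = (fun ω => stratonovichSum W i f π ω - J ω) -
        (fun ω => stratonovichSum W i f π ω - I ω) := by
      ext ω
      simp
    rw [e]
    exact eLpNorm_sub_le (hS.sub hJ1.1) (hS.sub hI1.1) (by norm_num)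
  have h0 : eLpNorm (I - J) 2 P ≤ 0 := by
    have := ge_of_tendsto (hJ2.add hI2) (Eventually.of_forall hle)
    simpa using this
  have h1 := (eLpNorm_eq_zero_iff (hI1.1.sub hJ1.1) (by norm_num)).1 (le_antisymm h0 bot_le)
  filter_upwards [h1] with ω hω
  exact sub_eq_zero.1 hω

end Stratonovich

/-- The Volterra kernel of fractional Brownian motion with Hurst parameter `H < 1/2`, with
normalizing constant `c`. It vanishes unless `0 < u < t`. -/
def fbmKernel (H c t u : ℝ) : ℝ :=
  if 0 < u ∧ u < t then
    c * ((u / t) ^ (1 / 2 - H) * (t - u) ^ (H - 1 / 2) +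
      (1 / 2 - H) * u ^ (1 / 2 - H) *
        ∫ v in u..t, v ^ (H - 3 / 2) * (v - u) ^ (H - 1 / 2))
  else 0

/-- The set `A_j^n` of all `(u₁,…,uₙ) ∈ [0,t]^n` such that `u_j = min(u₁,…,uₙ)`,
`u₁ > ⋯ > u_{j-1}` and `u_{j+1} < ⋯ < uₙ`. -/
def regionA {n : ℕ} (j : Fin n) (t : ℝ) : Set (Fin n → ℝ) :=
  {u | (∀ l, u l ∈ Set.Icc 0 t) ∧ (∀ l, u j ≤ u l) ∧
    (∀ l m, l < m → m < j → u m < u l) ∧ (∀ l m, j < l → l < m → u l < u m)}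

open Classical in
/-- The integrand `1_{A_j^n}(u) ∏_{l<j} K(s,u_l) [K(t,u_j) - K(s,u_j)] ∏_{l>j} K(t,u_l)`. -/
def volterraIntegrand (H c : ℝ) {n : ℕ} (j : Fin n) (s t : ℝ) (u : Fin n → ℝ) : ℝ :=
  if u ∈ regionA j t then
    (∏ l ∈ Finset.Iio j, fbmKernel H c s (u l)) *
      (fbmKernel H c t (u j) - fbmKernel H c s (u j)) *
      ∏ l ∈ Finset.Ioi j, fbmKernel H c t (u l)
  else 0

section Increment

variable {Ω : Type*} [MeasurableSpace Ω] {d n : ℕ}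

/-- The increment `B̂^{n,j}_{st}(i₁,…,iₙ)`. The index `j : Fin n` starts at `0`, so that the sign
`(-1)^{j-1}` of the usual (one-based) numbering reads `(-1)^j`. -/
def hatIncrement (P : Measure Ω) (W : Fin d → ℝ≥0 → Ω → ℝ) (T : ℝ≥0) (H c : ℝ)
    (j : Fin n) (s t : ℝ) (i : Fin n → Fin d) (ω : Ω) : ℝ :=
  (-1) ^ (j : ℕ) * stratonovichIntegral P W T i (volterraIntegrand H c j s t) ω

/-- The component `B^n_{st}(i₁,…,iₙ) = ∑_j B̂^{n,j}_{st}(i₁,…,iₙ)` of the order `n` increment. For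
`n = 1` this is `∫ [K(t,u) - K(s,u)] dW_u(i₁)`, the increment of the fractional Brownian motion. -/
def roughIncrement (P : Measure Ω) (W : Fin d → ℝ≥0 → Ω → ℝ) (T : ℝ≥0) (H c : ℝ)
    (s t : ℝ) (i : Fin n → Fin d) (ω : Ω) : ℝ :=
  ∑ j : Fin n, hatIncrement P W T H c j s t i ω

end Increment

end

/-!
The second moment of a Stratonovich sum is computed by Wick's formula, and everything else is
deterministic. Increments of the Wiener process are jointly Gaussian, those of different
components are independent, and the covariance of two increments of the same component is the
integral of the product of the indicator functions of their intervals. Hence the mixed moment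
`E[S_π S_π']` of the Stratonovich sums of `f` along two partitions is, up to a constant, a sum
over those pairings of the `2n` factors that respect the components, where a pairing contributes
the integral over `ℝⁿ` of `stepAvg f π (x ∘ σ) * stepAvg f π' (x ∘ τ)`. Here `stepAvg f π` is the
average of `f` over the cells of `π`, and `σ`, `τ` send a factor of the first or second sum to its
pair (`integral_stratonovichSum_mul`). Wick's formula itself follows from the even moments of a
single Gaussian variable by polarization (`integral_prod_of_gaussian`).

*Existence.* If the mixed moments converge as both meshes tend to zero, the sums are Cauchy in
`L²(Ω)` (`exists_L2_limit`). For the given integrand the cell averages converge at almost every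
point that can occur, even if some coordinates coincide, as they do when two factors of the same
sum are paired: the integrand is continuous up to the indicator function of `A_j^n`, and for small
mesh the order of the coordinates inside the cells is the lexicographic one
(`exists_tendsto_stepAvg`). The kernels are dominated by a sum of powers `|u - p| ^ (H - 1/2)`,
which are Muckenhoupt `A₁` weights (`setIntegral_abs_sub_rpow_le`). Therefore the cell averages
are bounded by a constant times the majorant, uniformly in the partition (`abs_stepAvg_le`). Each
variable occurs in exactly two factors, so the square integrability of the majorant suffices for
dominated convergence.

*The estimate.* The limit for a pairing is at most an integral of two copies of the absolute value
of the integrand, without any order between the non-minimal coordinates. Write `κ` for `K(s, ·) +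
K(t, ·)` and `D` for `|K(t, ·) - K(s, ·)|`. Integrating out a variable that is not the minimum of
a copy costs `∫_x^t κ² ≤ M (t - x) ^ (2H)`, where `x` is the larger of the minima that bound it,
hence at most a factor `(t - x) ^ H` for each of its two factors, with `x` the minimum of the copy
of that factor. What is left is `∫ D(x)² (t - x) ^ (2(n - 1)H) dx` if the two minima are paired
with each other, and a product of two integrals `∫ D(x) κ(x) (t - x) ^ ((n - 2)H) dx` otherwise
(`lintegral_minRegionProd_mul_le`). Both have the right order in `t - s`: above `s` the increment
of the kernel is `K(t, ·)`, and below `s` it is at most `c (t - s) (s - x) ^ (H - 1/2) (t - x)⁻¹`,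
so that the remaining integrals converge exactly because `nH < 1`
(`exists_lintegral_kernelIncr_sq_le`, `exists_lintegral_kernelIncr_mul_kernelSum_le`).
-/

noncomputable section

/-! ### Polarization and Wick's formula -/

/-- The sign of a Boolean: `-1` for `true` and `1` for `false`. -/
def boolSign (b : Bool) : ℝ := if b then -1 else 1

/-- The average over all signs detects whether `φ` is bijective: otherwise some `a` is missed by
`φ`, and the summation over the sign `ε a` alone gives `0`. -/
lemma sum_prod_boolSign_comp {A B : Type*} [Fintype A] [Fintype B] [DecidableEq A]
    (hAB : Fintype.card A = Fintype.card B) (φ : B → A) [Decidable (Function.Bijective φ)] :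
    ∑ ε : A → Bool, (∏ a, boolSign (ε a)) * ∏ b, boolSign (ε (φ b)) =
      if Function.Bijective φ then (2 : ℝ) ^ Fintype.card A else 0 := by
  have h1 : ∀ ε : A → Bool, (∏ a, boolSign (ε a)) * ∏ b, boolSign (ε (φ b)) =
      ∏ a, boolSign (ε a) ^ (1 + (Finset.univ.filter (fun b => φ b = a)).card) := by
    intro ε
    rw [← Finset.prod_fiberwise Finset.univ φ (fun b => boolSign (ε (φ b))),
      ← Finset.prod_mul_distrib]
    refine Finset.prod_congr rfl fun a _ => ?_
    rw [pow_add, pow_one]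
    congr 1
    rw [← Finset.prod_const]
    refine Finset.prod_congr rfl fun b hb => ?_
    rw [(Finset.mem_filter.1 hb).2]
  simp_rw [h1]
  have h2 := (Finset.prod_univ_sum (fun _ : A => (Finset.univ : Finset Bool))
    (fun a b => boolSign b ^ (1 + (Finset.univ.filter (fun b => φ b = a)).card)))
  rw [Fintype.piFinset_univ] at h2
  rw [← h2]
  split_ifs with hφ
  · rw [← Finset.card_univ, ← Finset.prod_const]
    refine Finset.prod_congr rfl fun a _ => ?_
    have : (Finset.univ.filter (fun b => φ b = a)).card = 1 := by
      rw [Finset.card_eq_one]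
      obtain ⟨b, hb⟩ := hφ.2 a
      refine ⟨b, ?_⟩
      ext b'
      simp only [Finset.mem_filter, Finset.mem_univ, true_and, Finset.mem_singleton]
      exact ⟨fun h => hφ.1 (h.trans hb.symm), fun h => h ▸ hb⟩
    rw [this]
    norm_num [boolSign]
  · have hns : ¬ Function.Surjective φ := fun hs =>
      hφ ((Fintype.bijective_iff_surjective_and_card φ).2 ⟨hs, hAB.symm⟩)
    simp only [Function.Surjective, not_forall, not_exists] at hns
    obtain ⟨a, ha⟩ := hns
    refine Finset.prod_eq_zero (Finset.mem_univ a) ?_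
    have : (Finset.univ.filter (fun b => φ b = a)).card = 0 := by
      rw [Finset.card_eq_zero, Finset.filter_eq_empty_iff]
      exact fun b _ => ha b
    rw [this]
    norm_num [boolSign]

/-- Averaging a multilinear expression against all signs extracts the terms in which every index
occurs exactly once. -/
lemma sum_boolSign_extract {A B : Type*} [Fintype A] [Fintype B] [DecidableEq A] [DecidableEq B]
    (hAB : Fintype.card A = Fintype.card B) (T : (B → A) → ℝ) :
    ∑ ε : A → Bool, (∏ a, boolSign (ε a)) * ∑ φ : B → A, (∏ b, boolSign (ε (φ b))) * T φ =
      2 ^ Fintype.card A * ∑ e : B ≃ A, T e := by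
  classical
  simp_rw [Finset.mul_sum]
  rw [Finset.sum_comm]
  simp_rw [← mul_assoc, ← Finset.sum_mul, sum_prod_boolSign_comp hAB, ite_mul, zero_mul]
  rw [← Finset.sum_filter]
  symm
  refine Finset.sum_bij (fun e _ => (e : B → A)) ?_ ?_ ?_ ?_
  · intro e _
    simp
  · intro e _ e' _ h
    exact DFunLike.coe_injective h
  · intro φ hφ
    refine ⟨Equiv.ofBijective φ (Finset.mem_filter.1 hφ).2, Finset.mem_univ _, rfl⟩
  · intro e _
    rfl

/-- Polarization of a product of `2n` numbers into `2n`-th powers of signed sums. -/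
lemma prod_eq_polarization {A : Type*} [Fintype A] [DecidableEq A] {n : ℕ}
    (hA : Fintype.card A = Fintype.card (Fin n × Bool)) (x : A → ℝ) :
    2 ^ Fintype.card A * (Fintype.card (Fin n × Bool)).factorial * ∏ a, x a =
      ∑ ε : A → Bool, (∏ a, boolSign (ε a)) * (∑ a, boolSign (ε a) * x a) ^ (2 * n) := by
  have h := sum_boolSign_extract hA (fun φ : Fin n × Bool → A => ∏ b, x (φ b))
  have h1 : ∑ e : (Fin n × Bool) ≃ A, ∏ b, x (e b) =
      (Fintype.card (Fin n × Bool)).factorial * ∏ a, x a := by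
    have : ∀ e : (Fin n × Bool) ≃ A, ∏ b, x (e b) = ∏ a, x a := fun e => Equiv.prod_comp e x
    simp_rw [this]
    rw [Finset.sum_const, nsmul_eq_mul, Finset.card_univ,
      Fintype.card_equiv (Fintype.equivOfCardEq hA.symm)]
  rw [h1, ← mul_assoc] at h
  rw [← h]
  refine Finset.sum_congr rfl fun ε _ => ?_
  congr 1
  have h2 := (Finset.prod_univ_sum (fun _ : Fin n × Bool => (Finset.univ : Finset A))
    (fun _ a => boolSign (ε a) * x a))
  rw [Fintype.piFinset_univ, Finset.prod_const, Finset.card_univ] at h2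
  have hc : Fintype.card (Fin n × Bool) = 2 * n := by
    rw [Fintype.card_prod, Fintype.card_fin, Fintype.card_bool, mul_comm]
  rw [hc] at h2
  rw [h2]
  exact Finset.sum_congr rfl fun φ _ => Finset.prod_mul_distrib.symm

/-- Polarization of the `n`-th power of a quadratic form leaves the products of its coefficients
over the perfect matchings of the indices. -/
lemma sum_boolSign_quadratic_pow {A : Type*} [Fintype A] [DecidableEq A] {n : ℕ}
    (hA : Fintype.card A = Fintype.card (Fin n × Bool)) (C : A → A → ℝ) :
    ∑ ε : A → Bool, (∏ a, boolSign (ε a)) *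
        (∑ a, ∑ b, boolSign (ε a) * boolSign (ε b) * C a b) ^ n =
      2 ^ Fintype.card A * ∑ e : (Fin n × Bool) ≃ A, ∏ i, C (e (i, false)) (e (i, true)) := by
  rw [← sum_boolSign_extract hA
    (fun φ : Fin n × Bool → A => ∏ i, C (φ (i, false)) (φ (i, true)))]
  refine Finset.sum_congr rfl fun ε _ => ?_
  congr 1
  have h2 := (Finset.prod_univ_sum (fun _ : Fin n => (Finset.univ : Finset (Bool → A)))
    (fun _ p => boolSign (ε (p false)) * boolSign (ε (p true)) * C (p false) (p true)))
  rw [Fintype.piFinset_univ, Finset.prod_const, Finset.card_univ, Fintype.card_fin] at h2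
  have h3 : ∑ a, ∑ b, boolSign (ε a) * boolSign (ε b) * C a b =
      ∑ p : Bool → A, boolSign (ε (p false)) * boolSign (ε (p true)) *
        C (p false) (p true) := by
    rw [← Fintype.sum_prod_type']
    refine (Fintype.sum_equiv (Equiv.boolArrowEquivProd A) _ _ fun p => ?_).symm
    rfl
  rw [h3, h2]
  refine Fintype.sum_equiv (Equiv.curry (Fin n) Bool A).symm _ _ fun ψ => ?_
  rw [Finset.prod_mul_distrib, Fintype.prod_prod_type]
  congr 1
  refine Finset.prod_congr rfl fun i _ => ?_
  rw [Fintype.prod_bool, mul_comm]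
  rfl

/-- The Gaussian moment of order `2n`, divided by `(2n)!`. -/
def wickConst (n : ℕ) : ℝ :=
  (∫ x, x ^ (2 * n) ∂(gaussianReal 0 1)) / (Fintype.card (Fin n × Bool)).factorial

lemma wickConst_nonneg (n : ℕ) : 0 ≤ wickConst n := by
  refine div_nonneg (integral_nonneg fun x => ?_) (by positivity)
  simp only [Pi.zero_apply, pow_mul]
  positivity

lemma integral_pow_of_hasGaussianLaw {Ω : Type*} [MeasurableSpace Ω] {P : Measure Ω}
    {Y : Ω → ℝ} (hY : HasGaussianLaw Y P) (h0 : P[Y] = 0) (n : ℕ) :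
    ∫ ω, Y ω ^ (2 * n) ∂P = (∫ x, x ^ (2 * n) ∂(gaussianReal 0 1)) * (∫ ω, Y ω ^ 2 ∂P) ^ n := by
  have hm := hY.aemeasurable
  have := hY.isProbabilityMeasure
  have hv : Var[Y; P] = ∫ ω, Y ω ^ 2 ∂P := variance_of_integral_eq_zero hm h0
  have hlaw := hY.map_eq_gaussianReal
  rw [h0] at hlaw
  set v := ∫ ω, Y ω ^ 2 ∂P with hvdef
  have hv0 : 0 ≤ v := integral_nonneg fun x => by positivity
  have h2 : (gaussianReal 0 1).map (fun x => Real.sqrt v * x) = gaussianReal 0 v.toNNReal := by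
    rw [gaussianReal_map_const_mul]
    congr 1
    · simp
    · rw [mul_one]
      ext
      simp [Real.sq_sqrt hv0, Real.coe_toNNReal _ hv0]
  calc ∫ ω, Y ω ^ (2 * n) ∂P = ∫ x, x ^ (2 * n) ∂(P.map Y) := by
        rw [integral_map hm (by fun_prop)]
    _ = ∫ x, (Real.sqrt v * x) ^ (2 * n) ∂(gaussianReal 0 1) := by
        rw [hlaw, hv, ← h2, integral_map (by fun_prop) (by fun_prop)]
    _ = _ := by
        simp_rw [mul_pow]
        rw [integral_const_mul, mul_comm, pow_mul (Real.sqrt v), Real.sq_sqrt hv0]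

lemma integrable_pow_of_hasGaussianLaw {Ω : Type*} [MeasurableSpace Ω] {P : Measure Ω}
    {Y : Ω → ℝ} (hY : HasGaussianLaw Y P) (n : ℕ) :
    Integrable (fun ω => Y ω ^ n) P := by
  have := hY.isProbabilityMeasure
  have h := (hY.memLp (p := (n : ℝ≥0∞)) (by simp))
  rcases Nat.eq_zero_or_pos n with rfl | hn
  · simp
  have h1 := h.integrable_norm_pow (by omega)
  refine (integrable_norm_iff (hY.aemeasurable.pow_const n).aestronglyMeasurable).1 ?_
  simpa [norm_pow] using h1

section Wick

variable {Ω : Type*} [MeasurableSpace Ω] {P : Measure Ω} {A : Type*} [Fintype A] [DecidableEq A]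
  {X : A → Ω → ℝ} {n : ℕ}

lemma integrable_prod_of_gaussian (hA : Fintype.card A = Fintype.card (Fin n × Bool))
    (hX : ∀ r : A → ℝ, HasGaussianLaw (fun ω => ∑ a, r a * X a ω) P) :
    Integrable (fun ω => ∏ a, X a ω) P := by
  have h1 : (fun ω => ∏ a, X a ω) = fun ω =>
      (2 ^ Fintype.card A * ((Fintype.card (Fin n × Bool)).factorial : ℝ))⁻¹ *
      ∑ ε : A → Bool, (∏ a, boolSign (ε a)) * (∑ a, boolSign (ε a) * X a ω) ^ (2 * n) := by
    ext ω
    have := prod_eq_polarization hA (fun a => X a ω)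
    rw [← this, inv_mul_cancel_left₀ (by positivity)]
  rw [h1]
  refine Integrable.const_mul (integrable_finsetSum _ fun ε _ => Integrable.const_mul ?_ _) _
  exact integrable_pow_of_hasGaussianLaw (hX _) _

/-- **Wick's formula** for centered jointly Gaussian variables. Each perfect matching of the `2n`
indices is counted once for each of its enumerations by `Fin n × Bool`; the constant `wickConst n`
compensates for this. -/
lemma integral_prod_of_gaussian (hA : Fintype.card A = Fintype.card (Fin n × Bool))
    (hX : ∀ r : A → ℝ, HasGaussianLaw (fun ω => ∑ a, r a * X a ω) P)
    (hL2 : ∀ a, MemLp (X a) 2 P)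
    (h0 : ∀ a, P[X a] = 0) :
    ∫ ω, ∏ a, X a ω ∂P = wickConst n * ∑ e : (Fin n × Bool) ≃ A,
      ∏ i, ∫ ω, X (e (i, false)) ω * X (e (i, true)) ω ∂P := by
  have hP : IsProbabilityMeasure P := (hX 0).isProbabilityMeasure
  set N : ℝ := 2 ^ Fintype.card A with hN
  set F : ℝ := ((Fintype.card (Fin n × Bool)).factorial : ℝ) with hF
  have hN0 : N ≠ 0 := by positivity
  have hF0 : F ≠ 0 := by positivity
  have h1 : (fun ω => N * F * ∏ a, X a ω) = fun ω =>
      ∑ ε : A → Bool, (∏ a, boolSign (ε a)) * (∑ a, boolSign (ε a) * X a ω) ^ (2 * n) := by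
    ext ω
    exact prod_eq_polarization hA (fun a => X a ω)
  have hint : ∀ a b, Integrable (fun ω => X a ω * X b ω) P := fun a b =>
    (hL2 a).integrable_mul (hL2 b)
  have hmean : ∀ r : A → ℝ, P[fun ω => ∑ a, r a * X a ω] = 0 := by
    intro r
    rw [integral_finsetSum _ fun a _ => ((hL2 a).integrable (by norm_num)).const_mul _]
    refine Finset.sum_eq_zero fun a _ => ?_
    rw [integral_const_mul, h0 a, mul_zero]
  have hsq : ∀ r : A → ℝ, ∫ ω, (∑ a, r a * X a ω) ^ 2 ∂P =
      ∑ a, ∑ b, r a * r b * ∫ ω, X a ω * X b ω ∂P := by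
    intro r
    have : ∀ ω, (∑ a, r a * X a ω) ^ 2 = ∑ a, ∑ b, r a * r b * (X a ω * X b ω) := by
      intro ω
      rw [sq, Finset.sum_mul_sum]
      refine Finset.sum_congr rfl fun a _ => Finset.sum_congr rfl fun b _ => by ring
    simp_rw [this]
    rw [integral_finsetSum _ fun a _ => integrable_finsetSum _ fun b _ => (hint a b).const_mul _]
    refine Finset.sum_congr rfl fun a _ => ?_
    rw [integral_finsetSum _ fun b _ => (hint a b).const_mul _]
    exact Finset.sum_congr rfl fun b _ => integral_const_mul _ _
  have h2 : N * F * ∫ ω, ∏ a, X a ω ∂P =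
      (∫ x, x ^ (2 * n) ∂(gaussianReal 0 1)) *
      (N * ∑ e : (Fin n × Bool) ≃ A, ∏ i, ∫ ω, X (e (i, false)) ω * X (e (i, true)) ω ∂P) := by
    rw [← integral_const_mul, h1, integral_finsetSum _ fun ε _ =>
      (integrable_pow_of_hasGaussianLaw (hX _) _).const_mul _]
    simp_rw [integral_const_mul]
    rw [← sum_boolSign_quadratic_pow hA (fun a b => ∫ ω, X a ω * X b ω ∂P), Finset.mul_sum]
    refine Finset.sum_congr rfl fun ε _ => ?_
    rw [integral_pow_of_hasGaussianLaw (hX _) (hmean _), hsq]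
    ring
  unfold wickConst
  rw [← hF]
  field_simp
  have h3 : N * (F * ∫ ω, ∏ a, X a ω ∂P) = N * ((∫ x, x ^ (2 * n) ∂(gaussianReal 0 1)) *
      ∑ e : (Fin n × Bool) ≃ A, ∏ i, ∫ ω, X (e (i, false)) ω * X (e (i, true)) ω ∂P) := by
    linear_combination h2
  have := mul_left_cancel₀ hN0 h3
  linear_combination this

end Wick

/-! ### Increments of the Wiener process -/

section Wiener

variable {Ω : Type*} [MeasurableSpace Ω] {P : Measure Ω} {d : ℕ} {W : Fin d → ℝ≥0 → Ω → ℝ}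

lemma IsWienerProcess.isGaussianProcess (hW : IsWienerProcess W P) :
    IsGaussianProcess (fun p : Fin d × ℝ≥0 => W p.1 p.2) P where
  hasGaussianLaw I := by
    classical
    set J : Finset ℝ≥0 := I.image Prod.snd with hJ
    have h1 : ∀ i, HasGaussianLaw (fun ω => J.restrict (W i · ω)) P := by
      intro i
      have hB := (hW.isBrownian i).toIsPreBrownianReal
      exact hB.isGaussianProcess.hasGaussianLaw J
    have h2 : iIndepFun (fun (i : Fin d) (ω : Ω) => J.restrict (W i · ω)) P :=
      hW.indep.comp (fun _ x => J.restrict x) fun _ => by fun_prop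
    have h3 := iIndepFun.hasGaussianLaw h1 h2
    let L : (Fin d → (J → ℝ)) →L[ℝ] (I → ℝ) := ContinuousLinearMap.pi fun p =>
      (ContinuousLinearMap.proj (R := ℝ) (φ := fun _ : J => ℝ)
        ⟨p.1.2, Finset.mem_image_of_mem _ p.2⟩).comp
        (ContinuousLinearMap.proj (R := ℝ) (φ := fun _ : Fin d => J → ℝ) p.1.1)
    exact h3.map_fun L

lemma IsWienerProcess.memLp_two (hW : IsWienerProcess W P) (i : Fin d) (t : ℝ≥0) :
    MemLp (W i t) 2 P := by
  have hB := (hW.isBrownian i).toIsPreBrownianReal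
  exact (hB.isGaussianProcess.hasGaussianLaw_eval t).memLp_two

lemma IsWienerProcess.integral_mul (hW : IsWienerProcess W P) (i j : Fin d) (s t : ℝ≥0) :
    ∫ ω, W i s ω * W j t ω ∂P = if i = j then min (s : ℝ) t else 0 := by
  have := hW.isGaussianProcess.isProbabilityMeasure
  have hi := (hW.isBrownian i).toIsPreBrownianReal
  have hj := (hW.isBrownian j).toIsPreBrownianReal
  have hc : cov[W i s, W j t; P] = ∫ ω, W i s ω * W j t ω ∂P := by
    rw [covariance_eq_sub (hW.memLp_two i s) (hW.memLp_two j t), hi.integral_eval, zero_mul,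
      sub_zero]
    rfl
  rw [← hc]
  split_ifs with h
  · subst h
    rw [hi.covariance_eval, NNReal.coe_min]
  · have h2 : IndepFun (W i s) (W j t) P :=
      (hW.indep.indepFun h).comp (φ := fun x : ℝ≥0 → ℝ => x s)
        (ψ := fun x : ℝ≥0 → ℝ => x t) (measurable_pi_apply s) (measurable_pi_apply t)
    exact h2.covariance_eq_zero (hW.memLp_two i s) (hW.memLp_two j t)

lemma integral_indicator_Ioc_mul {a b a' b' : ℝ} (h : a ≤ b) (h' : a' ≤ b') :
    ∫ x, (Set.Ioc a b).indicator 1 x * (Set.Ioc a' b').indicator (1 : ℝ → ℝ) x =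
      min b b' - min b a' - min a b' + min a a' := by
  have h1 : ∀ x, (Set.Ioc a b).indicator 1 x * (Set.Ioc a' b').indicator (1 : ℝ → ℝ) x =
      (Set.Ioc (max a a') (min b b')).indicator 1 x := by
    intro x
    rw [← Set.Ioc_inter_Ioc, Set.inter_indicator_one]
    rfl
  simp_rw [h1]
  rw [integral_indicator_one measurableSet_Ioc, measureReal_def, Real.volume_Ioc,
    ENNReal.toReal_ofReal']
  simp only [min_def, max_def]
  split_ifs <;> linarith

/-- The increment of the `i`-th component of `W` over `(a, b]`. -/
abbrev wienerIncr (W : Fin d → ℝ≥0 → Ω → ℝ) (i : Fin d) (a b : ℝ≥0) (ω : Ω) : ℝ :=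
  W i b ω - W i a ω

lemma IsWienerProcess.integral_incr_mul (hW : IsWienerProcess W P) (i j : Fin d)
    {a b a' b' : ℝ≥0} (h : a ≤ b) (h' : a' ≤ b') :
    ∫ ω, wienerIncr W i a b ω * wienerIncr W j a' b' ω ∂P =
      (if i = j then 1 else 0) * ∫ x, (Set.Ioc (a : ℝ) b).indicator 1 x *
        (Set.Ioc (a' : ℝ) b').indicator (1 : ℝ → ℝ) x := by
  rw [integral_indicator_Ioc_mul (NNReal.coe_le_coe.2 h) (NNReal.coe_le_coe.2 h')]
  have hint : ∀ s t, Integrable (fun ω => W i s ω * W j t ω) P := fun s t =>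
    (hW.memLp_two i s).integrable_mul (hW.memLp_two j t)
  have e : ∀ ω, wienerIncr W i a b ω * wienerIncr W j a' b' ω =
      W i b ω * W j b' ω - W i b ω * W j a' ω - W i a ω * W j b' ω + W i a ω * W j a' ω := by
    intro ω
    ring
  simp_rw [e]
  have i1 : Integrable (fun ω => W i b ω * W j b' ω - W i b ω * W j a' ω) P :=
    (hint _ _).sub (hint _ _)
  have i2 : Integrable (fun ω => W i b ω * W j b' ω - W i b ω * W j a' ω -
    W i a ω * W j b' ω) P := i1.sub (hint _ _)
  rw [integral_add i2 (hint _ _), integral_sub i1 (hint _ _), integral_sub (hint _ _) (hint _ _)]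
  simp_rw [hW.integral_mul]
  split_ifs <;> ring

lemma IsWienerProcess.hasGaussianLaw_sum_incr (hW : IsWienerProcess W P) {A : Type*} [Fintype A]
    (i : A → Fin d) (a b : A → ℝ≥0) (r : A → ℝ) :
    HasGaussianLaw (fun ω => ∑ k, r k * wienerIncr W (i k) (a k) (b k) ω) P := by
  classical
  set I : Finset (Fin d × ℝ≥0) := Finset.univ.image (fun k => (i k, a k)) ∪
    Finset.univ.image (fun k => (i k, b k)) with hI
  have ha : ∀ k, (i k, a k) ∈ I := fun k => Finset.mem_union_left _
    (Finset.mem_image_of_mem _ (Finset.mem_univ k))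
  have hb : ∀ k, (i k, b k) ∈ I := fun k => Finset.mem_union_right _
    (Finset.mem_image_of_mem _ (Finset.mem_univ k))
  let L : (I → ℝ) →L[ℝ] ℝ := ∑ k, r k •
    (ContinuousLinearMap.proj (R := ℝ) (φ := fun _ : I => ℝ) ⟨_, hb k⟩ -
      ContinuousLinearMap.proj (R := ℝ) (φ := fun _ : I => ℝ) ⟨_, ha k⟩)
  have := (hW.isGaussianProcess.hasGaussianLaw I).map_fun L
  have e : (fun ω => ∑ k, r k * wienerIncr W (i k) (a k) (b k) ω) =
      fun ω => L (I.restrict fun p => W p.1 p.2 ω) := by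
    ext ω
    simp [L]
  rw [e]
  exact this

end Wiener

/-! ### Second moments of Stratonovich sums -/

section SecondMoment

variable {Ω : Type*} [MeasurableSpace Ω] {P : Measure Ω} {d n : ℕ} {W : Fin d → ℝ≥0 → Ω → ℝ}
  {T : ℝ≥0}

/-- The step function obtained from `f` by averaging over the products of cells of `π`. -/
def stepAvg (f : (Fin n → ℝ) → ℝ) (π : IntervalPartition T) (y : Fin n → ℝ) : ℝ :=
  ∑ k : Fin n → Fin π.N, (∏ l, π.len (k l))⁻¹ *
    (∫ u in Set.univ.pi (fun l => π.cell (k l)), f u) *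
      ∏ l, (π.cell (k l)).indicator 1 (y l)

/-- A bijection `e : Fin n × Bool ≃ Fin n ⊕ Fin n` encodes a pairing of the `2n` factors of a
product of two terms of Stratonovich sums, together with an enumeration of its pairs by `Fin n`.
The factors, that is the elements of `Fin n ⊕ Fin n`, are called half-edges, the left and the right
summand are the two copies, and the `c`-th pair consists of `e (c, false)` and `e (c, true)`. The
weight is `1` if `e` only pairs half-edges that carry the same component of the Wiener process,
and `0` otherwise. -/
def pairingWeight (i : Fin n → Fin d) (e : (Fin n × Bool) ≃ (Fin n ⊕ Fin n)) : ℝ :=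
  ∏ c, if Sum.elim i i (e (c, false)) = Sum.elim i i (e (c, true)) then 1 else 0

lemma pairingWeight_nonneg (i : Fin n → Fin d) (e : (Fin n × Bool) ≃ (Fin n ⊕ Fin n)) :
    0 ≤ pairingWeight i e :=
  Finset.prod_nonneg fun c _ => by split_ifs <;> norm_num

lemma pairingWeight_le_one (i : Fin n → Fin d) (e : (Fin n × Bool) ≃ (Fin n ⊕ Fin n)) :
    pairingWeight i e ≤ 1 :=
  Finset.prod_le_one (fun c _ => by split_ifs <;> norm_num) fun c _ => by split_ifs <;> norm_num

/-- The pair to which the half-edge `a` belongs. -/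
abbrev pairLabel (e : (Fin n × Bool) ≃ (Fin n ⊕ Fin n)) (a : Fin n ⊕ Fin n) : Fin n :=
  (e.symm a).1

/-- A product over the pairs is a product over the half-edges of the two copies. -/
lemma prod_pairs {M : Type*} [CommMonoid M] (e : (Fin n × Bool) ≃ (Fin n ⊕ Fin n))
    (g : Fin n ⊕ Fin n → Fin n → M) :
    ∏ c, g (e (c, false)) c * g (e (c, true)) c =
      (∏ l, g (Sum.inl l) (pairLabel e (Sum.inl l))) *
        ∏ l, g (Sum.inr l) (pairLabel e (Sum.inr l)) := by
  rw [← Fintype.prod_sum_type (fun a => g a (pairLabel e a)), ← Equiv.prod_comp e,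
    Fintype.prod_prod_type]
  refine Finset.prod_congr rfl fun c _ => ?_
  rw [Fintype.prod_bool, mul_comm]
  simp [pairLabel]

lemma card_sum_eq_card_prod_bool (n : ℕ) :
    Fintype.card (Fin n ⊕ Fin n) = Fintype.card (Fin n × Bool) := by
  simp [mul_two]

lemma IntervalPartition.pt_castSucc_le (π : IntervalPartition T) (k : Fin π.N) :
    π.pt k.castSucc ≤ π.pt k.succ := (π.strictMono (Fin.castSucc_lt_succ (i := k))).le

lemma integrable_indicator_cell_mul (π π' : IntervalPartition T) (k : Fin π.N) (k' : Fin π'.N) :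
    Integrable (fun x => (π.cell k).indicator 1 x * (π'.cell k').indicator (1 : ℝ → ℝ) x) := by
  have : (fun x => (π.cell k).indicator 1 x * (π'.cell k').indicator (1 : ℝ → ℝ) x) =
      (π.cell k ∩ π'.cell k').indicator 1 := by
    rw [Set.inter_indicator_one]
    rfl
  rw [this]
  refine (integrable_indicator_iff (measurableSet_Ioc.inter measurableSet_Ioc)).2 ?_
  refine integrableOn_const (ne_of_lt ((measure_mono Set.inter_subset_left).trans_lt ?_))
  exact measure_Ioc_lt_top

/-- Wick's formula for the increments over the cells of two partitions. The covariance of two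
increments is the integral of the product of the indicator functions of their cells, so that a
pairing turns into an integral over `ℝⁿ` in which paired half-edges share a variable. -/
lemma integral_prod_incr (hW : IsWienerProcess W P) (i : Fin n → Fin d)
    (π π' : IntervalPartition T) (k : Fin n → Fin π.N) (k' : Fin n → Fin π'.N) :
    Integrable (fun ω =>
      (∏ l, (W (i l) (π.pt (k l).succ) ω - W (i l) (π.pt (k l).castSucc) ω)) *
      ∏ l, (W (i l) (π'.pt (k' l).succ) ω - W (i l) (π'.pt (k' l).castSucc) ω)) P ∧
    ∫ ω, (∏ l, (W (i l) (π.pt (k l).succ) ω - W (i l) (π.pt (k l).castSucc) ω)) *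
      (∏ l, (W (i l) (π'.pt (k' l).succ) ω - W (i l) (π'.pt (k' l).castSucc) ω)) ∂P =
    wickConst n * ∑ e : (Fin n × Bool) ≃ (Fin n ⊕ Fin n), pairingWeight i e *
      ∫ x : Fin n → ℝ, (∏ l, (π.cell (k l)).indicator 1 (x (pairLabel e (Sum.inl l)))) *
        ∏ l, (π'.cell (k' l)).indicator 1 (x (pairLabel e (Sum.inr l))) := by
  set ι : Fin n ⊕ Fin n → Fin d := Sum.elim i i with hι
  set lo : Fin n ⊕ Fin n → ℝ≥0 := Sum.elim (fun l => π.pt (k l).castSucc)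
    (fun l => π'.pt (k' l).castSucc) with hlo
  set hi : Fin n ⊕ Fin n → ℝ≥0 := Sum.elim (fun l => π.pt (k l).succ)
    (fun l => π'.pt (k' l).succ) with hhi
  have hle : ∀ a, lo a ≤ hi a := by
    rintro (l | l)
    · exact π.pt_castSucc_le _
    · exact π'.pt_castSucc_le _
  set X : Fin n ⊕ Fin n → Ω → ℝ := fun a => wienerIncr W (ι a) (lo a) (hi a) with hX
  have hprod : ∀ ω, (∏ l, (W (i l) (π.pt (k l).succ) ω - W (i l) (π.pt (k l).castSucc) ω)) *
      (∏ l, (W (i l) (π'.pt (k' l).succ) ω - W (i l) (π'.pt (k' l).castSucc) ω)) =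
      ∏ a, X a ω := fun ω => (Fintype.prod_sum_type (fun a => X a ω)).symm
  simp_rw [hprod]
  have hG : ∀ r : Fin n ⊕ Fin n → ℝ, HasGaussianLaw (fun ω => ∑ a, r a * X a ω) P :=
    fun r => hW.hasGaussianLaw_sum_incr ι lo hi r
  refine ⟨integrable_prod_of_gaussian (card_sum_eq_card_prod_bool n) hG, ?_⟩
  have := hW.isGaussianProcess.isProbabilityMeasure
  rw [integral_prod_of_gaussian (card_sum_eq_card_prod_bool n) hG
    (fun a => (hW.memLp_two _ _).sub (hW.memLp_two _ _))]
  swap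
  · intro a
    have h1 := (hW.isBrownian (ι a)).toIsPreBrownianReal
    change ∫ ω, (W (ι a) (hi a) ω - W (ι a) (lo a) ω) ∂P = 0
    rw [integral_sub (h1.integrable_eval _) (h1.integrable_eval _), h1.integral_eval,
      h1.integral_eval, sub_zero]
  congr 1
  refine Finset.sum_congr rfl fun e _ => ?_
  set g : Fin n ⊕ Fin n → ℝ → ℝ := fun a => (Set.Ioc (lo a : ℝ) (hi a)).indicator 1 with hg
  have h1 : ∀ x : Fin n → ℝ,
      (∏ l, (π.cell (k l)).indicator 1 (x (pairLabel e (Sum.inl l)))) *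
        (∏ l, (π'.cell (k' l)).indicator 1 (x (pairLabel e (Sum.inr l)))) =
      ∏ c, g (e (c, false)) (x c) * g (e (c, true)) (x c) := fun x =>
    (prod_pairs e (fun a c => g a (x c))).symm
  simp_rw [h1]
  rw [integral_fintype_prod_volume_eq_prod
    (fun c y => g (e (c, false)) y * g (e (c, true)) y), pairingWeight, ← Finset.prod_mul_distrib]
  exact Finset.prod_congr rfl fun c _ => hW.integral_incr_mul _ _ (hle _) (hle _)

lemma integrable_prod_indicator_pairs (π π' : IntervalPartition T) (k : Fin n → Fin π.N)
    (k' : Fin n → Fin π'.N) (e : (Fin n × Bool) ≃ (Fin n ⊕ Fin n)) :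
    Integrable (fun x : Fin n → ℝ =>
      (∏ l, (π.cell (k l)).indicator (1 : ℝ → ℝ) (x (pairLabel e (Sum.inl l)))) *
        ∏ l, (π'.cell (k' l)).indicator 1 (x (pairLabel e (Sum.inr l)))) := by
  set lo : Fin n ⊕ Fin n → ℝ≥0 := Sum.elim (fun l => π.pt (k l).castSucc)
    (fun l => π'.pt (k' l).castSucc) with hlo
  set hi : Fin n ⊕ Fin n → ℝ≥0 := Sum.elim (fun l => π.pt (k l).succ)
    (fun l => π'.pt (k' l).succ) with hhi
  set g : Fin n ⊕ Fin n → ℝ → ℝ := fun a => (Set.Ioc (lo a : ℝ) (hi a)).indicator 1 with hg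
  have h1 : ∀ x : Fin n → ℝ,
      (∏ l, (π.cell (k l)).indicator (1 : ℝ → ℝ) (x (pairLabel e (Sum.inl l)))) *
        (∏ l, (π'.cell (k' l)).indicator 1 (x (pairLabel e (Sum.inr l)))) =
      ∏ c, g (e (c, false)) (x c) * g (e (c, true)) (x c) := fun x =>
    (prod_pairs e (fun a c => g a (x c))).symm
  simp_rw [h1]
  refine Integrable.fintype_prod (f := fun c y => g (e (c, false)) y * g (e (c, true)) y)
    fun c => ?_
  have h2 : ∀ a b, Integrable (fun y => g a y * g b y) := by
    rintro (a | a) (b | b) <;> exact integrable_indicator_cell_mul _ _ _ _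
  exact h2 _ _

/-- The mixed second moment of two Stratonovich sums is, up to a constant, a sum over the pairings
of integrals of the cell averages of `f`, in which paired half-edges share a variable. -/
lemma integral_stratonovichSum_mul (hW : IsWienerProcess W P) (i : Fin n → Fin d)
    (f : (Fin n → ℝ) → ℝ) (π π' : IntervalPartition T) :
    Integrable (fun ω => stratonovichSum W i f π ω * stratonovichSum W i f π' ω) P ∧
    ∫ ω, stratonovichSum W i f π ω * stratonovichSum W i f π' ω ∂P =
      wickConst n * ∑ e : (Fin n × Bool) ≃ (Fin n ⊕ Fin n), pairingWeight i e *
        ∫ x : Fin n → ℝ, stepAvg f π (fun l => x (pairLabel e (Sum.inl l))) *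
          stepAvg f π' (fun l => x (pairLabel e (Sum.inr l))) := by
  have e1 : ∀ ω, stratonovichSum W i f π ω * stratonovichSum W i f π' ω =
      ∑ k : Fin n → Fin π.N, ∑ k' : Fin n → Fin π'.N,
        ((∏ l, π.len (k l))⁻¹ * (∫ u in Set.univ.pi (fun l => π.cell (k l)), f u)) *
        ((∏ l, π'.len (k' l))⁻¹ * (∫ u in Set.univ.pi (fun l => π'.cell (k' l)), f u)) *
        ((∏ l, (W (i l) (π.pt (k l).succ) ω - W (i l) (π.pt (k l).castSucc) ω)) *
      (∏ l, (W (i l) (π'.pt (k' l).succ) ω - W (i l) (π'.pt (k' l).castSucc) ω))) := by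
    intro ω
    rw [stratonovichSum, stratonovichSum, Finset.sum_mul_sum]
    refine Finset.sum_congr rfl fun k _ => Finset.sum_congr rfl fun k' _ => by ring
  have e2 : ∀ y z, stepAvg f π y * stepAvg f π' z =
      ∑ k : Fin n → Fin π.N, ∑ k' : Fin n → Fin π'.N,
        ((∏ l, π.len (k l))⁻¹ * (∫ u in Set.univ.pi (fun l => π.cell (k l)), f u)) *
        ((∏ l, π'.len (k' l))⁻¹ * (∫ u in Set.univ.pi (fun l => π'.cell (k' l)), f u)) *
        ((∏ l, (π.cell (k l)).indicator 1 (y l)) *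
          ∏ l, (π'.cell (k' l)).indicator 1 (z l)) := by
    intro y z
    rw [stepAvg, stepAvg, Finset.sum_mul_sum]
    refine Finset.sum_congr rfl fun k _ => Finset.sum_congr rfl fun k' _ => by ring
  simp_rw [e1, e2]
  have hI := fun k k' => (integral_prod_incr hW i π π' k k').1
  refine ⟨integrable_finsetSum _ fun k _ => integrable_finsetSum _ fun k' _ =>
    (hI k k').const_mul _, ?_⟩
  rw [integral_finsetSum _ fun k _ => integrable_finsetSum _ fun k' _ => (hI k k').const_mul _]
  have e3 : ∀ e : (Fin n × Bool) ≃ (Fin n ⊕ Fin n), pairingWeight i e *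
      ∫ x : Fin n → ℝ, ∑ k : Fin n → Fin π.N, ∑ k' : Fin n → Fin π'.N,
        ((∏ l, π.len (k l))⁻¹ * (∫ u in Set.univ.pi (fun l => π.cell (k l)), f u)) *
        ((∏ l, π'.len (k' l))⁻¹ * (∫ u in Set.univ.pi (fun l => π'.cell (k' l)), f u)) *
        ((∏ l, (π.cell (k l)).indicator 1 (x (pairLabel e (Sum.inl l)))) *
          ∏ l, (π'.cell (k' l)).indicator 1 (x (pairLabel e (Sum.inr l)))) =
      ∑ k : Fin n → Fin π.N, ∑ k' : Fin n → Fin π'.N, pairingWeight i e *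
        (((∏ l, π.len (k l))⁻¹ * (∫ u in Set.univ.pi (fun l => π.cell (k l)), f u)) *
        ((∏ l, π'.len (k' l))⁻¹ * (∫ u in Set.univ.pi (fun l => π'.cell (k' l)), f u)) *
        ∫ x : Fin n → ℝ, ((∏ l, (π.cell (k l)).indicator 1 (x (pairLabel e (Sum.inl l)))) *
          ∏ l, (π'.cell (k' l)).indicator 1 (x (pairLabel e (Sum.inr l))))) := by
    intro e
    have hJ := fun k k' => integrable_prod_indicator_pairs π π' k k' e
    rw [integral_finsetSum _ fun k _ => integrable_finsetSum _ fun k' _ =>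
      (hJ k k').const_mul _, Finset.mul_sum]
    refine Finset.sum_congr rfl fun k _ => ?_
    rw [integral_finsetSum _ fun k' _ => (hJ k k').const_mul _, Finset.mul_sum]
    refine Finset.sum_congr rfl fun k' _ => ?_
    rw [integral_const_mul]
  simp_rw [e3]
  rw [Finset.sum_comm, Finset.mul_sum]
  refine Finset.sum_congr rfl fun k _ => ?_
  rw [integral_finsetSum _ fun k' _ => (hI k k').const_mul _, Finset.sum_comm, Finset.mul_sum]
  refine Finset.sum_congr rfl fun k' _ => ?_
  rw [integral_const_mul, (integral_prod_incr hW i π π' k k').2, Finset.mul_sum, Finset.mul_sum,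
    Finset.mul_sum]
  refine Finset.sum_congr rfl fun e _ => by ring

lemma memLp_stratonovichSum (hW : IsWienerProcess W P) (i : Fin n → Fin d)
    (f : (Fin n → ℝ) → ℝ) (π : IntervalPartition T) : MemLp (stratonovichSum W i f π) 2 P := by
  rw [memLp_two_iff_integrable_sq (stratonovichSum_aemeasurable hW i f π).aestronglyMeasurable]
  simpa only [sq] using (integral_stratonovichSum_mul hW i f π π).1

end SecondMoment

/-! ### Convergence in mean square -/

/-- A family in `L²` whose mixed second moments converge has an `L²`-limit, and the second moments
converge to the second moment of the limit. -/
lemma exists_L2_limit {Ω ι : Type*} [MeasurableSpace Ω] {P : Measure Ω} {l : Filter ι} [l.NeBot]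
    {X : ι → Ω → ℝ} (hX : ∀ i, MemLp (X i) 2 P) {c : ℝ}
    (h : Tendsto (fun p : ι × ι => ∫ ω, X p.1 ω * X p.2 ω ∂P) (l ×ˢ l) (𝓝 c)) :
    ∃ I : Ω → ℝ, MemLp I 2 P ∧ Tendsto (fun i => eLpNorm (fun ω => X i ω - I ω) 2 P) l (𝓝 0) ∧
      ∫ ω, I ω ^ 2 ∂P = c := by
  let Y : ι → Lp ℝ 2 P := fun i => (hX i).toLp
  have hin : ∀ i j, inner ℝ (Y i) (Y j) = ∫ ω, X i ω * X j ω ∂P := by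
    intro i j
    rw [L2.inner_def]
    refine integral_congr_ae ?_
    filter_upwards [(hX i).coeFn_toLp, (hX j).coeFn_toLp] with ω h1 h2
    simp only [Y, h1, h2]
    simp [mul_comm]
  have hdiag : Tendsto (fun i => ∫ ω, X i ω * X i ω ∂P) l (𝓝 c) :=
    h.comp (tendsto_id.prodMk tendsto_id)
  have hnorm : Tendsto (fun p : ι × ι => ‖Y p.1 - Y p.2‖ ^ 2) (l ×ˢ l) (𝓝 0) := by
    have h1 : ∀ p : ι × ι, ‖Y p.1 - Y p.2‖ ^ 2 = (∫ ω, X p.1 ω * X p.1 ω ∂P) -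
        2 * (∫ ω, X p.1 ω * X p.2 ω ∂P) + ∫ ω, X p.2 ω * X p.2 ω ∂P := by
      intro p
      rw [← real_inner_self_eq_norm_sq, inner_sub_sub_self]
      simp only [hin]
      rw [integral_congr_ae (g := fun ω => X p.1 ω * X p.2 ω)
        (Eventually.of_forall fun ω => mul_comm _ _)]
      ring
    simp_rw [h1]
    have := ((hdiag.comp tendsto_fst).sub (h.const_mul 2)).add (hdiag.comp (tendsto_snd (f := l)))
    refine (this.congr fun p => rfl).trans (le_of_eq ?_)
    congr 1
    ring
  have hcau : Cauchy (map Y l) := by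
    rw [cauchy_map_iff]
    refine ⟨inferInstance, ?_⟩
    rw [Metric.uniformity_eq_comap_nhds_zero, tendsto_comap_iff]
    have h2 : Tendsto (fun p : ι × ι => Real.sqrt (‖Y p.1 - Y p.2‖ ^ 2)) (l ×ˢ l) (𝓝 0) := by
      simpa using hnorm.sqrt
    refine h2.congr fun p => ?_
    rw [Real.sqrt_sq (norm_nonneg _), ← dist_eq_norm]
    rfl
  obtain ⟨J, hJ⟩ := CompleteSpace.complete hcau
  have hJ' : Tendsto Y l (𝓝 J) := hJ
  refine ⟨J, Lp.memLp J, ?_, ?_⟩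
  · have h3 : Tendsto (fun i => edist (Y i) J) l (𝓝 0) := tendsto_iff_edist_tendsto_0.1 hJ'
    refine h3.congr fun i => ?_
    rw [Lp.edist_def]
    refine eLpNorm_congr_ae ?_
    filter_upwards [(hX i).coeFn_toLp] with ω h1
    simp [Y, h1]
  · have h4 : Tendsto (fun i => inner ℝ (Y i) (Y i)) l (𝓝 (inner ℝ J J)) := hJ'.inner hJ'
    simp_rw [hin] at h4
    have h5 := tendsto_nhds_unique h4 hdiag
    rw [← h5, L2.inner_def]
    refine integral_congr_ae (Eventually.of_forall fun ω => ?_)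
    simp [sq]

/-! ### The cells of a partition -/

namespace IntervalPartition

variable {T : ℝ≥0} (π : IntervalPartition T)

lemma len_pos (k : Fin π.N) : 0 < π.len k :=
  sub_pos.2 (NNReal.coe_lt_coe.2 (π.strictMono (Fin.castSucc_lt_succ (i := k))))

lemma len_le_mesh (k : Fin π.N) : π.len k ≤ π.mesh :=
  le_ciSup (Set.finite_range _).bddAbove k

lemma exists_mem_cell {y : ℝ} (h0 : 0 < y) (hT : y ≤ T) : ∃ k, y ∈ π.cell k := by
  have key : ∀ m : ℕ, ∀ hm : m < π.N + 1, y ≤ π.pt ⟨m, hm⟩ → ∃ k, y ∈ π.cell k := by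
    intro m
    induction m with
    | zero =>
      intro hm h
      have : π.pt ⟨0, hm⟩ = 0 := π.pt_zero
      rw [this] at h
      exact absurd h (by simpa using h0)
    | succ m ih =>
      intro hm h
      by_cases h' : y ≤ π.pt ⟨m, by omega⟩
      · exact ih _ h'
      · exact ⟨⟨m, by omega⟩, not_le.1 h', h⟩
  refine key π.N (Nat.lt_succ_self _) ?_
  have : π.pt ⟨π.N, Nat.lt_succ_self _⟩ = T := π.pt_last
  rw [this]
  exact hT

lemma cell_subset (k : Fin π.N) : π.cell k ⊆ Set.Ioc 0 (T : ℝ) := by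
  intro y hy
  refine ⟨(NNReal.coe_nonneg _).trans_lt hy.1, hy.2.trans (NNReal.coe_le_coe.2 ?_)⟩
  exact (π.strictMono.monotone (Fin.le_last _)).trans π.pt_last.le

lemma eq_of_mem_cell {y : ℝ} {k k' : Fin π.N} (h : y ∈ π.cell k) (h' : y ∈ π.cell k') :
    k = k' := by
  have aux : ∀ {a b : Fin π.N}, y ∈ π.cell a → y ∈ π.cell b → ¬ a < b := by
    intro a b ha hb hab
    have : π.pt a.succ ≤ π.pt b.castSucc := π.strictMono.monotone (by
      rw [Fin.le_def, Fin.val_succ, Fin.val_castSucc]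
      exact hab)
    exact absurd (ha.2.trans (NNReal.coe_le_coe.2 this)) (not_le.2 hb.1)
  exact le_antisymm (not_lt.1 (aux h' h)) (not_lt.1 (aux h h'))

/-- The left end point of the cell that contains `y` (and `0` if there is none). -/
def leftAt (y : ℝ) : ℝ := ∑ k, (π.cell k).indicator (fun _ => (π.pt k.castSucc : ℝ)) y

/-- The length of the cell that contains `y` (and `0` if there is none). -/
def lenAt (y : ℝ) : ℝ := ∑ k, (π.cell k).indicator (fun _ => π.len k) y

lemma sum_indicator_cell {y : ℝ} {k : Fin π.N} (h : y ∈ π.cell k) (c : Fin π.N → ℝ) :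
    ∑ k, (π.cell k).indicator (fun _ => c k) y = c k := by
  rw [Finset.sum_eq_single k, Set.indicator_of_mem h]
  · intro k' _ hk'
    exact Set.indicator_of_notMem (fun h' => hk' (π.eq_of_mem_cell h' h)) _
  · simp

lemma leftAt_eq {y : ℝ} {k : Fin π.N} (h : y ∈ π.cell k) : π.leftAt y = π.pt k.castSucc :=
  π.sum_indicator_cell h _

lemma lenAt_eq {y : ℝ} {k : Fin π.N} (h : y ∈ π.cell k) : π.lenAt y = π.len k :=
  π.sum_indicator_cell h _

lemma lenAt_pos {y : ℝ} (h0 : 0 < y) (hT : y ≤ T) : 0 < π.lenAt y := by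
  obtain ⟨k, hk⟩ := π.exists_mem_cell h0 hT
  rw [π.lenAt_eq hk]
  exact π.len_pos k

lemma abs_point_sub_le {y : ℝ} (h0 : 0 < y) (hT : y ≤ T) {v : ℝ} (hv : v ∈ Set.Ioc (0 : ℝ) 1) :
    |π.leftAt y + π.lenAt y * v - y| ≤ π.mesh := by
  obtain ⟨k, hk⟩ := π.exists_mem_cell h0 hT
  rw [π.lenAt_eq hk, π.leftAt_eq hk]
  have h1 := π.len_pos k
  have h2 := π.len_le_mesh k
  have h3 : (π.pt k.succ : ℝ) = π.pt k.castSucc + π.len k := by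
    unfold len
    ring
  have h4 := hk.1
  have h5 := hk.2
  rw [h3] at h5
  have h6 : π.len k * v ≤ π.len k := by nlinarith [hv.2]
  have h7 : 0 < π.len k * v := mul_pos h1 hv.1
  rw [abs_le]
  constructor <;> linarith

lemma eventually_mesh_lt (T : ℝ≥0) {ε : ℝ} (hε : 0 < ε) : ∀ᶠ π in meshToZero T, π.mesh < ε :=
  (tendsto_comap (f := mesh (T := T)) (x := 𝓝 0)).eventually_lt_const hε

instance (T : ℝ≥0) : (meshToZero T).IsCountablyGenerated := by
  unfold meshToZero
  infer_instance

end IntervalPartition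

/-! ### Cell averages and their limits -/

section StepAvg

variable {n : ℕ} {T : ℝ≥0}

/-- The unit cube `(0, 1]^n`. -/
def unitCube (n : ℕ) : Set (Fin n → ℝ) := Set.univ.pi fun _ => Set.Ioc 0 1

lemma measurableSet_unitCube : MeasurableSet (unitCube n) :=
  MeasurableSet.univ_pi fun _ => measurableSet_Ioc

lemma volume_unitCube : volume (unitCube n) = 1 := by
  rw [unitCube, Real.volume_pi_Ioc]
  simp

lemma setIntegral_pi_Ioc_eq_unitCube (f : (Fin n → ℝ) → ℝ) (a D : Fin n → ℝ)
    (hD : ∀ l, 0 < D l) :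
    ∫ u in Set.univ.pi (fun l => Set.Ioc (a l) (a l + D l)), f u =
      (∏ l, D l) * ∫ v in unitCube n, f (fun l => a l + D l * v l) := by
  have hdet : (Matrix.diagonal D).det ≠ 0 := by
    rw [Matrix.det_diagonal]
    exact Finset.prod_ne_zero_iff.2 fun l _ => (hD l).ne'
  have hmap := Real.smul_map_diagonal_volume_pi hdet
  rw [Matrix.det_diagonal, abs_of_pos (Finset.prod_pos fun l _ => hD l)] at hmap
  have hlin : ∀ v, Matrix.toLin' (Matrix.diagonal D) v = fun l => D l * v l := by
    intro v
    ext l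
    rw [Matrix.toLin'_apply, Matrix.mulVec_diagonal]
  have hemb : MeasurableEmbedding (Matrix.toLin' (Matrix.diagonal D)) := by
    refine Continuous.measurableEmbedding ?_ ?_
    · exact LinearMap.continuous_of_finiteDimensional _
    · intro v w h
      rw [hlin, hlin] at h
      ext l
      exact mul_left_cancel₀ (hD l).ne' (congrFun h l)
  rw [← integral_indicator (MeasurableSet.univ_pi fun _ => measurableSet_Ioc),
    ← integral_indicator measurableSet_unitCube]
  rw [← integral_add_left_eq_self _ a]
  conv_lhs => rw [← hmap]
  rw [integral_smul_measure, hemb.integral_map, ENNReal.toReal_ofReal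
    (Finset.prod_nonneg fun l _ => (hD l).le), smul_eq_mul]
  congr 1
  refine integral_congr_ae (Eventually.of_forall fun v => ?_)
  simp only [hlin]
  have hiff : (a + fun l => D l * v l) ∈ Set.univ.pi (fun l => Set.Ioc (a l) (a l + D l)) ↔
      v ∈ unitCube n := by
    simp only [unitCube, Set.mem_univ_pi, Pi.add_apply, Set.mem_Ioc]
    refine forall_congr' fun l => ?_
    have := hD l
    constructor
    · rintro ⟨h1, h2⟩
      exact ⟨by nlinarith, by nlinarith⟩
    · rintro ⟨h1, h2⟩
      exact ⟨by nlinarith, by nlinarith⟩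
  by_cases hv : v ∈ unitCube n
  · rw [Set.indicator_of_mem hv, Set.indicator_of_mem (hiff.2 hv)]
    rfl
  · rw [Set.indicator_of_notMem hv, Set.indicator_of_notMem (fun h => hv (hiff.1 h))]

lemma stepAvg_eq_of_mem (f : (Fin n → ℝ) → ℝ) (π : IntervalPartition T) {y : Fin n → ℝ}
    {k : Fin n → Fin π.N} (hk : ∀ l, y l ∈ π.cell (k l)) :
    stepAvg f π y = (∏ l, π.len (k l))⁻¹ *
      ∫ u in Set.univ.pi (fun l => π.cell (k l)), f u := by
  rw [stepAvg, Finset.sum_eq_single k]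
  · have h1 : ∏ l, (π.cell (k l)).indicator (1 : ℝ → ℝ) (y l) = 1 :=
      Finset.prod_eq_one fun l _ => Set.indicator_of_mem (hk l) _
    rw [h1, mul_one]
  · intro k' _ hk'
    obtain ⟨l, hl⟩ := Function.ne_iff.1 hk'
    have h1 : ∏ l, (π.cell (k' l)).indicator (1 : ℝ → ℝ) (y l) = 0 :=
      Finset.prod_eq_zero (Finset.mem_univ l)
        (Set.indicator_of_notMem (fun h => hl (π.eq_of_mem_cell h (hk l))) _)
    rw [h1, mul_zero]
  · simp

lemma stepAvg_eq_zero (f : (Fin n → ℝ) → ℝ) (π : IntervalPartition T) {y : Fin n → ℝ}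
    {l : Fin n} (hl : y l ∉ Set.Ioc 0 (T : ℝ)) : stepAvg f π y = 0 := by
  refine Finset.sum_eq_zero fun k _ => ?_
  have h1 : ∏ l, (π.cell (k l)).indicator (1 : ℝ → ℝ) (y l) = 0 :=
    Finset.prod_eq_zero (Finset.mem_univ l)
      (Set.indicator_of_notMem (fun h => hl (π.cell_subset _ h)) _)
  rw [h1, mul_zero]

lemma measurable_stepAvg (f : (Fin n → ℝ) → ℝ) (π : IntervalPartition T) :
    Measurable (stepAvg f π) := by
  unfold stepAvg
  refine Finset.measurable_fun_sum _ fun k _ => Measurable.const_mul ?_ _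
  refine Finset.measurable_fun_prod _ fun l _ => ?_
  exact (measurable_one.indicator measurableSet_Ioc).comp (measurable_pi_apply l)

lemma stepAvg_eq_integral_unitCube (f : (Fin n → ℝ) → ℝ) (π : IntervalPartition T)
    {y : Fin n → ℝ} (hy : ∀ l, y l ∈ Set.Ioc 0 (T : ℝ)) :
    stepAvg f π y = ∫ v in unitCube n, f (fun l => π.leftAt (y l) + π.lenAt (y l) * v l) := by
  choose k hk using fun l => π.exists_mem_cell (hy l).1 (hy l).2
  rw [stepAvg_eq_of_mem f π hk]
  have h1 : ∀ l, π.cell (k l) =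
      Set.Ioc (π.leftAt (y l)) (π.leftAt (y l) + π.lenAt (y l)) := by
    intro l
    rw [π.leftAt_eq (hk l), π.lenAt_eq (hk l)]
    unfold IntervalPartition.cell IntervalPartition.len
    congr 1
    ring
  have h2 : ∀ l, π.len (k l) = π.lenAt (y l) := fun l => (π.lenAt_eq (hk l)).symm
  simp_rw [h1, h2]
  rw [setIntegral_pi_Ioc_eq_unitCube _ _ _ fun l => π.lenAt_pos (hy l).1 (hy l).2,
    inv_mul_cancel_left₀]
  exact Finset.prod_ne_zero_iff.2 fun l _ => (π.lenAt_pos (hy l).1 (hy l).2).ne'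

/-- If the one-dimensional majorant `G` of `f` satisfies the Muckenhoupt `A₁` condition, then the
cell averages of `f` are dominated pointwise, uniformly in the partition. -/
lemma abs_stepAvg_le {f : (Fin n → ℝ) → ℝ} {G : ℝ → ℝ} {M : ℝ} {bad : Set ℝ}
    (hG0 : ∀ u, 0 ≤ G u)
    (hGi : ∀ a b, IntegrableOn G (Set.Ioc a b))
    (hfG : ∀ u, |f u| ≤ ∏ l, G (u l))
    (hA1 : ∀ a b x, x ∈ Set.Ioc a b → x ∉ bad → ∫ u in Set.Ioc a b, G u ≤ (b - a) * (M * G x))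
    (π : IntervalPartition T) {y : Fin n → ℝ} (hy : ∀ l, y l ∈ Set.Ioc 0 (T : ℝ))
    (hbad : ∀ l, y l ∉ bad) :
    |stepAvg f π y| ≤ ∏ l, M * G (y l) := by
  choose k hk using fun l => π.exists_mem_cell (hy l).1 (hy l).2
  rw [stepAvg_eq_of_mem f π hk, abs_mul, abs_inv,
    abs_of_pos (Finset.prod_pos fun l _ => π.len_pos _)]
  have hpos : 0 < ∏ l, π.len (k l) := Finset.prod_pos fun l _ => π.len_pos _
  rw [inv_mul_le_iff₀ hpos, ← Finset.prod_mul_distrib]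
  have hrestr : (volume : Measure (Fin n → ℝ)).restrict
      (Set.univ.pi fun l => π.cell (k l)) =
      Measure.pi fun l => volume.restrict (π.cell (k l)) := by
    rw [volume_pi, Measure.restrict_pi_pi]
  calc |∫ u in Set.univ.pi (fun l => π.cell (k l)), f u|
      ≤ ∫ u in Set.univ.pi (fun l => π.cell (k l)), ∏ l, G (u l) := by
        refine norm_integral_le_of_norm_le (f := f) (g := fun u => ∏ l, G (u l)) ?_
          (Eventually.of_forall hfG)
        rw [hrestr]
        exact Integrable.fintype_prod (f := fun _ => G) fun l => hGi _ _
    _ = ∏ l, ∫ u in π.cell (k l), G u := by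
        rw [hrestr, integral_fintype_prod_eq_prod (fun _ => G)]
    _ ≤ ∏ l, π.len (k l) * (M * G (y l)) :=
        Finset.prod_le_prod (fun l _ => integral_nonneg hG0)
          fun l _ => hA1 _ _ _ (hk l) (hbad l)

/-- The order of two points in rescaled cells is eventually the lexicographic order of the base
points and the positions inside the cells. -/
lemma eventually_point_order {y y' : ℝ} (hy : y ∈ Set.Ioc 0 (T : ℝ))
    (hy' : y' ∈ Set.Ioc 0 (T : ℝ)) :
    ∀ᶠ π in IntervalPartition.meshToZero T, ∀ v ∈ Set.Ioc (0 : ℝ) 1, ∀ v' ∈ Set.Ioc (0 : ℝ) 1,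
      (π.leftAt y + π.lenAt y * v < π.leftAt y' + π.lenAt y' * v' ↔
        y < y' ∨ (y = y' ∧ v < v')) ∧
      (π.leftAt y + π.lenAt y * v ≤ π.leftAt y' + π.lenAt y' * v' ↔
        y < y' ∨ (y = y' ∧ v ≤ v')) := by
  rcases eq_or_ne y y' with rfl | hne
  · refine Eventually.of_forall fun π v hv v' hv' => ?_
    have := π.lenAt_pos hy.1 hy.2
    simp [this]
  · have hpos : 0 < |y - y'| / 2 := by
      have := abs_pos.2 (sub_ne_zero.2 hne)
      positivity
    filter_upwards [IntervalPartition.eventually_mesh_lt T hpos] with π hπ v hv v' hv'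
    have h1 := abs_le.1 (π.abs_point_sub_le hy.1 hy.2 hv)
    have h2 := abs_le.1 (π.abs_point_sub_le hy'.1 hy'.2 hv')
    simp only [hne, false_and, or_false]
    rcases lt_or_gt_of_ne hne with h | h
    · rw [abs_of_neg (by linarith)] at hπ
      exact ⟨iff_of_true (by linarith) h, iff_of_true (by linarith) h⟩
    · rw [abs_of_pos (by linarith)] at hπ
      exact ⟨iff_of_false (by linarith) (by linarith), iff_of_false (by linarith) (by linarith)⟩

open Classical in
/-- The cell averages of a function that is continuous up to the indicator function of the region
`A_j^n` converge, also at points with coinciding coordinates. There the limit carries the factor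
given by the proportion of a small cube that is occupied by the region. -/
lemma exists_tendsto_stepAvg {f g : (Fin n → ℝ) → ℝ} {j : Fin n} {t : ℝ}
    (hf : Measurable f) (hfg : ∀ u, f u = if u ∈ regionA j t then g u else 0)
    {y : Fin n → ℝ} (hyt : ∀ l, y l ≠ t)
    (hg : (∀ l, 0 < y l ∧ y l < t) → ContinuousAt g y) :
    ∃ L, Tendsto (fun π : IntervalPartition T => stepAvg f π y)
      (IntervalPartition.meshToZero T) (𝓝 L) ∧
      |L| ≤ if ∀ l, 0 < y l ∧ y l < t ∧ y j ≤ y l then |g y| else 0 := by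
  by_cases hy : ∀ l, y l ∈ Set.Ioc 0 (T : ℝ)
  swap
  · push Not at hy
    obtain ⟨l, hl⟩ := hy
    refine ⟨0, ?_, ?_⟩
    · simp_rw [fun π => stepAvg_eq_zero (T := T) f π hl]
      exact tendsto_const_nhds
    · rw [abs_zero]
      split_ifs <;> simp
  set pt : IntervalPartition T → (Fin n → ℝ) → (Fin n → ℝ) :=
    fun π v l => π.leftAt (y l) + π.lenAt (y l) * v l with hpt
  have hord : ∀ᶠ π in IntervalPartition.meshToZero T, ∀ l m, ∀ v ∈ unitCube n,
      (pt π v l < pt π v m ↔ y l < y m ∨ (y l = y m ∧ v l < v m)) ∧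
      (pt π v l ≤ pt π v m ↔ y l < y m ∨ (y l = y m ∧ v l ≤ v m)) := by
    rw [eventually_all]
    intro l
    rw [eventually_all]
    intro m
    filter_upwards [eventually_point_order (hy l) (hy m)] with π hπ v hv
    exact hπ _ (hv l trivial) _ (hv m trivial)
  have hmem : ∀ᶠ π in IntervalPartition.meshToZero T, ∀ l, ∀ v ∈ unitCube n,
      (pt π v l ∈ Set.Icc 0 t ↔ y l < t) := by
    rw [eventually_all]
    intro l
    have hp : 0 < min (y l) |y l - t| := lt_min (hy l).1 (abs_pos.2 (sub_ne_zero.2 (hyt l)))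
    filter_upwards [IntervalPartition.eventually_mesh_lt T hp] with π hπ v hv
    have h1 := abs_le.1 (π.abs_point_sub_le (hy l).1 (hy l).2 (hv l trivial))
    have h2 := hπ.trans_le (min_le_left _ _)
    have h3 := hπ.trans_le (min_le_right _ _)
    simp only [hpt, Set.mem_Icc]
    rcases lt_or_gt_of_ne (hyt l) with h | h
    · rw [abs_of_neg (by linarith)] at h3
      exact iff_of_true ⟨by linarith, by linarith⟩ h
    · rw [abs_of_pos (by linarith)] at h3
      exact iff_of_false (fun h' => by linarith [h'.2]) (by linarith)
  -- the part of the unit cube that is mapped into the region once the mesh is small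
  set A' : Set (Fin n → ℝ) := {v | (∀ l, y l < t) ∧
    (∀ l, y j < y l ∨ (y j = y l ∧ v j ≤ v l)) ∧
    (∀ l m, l < m → m < j → y m < y l ∨ (y m = y l ∧ v m < v l)) ∧
    (∀ l m, j < l → l < m → y l < y m ∨ (y l = y m ∧ v l < v m))} with hA'
  have hregion : ∀ᶠ π in IntervalPartition.meshToZero T, ∀ v ∈ unitCube n,
      (pt π v ∈ regionA j t ↔ v ∈ A') := by
    filter_upwards [hord, hmem] with π h1 h2 v hv
    simp only [regionA, hA', Set.mem_ofPred_eq]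
    refine and_congr (forall_congr' fun l => h2 l v hv) (and_congr
      (forall_congr' fun l => (h1 j l v hv).2) (and_congr ?_ ?_))
    · exact forall_congr' fun l => forall_congr' fun m => imp_congr Iff.rfl
        (imp_congr Iff.rfl (h1 m l v hv).1)
    · exact forall_congr' fun l => forall_congr' fun m => imp_congr Iff.rfl
        (imp_congr Iff.rfl (h1 l m v hv).1)
  by_cases hgood : ∀ l, 0 < y l ∧ y l < t ∧ y j ≤ y l
  · have hgc := hg fun l => ⟨(hgood l).1, (hgood l).2.1⟩
    have hclose : ∀ ε > 0, ∀ᶠ π in IntervalPartition.meshToZero T, ∀ v ∈ unitCube n,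
        |g (pt π v) - g y| < ε := by
      intro ε hε
      obtain ⟨δ, hδ, h⟩ := Metric.continuousAt_iff.1 hgc ε hε
      filter_upwards [IntervalPartition.eventually_mesh_lt T hδ] with π hπ v hv
      refine h ((dist_pi_lt_iff hδ).2 fun l => ?_)
      exact (π.abs_point_sub_le (hy l).1 (hy l).2 (hv l trivial)).trans_lt hπ
    refine ⟨∫ v in unitCube n, if v ∈ A' then g y else 0, ?_, ?_⟩
    · simp_rw [fun π => stepAvg_eq_integral_unitCube (T := T) f π hy]
      have hvol : volume (unitCube n) ≠ ∞ := by simp [volume_unitCube]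
      refine tendsto_integral_filter_of_dominated_convergence (fun _ => |g y| + 1) ?_ ?_ ?_ ?_
      · refine Eventually.of_forall fun π => (hf.comp ?_).aestronglyMeasurable
        fun_prop
      · filter_upwards [hclose 1 one_pos] with π hπ
        refine (ae_restrict_iff' measurableSet_unitCube).2 (Eventually.of_forall fun v hv => ?_)
        have h1 := hπ v hv
        rw [Real.norm_eq_abs, hfg]
        split_ifs
        · have := abs_sub_abs_le_abs_sub (g (pt π v)) (g y)
          change |g (pt π v)| ≤ _
          linarith
        · rw [abs_zero]
          positivity
      · exact integrableOn_const hvol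
      · refine (ae_restrict_iff' measurableSet_unitCube).2 (Eventually.of_forall fun v hv => ?_)
        have h1 : ∀ᶠ π in IntervalPartition.meshToZero T,
            (if v ∈ A' then g (pt π v) else 0) = f (pt π v) := by
          filter_upwards [hregion] with π hπ
          rw [hfg, if_congr (hπ v hv) rfl rfl]
        refine Tendsto.congr' h1 ?_
        split_ifs
        · rw [Metric.tendsto_nhds]
          intro ε hε
          filter_upwards [hclose ε hε] with π hπ
          exact hπ v hv
        · exact tendsto_const_nhds
    · rw [if_pos hgood]
      have hvol : volume (unitCube n) < ∞ := by simp [volume_unitCube]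
      have := norm_setIntegral_le_of_norm_le_const (μ := volume) (s := unitCube n)
        (f := fun v => if v ∈ A' then g y else 0) (C := |g y|) hvol (fun v _ => by
          split_ifs <;> simp)
      simpa [measureReal_def, volume_unitCube] using this
  · refine ⟨0, ?_, ?_⟩
    · refine tendsto_const_nhds.congr' ?_
      filter_upwards [hregion] with π hπ
      rw [stepAvg_eq_integral_unitCube f π hy]
      symm
      refine setIntegral_eq_zero_of_forall_eq_zero fun v hv => ?_
      rw [hfg, if_neg]
      intro h
      have h1 := (hπ v hv).1 h
      refine hgood fun l => ⟨(hy l).1, h1.1 l, ?_⟩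
      rcases h1.2.1 l with h2 | h2
      · exact h2.le
      · exact h2.1.le
    · rw [if_neg hgood, abs_zero]

end StepAvg

/-! ### Existence of the Stratonovich integral -/

section Existence

variable {Ω : Type*} [MeasurableSpace Ω] {P : Measure Ω} {d n : ℕ} {W : Fin d → ℝ≥0 → Ω → ℝ}
  {T : ℝ≥0}

open Classical in
/-- The function `|g|`, restricted to the part of `(0, t)^n` where the `j`-th coordinate is
minimal. -/
def minRegionAbs (g : (Fin n → ℝ) → ℝ) (j : Fin n) (t : ℝ) (y : Fin n → ℝ) : ℝ :=
  if ∀ l, 0 < y l ∧ y l < t ∧ y j ≤ y l then |g y| else 0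

lemma minRegionAbs_nonneg (g : (Fin n → ℝ) → ℝ) (j : Fin n) (t : ℝ) (y : Fin n → ℝ) :
    0 ≤ minRegionAbs g j t y := by
  unfold minRegionAbs
  split_ifs
  · exact abs_nonneg _
  · exact le_rfl

lemma ae_forall_notMem_of_countable {bad : Set ℝ} (hbad : bad.Countable) :
    ∀ᵐ x : Fin n → ℝ, ∀ c, x c ∉ bad := by
  rw [ae_all_iff]
  intro c
  have h : ∀ᵐ z : ℝ, z ∉ bad := hbad.ae_notMem _
  exact (Measure.quasiMeasurePreserving_eval (fun _ : Fin n => (volume : Measure ℝ)) c).ae h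

open Classical in
/-- The mixed second moments of the cell averages converge for every pairing. Each variable `x c`
is hit by exactly two half-edges, so that `∏ c, G (x c) ^ 2` is an integrable majorant. -/
lemma tendsto_integral_stepAvg_mul {f g : (Fin n → ℝ) → ℝ} {j : Fin n} {t : ℝ}
    {G : ℝ → ℝ} {M : ℝ} {bad : Set ℝ}
    (hf : Measurable f) (hfg : ∀ u, f u = if u ∈ regionA j t then g u else 0)
    (hG0 : ∀ u, 0 ≤ G u) (hGi : ∀ a b, IntegrableOn G (Set.Ioc a b))
    (hG2 : IntegrableOn (fun u => G u ^ 2) (Set.Icc 0 (T : ℝ)))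
    (hfG : ∀ u, |f u| ≤ ∏ l, G (u l))
    (hA1 : ∀ a b x, x ∈ Set.Ioc a b → x ∉ bad → ∫ u in Set.Ioc a b, G u ≤ (b - a) * (M * G x))
    (hbad : bad.Countable) (ht : t ∈ bad)
    (hg : ∀ y : Fin n → ℝ, (∀ l, 0 < y l ∧ y l < t ∧ y l ∉ bad) → ContinuousAt g y)
    (e : (Fin n × Bool) ≃ (Fin n ⊕ Fin n)) {B : ℝ} (hB0 : 0 ≤ B)
    (hB : ∫⁻ x : Fin n → ℝ, ENNReal.ofReal
      (minRegionAbs g j t (fun l => x (pairLabel e (Sum.inl l))) *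
        minRegionAbs g j t (fun l => x (pairLabel e (Sum.inr l)))) ≤ ENNReal.ofReal B) :
    ∃ L, L ≤ B ∧ Tendsto (fun p : IntervalPartition T × IntervalPartition T =>
      ∫ x : Fin n → ℝ, stepAvg f p.1 (fun l => x (pairLabel e (Sum.inl l))) *
          stepAvg f p.2 (fun l => x (pairLabel e (Sum.inr l))))
      (IntervalPartition.meshToZero T ×ˢ IntervalPartition.meshToZero T) (𝓝 L) := by
  have hex : ∀ y : Fin n → ℝ, (∀ l, y l ∉ bad) →
      ∃ L, Tendsto (fun π : IntervalPartition T => stepAvg f π y)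
        (IntervalPartition.meshToZero T) (𝓝 L) ∧ |L| ≤ minRegionAbs g j t y := by
    intro y hy
    exact exists_tendsto_stepAvg hf hfg (fun l h => hy l (h ▸ ht))
      fun h => hg y fun l => ⟨(h l).1, (h l).2, hy l⟩
  choose! L hL hLle using hex
  set h : ℝ → ℝ := (Set.Ioc 0 (T : ℝ)).indicator fun u => (M * G u) * (M * G u) with hh
  have hhi : Integrable h := by
    rw [hh, integrable_indicator_iff measurableSet_Ioc]
    have := (hG2.mono_set Set.Ioc_subset_Icc_self).const_mul (M ^ 2)
    refine this.congr (Eventually.of_forall fun u => ?_)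
    simp only
    ring
  have hMG : ∀ u, u ∉ bad → u ∈ Set.Ioc 0 (T : ℝ) → 0 ≤ M * G u := by
    intro u hu huT
    have h1 := hA1 0 T u huT hu
    have h2 : 0 ≤ ∫ u in Set.Ioc 0 (T : ℝ), G u := integral_nonneg hG0
    have h3 : (0 : ℝ) < T - 0 := by linarith [huT.1, huT.2]
    exact nonneg_of_mul_nonneg_right (h2.trans h1) h3
  refine ⟨∫ x : Fin n → ℝ, L (fun l => x (pairLabel e (Sum.inl l))) *
    L (fun l => x (pairLabel e (Sum.inr l))), ?_, ?_⟩
  · have h1 : ∀ᵐ x : Fin n → ℝ, ‖L (fun l => x (pairLabel e (Sum.inl l))) *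
        L (fun l => x (pairLabel e (Sum.inr l)))‖ₑ ≤ ENNReal.ofReal
      (minRegionAbs g j t (fun l => x (pairLabel e (Sum.inl l))) *
        minRegionAbs g j t (fun l => x (pairLabel e (Sum.inr l)))) := by
      filter_upwards [ae_forall_notMem_of_countable hbad] with x hx
      rw [← ofReal_norm, Real.norm_eq_abs, abs_mul]
      refine ENNReal.ofReal_le_ofReal ?_
      exact mul_le_mul (hLle _ fun l => hx _) (hLle _ fun l => hx _) (abs_nonneg _)
        (minRegionAbs_nonneg _ _ _ _)
    have h2 := (enorm_integral_le_lintegral_enorm _).trans ((lintegral_mono_ae h1).trans hB)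
    rw [← ofReal_norm, ENNReal.ofReal_le_ofReal_iff hB0] at h2
    exact (le_abs_self _).trans h2
  · refine tendsto_integral_filter_of_dominated_convergence (fun x => ∏ c, h (x c)) ?_ ?_ ?_ ?_
    · refine Eventually.of_forall fun p => Measurable.aestronglyMeasurable ?_
      exact ((measurable_stepAvg f p.1).comp (by fun_prop)).mul
        ((measurable_stepAvg f p.2).comp (by fun_prop))
    · refine Eventually.of_forall fun p => ?_
      filter_upwards [ae_forall_notMem_of_countable hbad] with x hx
      by_cases hxT : ∀ c, x c ∈ Set.Ioc 0 (T : ℝ)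
      · have e1 : ∏ c, h (x c) = (∏ l, M * G (x (pairLabel e (Sum.inl l)))) *
            ∏ l, M * G (x (pairLabel e (Sum.inr l))) := by
          rw [← prod_pairs e (fun _ c => M * G (x c))]
          refine Finset.prod_congr rfl fun c _ => ?_
          rw [hh, Set.indicator_of_mem (hxT c)]
        rw [e1, norm_mul]
        refine mul_le_mul ?_ ?_ (norm_nonneg _)
          (Finset.prod_nonneg fun l _ => hMG _ (hx _) (hxT _))
        · exact abs_stepAvg_le hG0 hGi hfG hA1 p.1 (fun l => hxT _) fun l => hx _
        · exact abs_stepAvg_le hG0 hGi hfG hA1 p.2 (fun l => hxT _) fun l => hx _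
      · push Not at hxT
        obtain ⟨c, hc⟩ := hxT
        have e2 : ∏ c, h (x c) = 0 := Finset.prod_eq_zero (Finset.mem_univ c)
          (Set.indicator_of_notMem hc _)
        rw [e2]
        have hlab : pairLabel e (e (c, false)) = c := by simp [pairLabel]
        rcases hs : e (c, false) with l | l <;> rw [hs] at hlab
        · rw [stepAvg_eq_zero f p.1 (l := l) (by rw [hlab]; exact hc), zero_mul, norm_zero]
        · rw [stepAvg_eq_zero f p.2 (l := l) (by rw [hlab]; exact hc), mul_zero, norm_zero]
    · exact Integrable.fintype_prod (f := fun _ => h) fun _ => hhi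
    · filter_upwards [ae_forall_notMem_of_countable hbad] with x hx
      exact ((hL _ fun l => hx _).comp tendsto_fst).mul ((hL _ fun l => hx _).comp tendsto_snd)

open Classical in
/-- A measurable function is Stratonovich integrable if it is continuous up to the indicator
function of `A_j^n` and has a product of square integrable `A₁` weights as a majorant. The second
moment of the integral is controlled by the integrals that belong to the pairings. -/
lemma exists_stratonovichIntegral_le (hW : IsWienerProcess W P) (hT : 0 < T) (i : Fin n → Fin d)
    {f g : (Fin n → ℝ) → ℝ} {j : Fin n} {t : ℝ}
    {G : ℝ → ℝ} {M : ℝ} {bad : Set ℝ}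
    (hf : Measurable f) (hfg : ∀ u, f u = if u ∈ regionA j t then g u else 0)
    (hG0 : ∀ u, 0 ≤ G u) (hGi : ∀ a b, IntegrableOn G (Set.Ioc a b))
    (hG2 : IntegrableOn (fun u => G u ^ 2) (Set.Icc 0 (T : ℝ)))
    (hfG : ∀ u, |f u| ≤ ∏ l, G (u l))
    (hA1 : ∀ a b x, x ∈ Set.Ioc a b → x ∉ bad → ∫ u in Set.Ioc a b, G u ≤ (b - a) * (M * G x))
    (hbad : bad.Countable) (ht : t ∈ bad)
    (hg : ∀ y : Fin n → ℝ, (∀ l, 0 < y l ∧ y l < t ∧ y l ∉ bad) → ContinuousAt g y)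
    {B : ℝ} (hB0 : 0 ≤ B)
    (hB : ∀ e : (Fin n × Bool) ≃ (Fin n ⊕ Fin n), ∫⁻ x : Fin n → ℝ, ENNReal.ofReal
      (minRegionAbs g j t (fun l => x (pairLabel e (Sum.inl l))) *
        minRegionAbs g j t (fun l => x (pairLabel e (Sum.inr l)))) ≤ ENNReal.ofReal B) :
    ∃ I, IsStratonovichIntegral P W T i f I ∧ ∫ ω, I ω ^ 2 ∂P ≤
      wickConst n * (Fintype.card ((Fin n × Bool) ≃ (Fin n ⊕ Fin n)) * B) := by
  have := IntervalPartition.meshToZero_neBot hT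
  choose L hLB hL using fun e => tendsto_integral_stepAvg_mul hf hfg hG0 hGi hG2 hfG hA1 hbad ht
    hg e hB0 (hB e)
  have hlim : Tendsto (fun p : IntervalPartition T × IntervalPartition T =>
      ∫ ω, stratonovichSum W i f p.1 ω * stratonovichSum W i f p.2 ω ∂P)
      (IntervalPartition.meshToZero T ×ˢ IntervalPartition.meshToZero T)
      (𝓝 (wickConst n * ∑ e, pairingWeight i e * L e)) := by
    simp_rw [fun p : IntervalPartition T × IntervalPartition T =>
      (integral_stratonovichSum_mul hW i f p.1 p.2).2]
    exact (tendsto_finsetSum _ fun e _ => (hL e).const_mul _).const_mul _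
  obtain ⟨I, hI2, hI, hIc⟩ := exists_L2_limit (fun π => memLp_stratonovichSum hW i f π) hlim
  refine ⟨I, ⟨?_, hI2, hI⟩, ?_⟩
  · rw [memLp_two_iff_integrable_sq hf.aestronglyMeasurable]
    have hrestr : (volume : Measure (Fin n → ℝ)).restrict (Set.Icc 0 fun _ => (T : ℝ)) =
        Measure.pi fun _ => volume.restrict (Set.Icc 0 (T : ℝ)) := by
      rw [← Set.pi_univ_Icc, volume_pi, Measure.restrict_pi_pi]
      rfl
    rw [hrestr]
    refine Integrable.mono' (Integrable.fintype_prod (f := fun _ u => G u ^ 2) fun _ => hG2)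
      (hf.pow_const 2).aestronglyMeasurable (Eventually.of_forall fun u => ?_)
    rw [Real.norm_eq_abs, abs_pow, Finset.prod_pow]
    exact pow_le_pow_left₀ (abs_nonneg _) (hfG u) 2
  · rw [hIc]
    refine mul_le_mul_of_nonneg_left ?_ (wickConst_nonneg n)
    rw [← nsmul_eq_mul, ← Finset.card_univ, ← Finset.sum_const]
    refine Finset.sum_le_sum fun e _ => ?_
    calc pairingWeight i e * L e ≤ pairingWeight i e * B :=
          mul_le_mul_of_nonneg_left (hLB e) (pairingWeight_nonneg i e)
      _ ≤ 1 * B := mul_le_mul_of_nonneg_right (pairingWeight_le_one i e) hB0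
      _ = B := one_mul B

end Existence

/-! ### Integrals that belong to a pairing -/

section PairingIntegral

lemma lintegral_fin_prod_eq_prod {n : ℕ} (f : Fin n → ℝ → ℝ≥0∞) (hf : ∀ i, Measurable (f i)) :
    ∫⁻ x : Fin n → ℝ, ∏ i, f i (x i) = ∏ i, ∫⁻ x, f i x := by
  induction n with
  | zero =>
    simp only [Finset.univ_eq_empty, Finset.prod_empty, lintegral_const, one_mul]
    rw [volume_pi, Measure.pi_of_empty]
    simp
  | succ n ih =>
    rw [← ((volume_preserving_piFinSuccAbove (fun _ : Fin (n + 1) => ℝ) 0).symm).lintegral_comp_emb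
      (MeasurableEquiv.measurableEmbedding _)]
    simp_rw [MeasurableEquiv.piFinSuccAbove_symm_apply, Fin.insertNthEquiv,
      Fin.prod_univ_succ, Fin.insertNth_zero, Equiv.coe_fn_mk, Fin.cons_succ, Fin.cons_zero]
    rw [← ih (fun i => f i.succ) fun i => hf _, Measure.volume_eq_prod,
      ← lintegral_prod_mul (f := f 0) (g := fun x : Fin n → ℝ => ∏ i, f i.succ (x i))
        (hf 0).aemeasurable]
    · rfl
    · exact (Finset.measurable_fun_prod _ fun i _ =>
        (hf _).comp (measurable_pi_apply i)).aemeasurable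

lemma lintegral_fintype_prod_eq_prod {ι : Type*} [Fintype ι] (f : ι → ℝ → ℝ≥0∞)
    (hf : ∀ i, Measurable (f i)) :
    ∫⁻ x : ι → ℝ, ∏ i, f i (x i) = ∏ i, ∫⁻ x, f i x := by
  let e := (Fintype.equivFin ι).symm
  rw [← (volume_measurePreserving_piCongrLeft (fun _ => ℝ) e).lintegral_comp_emb
    (MeasurableEquiv.measurableEmbedding _)]
  simp_rw [← e.prod_comp, MeasurableEquiv.coe_piCongrLeft, Equiv.piCongrLeft_apply_apply]
  exact lintegral_fin_prod_eq_prod (fun i => f (e i)) fun i => hf _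

variable {n : ℕ}

/-- The factor that a half-edge contributes: `D` at the distinguished position `j` of either copy,
`κ` everywhere else. -/
def halfEdgeFun (D κ : ℝ → ℝ≥0∞) (j : Fin n) : Fin n ⊕ Fin n → ℝ → ℝ≥0∞ :=
  Sum.elim (fun l => if l = j then D else κ) (fun l => if l = j then D else κ)

lemma prod_bool_eq {M : Type*} [CommMonoid M] (F : Bool → M) (β : Bool) :
    F false * F true = F β * F (!β) := by
  cases β
  · rfl
  · exact mul_comm _ _

/-- Let every half-edge of the first copy carry the weight `A` and every half-edge of the second
copy the weight `B`, so that the total weight is `A ^ n * B ^ n`. If the two distinguished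
half-edges lie in different pairs, these two pairs carry at least `A² B²`: a partner that lies in
the wrong copy only makes their weight larger, by `h1` or `h2`. -/
lemma prod_weights_erase_le {e : (Fin n × Bool) ≃ (Fin n ⊕ Fin n)} {j : Fin n}
    (hab : pairLabel e (Sum.inl j) ≠ pairLabel e (Sum.inr j)) {A B : ℝ≥0∞}
    (hA0 : A ≠ 0) (hA : A ≠ ∞) (hB0 : B ≠ 0) (hB : B ≠ ∞)
    (h1 : (∃ m, pairLabel e (Sum.inr m) = pairLabel e (Sum.inl j)) → A ≤ B)
    (h2 : (∃ m, pairLabel e (Sum.inl m) = pairLabel e (Sum.inr j)) → B ≤ A) :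
    ∏ c ∈ Finset.univ.filter (fun c => ¬ (c = pairLabel e (Sum.inl j) ∨
        c = pairLabel e (Sum.inr j))),
      (Sum.elim (fun _ => A) (fun _ => B) (e (c, false)) *
        Sum.elim (fun _ => A) (fun _ => B) (e (c, true))) ≤ A ^ (n - 2) * B ^ (n - 2) := by
  set a := pairLabel e (Sum.inl j) with ha
  set b := pairLabel e (Sum.inr j) with hb
  set w : Fin n ⊕ Fin n → ℝ≥0∞ := Sum.elim (fun _ => A) (fun _ => B) with hw
  set R := ∏ c ∈ Finset.univ.filter (fun c => ¬ (c = a ∨ c = b)),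
    (w (e (c, false)) * w (e (c, true))) with hR
  have hn : 2 ≤ n := by
    have h3 : (a : ℕ) ≠ b := fun h => hab (Fin.ext h)
    have := a.2
    have := b.2
    omega
  have htot : (w (e (a, false)) * w (e (a, true))) * (w (e (b, false)) * w (e (b, true))) * R =
      A ^ n * B ^ n := by
    have h3 := prod_pairs e (fun x _ => w x)
    simp only [hw, Sum.elim_inl, Sum.elim_inr, Finset.prod_const, Finset.card_univ,
      Fintype.card_fin] at h3
    rw [← h3, ← Finset.prod_filter_mul_prod_filter_not Finset.univ (fun c => c = a ∨ c = b)]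
    congr 1
    have h4 : Finset.univ.filter (fun c => c = a ∨ c = b) = {a, b} := by
      ext c
      simp
    rw [h4, Finset.prod_pair hab]
  have hAB : A * A * (B * B) ≤
      (w (e (a, false)) * w (e (a, true))) * (w (e (b, false)) * w (e (b, true))) := by
    rw [prod_bool_eq (fun β => w (e (a, β))) (e.symm (Sum.inl j)).2,
      prod_bool_eq (fun β => w (e (b, β))) (e.symm (Sum.inr j)).2]
    have e1 : e (a, (e.symm (Sum.inl j)).2) = Sum.inl j := e.apply_symm_apply _
    have e2 : e (b, (e.symm (Sum.inr j)).2) = Sum.inr j := e.apply_symm_apply _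
    rw [e1, e2]
    have l1 : pairLabel e (e (a, !(e.symm (Sum.inl j)).2)) = a := by simp [pairLabel]
    have l2 : pairLabel e (e (b, !(e.symm (Sum.inr j)).2)) = b := by simp [pairLabel]
    simp only [hw, Sum.elim_inl, Sum.elim_inr]
    have key : A * B ≤ Sum.elim (fun _ => A) (fun _ => B) (e (a, !(e.symm (Sum.inl j)).2)) *
        Sum.elim (fun _ => A) (fun _ => B) (e (b, !(e.symm (Sum.inr j)).2)) := by
      rcases hp : e (a, !(e.symm (Sum.inl j)).2) with p | p <;>
        rcases hq : e (b, !(e.symm (Sum.inr j)).2) with q | q <;>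
        simp only [Sum.elim_inl, Sum.elim_inr] <;> rw [hp] at l1 <;> rw [hq] at l2
      · gcongr
        exact h2 ⟨q, l2⟩
      · exact (mul_comm A B).le
      · gcongr
        exact h1 ⟨p, l1⟩
    calc A * A * (B * B) = A * B * (A * B) := by ring
      _ ≤ A * B * _ := mul_le_mul_right key _
      _ = _ := by ring
  have hfin : A * A * (B * B) * R ≤ A * A * (B * B) * (A ^ (n - 2) * B ^ (n - 2)) := by
    calc A * A * (B * B) * R ≤ _ := mul_le_mul_left hAB R
      _ = A ^ n * B ^ n := htot
      _ = A * A * (B * B) * (A ^ (n - 2) * B ^ (n - 2)) := by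
        obtain ⟨m, rfl⟩ := Nat.exists_eq_add_of_le hn
        rw [Nat.add_sub_cancel_left]
        ring
  refine (ENNReal.mul_le_mul_iff_right ?_ ?_).1 hfin
  · exact mul_ne_zero (mul_ne_zero hA0 hA0) (mul_ne_zero hB0 hB0)
  · exact ENNReal.mul_ne_top (ENNReal.mul_ne_top hA hA) (ENNReal.mul_ne_top hB hB)

lemma halfEdgeFun_of_ne (D κ : ℝ → ℝ≥0∞) (j : Fin n) (e : (Fin n × Bool) ≃ (Fin n ⊕ Fin n))
    {c : Fin n} (ha : c ≠ pairLabel e (Sum.inl j)) (hb : c ≠ pairLabel e (Sum.inr j)) (β : Bool) :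
    halfEdgeFun D κ j (e (c, β)) = κ := by
  have hlab : pairLabel e (e (c, β)) = c := by simp [pairLabel]
  rcases hs : e (c, β) with l | l <;> rw [hs] at hlab
  · have : l ≠ j := by
      rintro rfl
      exact ha hlab.symm
    simp [halfEdgeFun, this]
  · have : l ≠ j := by
      rintro rfl
      exact hb hlab.symm
    simp [halfEdgeFun, this]

lemma halfEdgeFun_mul_of_eq (D κ : ℝ → ℝ≥0∞) (j : Fin n) (e : (Fin n × Bool) ≃ (Fin n ⊕ Fin n))
    (hab : pairLabel e (Sum.inl j) = pairLabel e (Sum.inr j)) (x : ℝ) :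
    halfEdgeFun D κ j (e (pairLabel e (Sum.inl j), false)) x *
      halfEdgeFun D κ j (e (pairLabel e (Sum.inl j), true)) x = D x ^ 2 := by
  set a := pairLabel e (Sum.inl j) with ha
  rw [prod_bool_eq (fun β => halfEdgeFun D κ j (e (a, β)) x) (e.symm (Sum.inl j)).2]
  have e1 : e (a, (e.symm (Sum.inl j)).2) = Sum.inl j := e.apply_symm_apply _
  have e2 : e (a, (e.symm (Sum.inr j)).2) = Sum.inr j := by
    rw [hab]
    exact e.apply_symm_apply _
  have e3 : (!(e.symm (Sum.inl j)).2) = (e.symm (Sum.inr j)).2 := by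
    by_contra hne
    have : (e.symm (Sum.inl j)).2 = (e.symm (Sum.inr j)).2 := by
      revert hne
      generalize (e.symm (Sum.inl j)).2 = β₁
      generalize (e.symm (Sum.inr j)).2 = β₂
      revert β₁ β₂
      decide
    rw [this, e2] at e1
    cases e1
  rw [e1, e3, e2]
  simp [halfEdgeFun, sq]

lemma halfEdgeFun_mul_of_ne (D κ : ℝ → ℝ≥0∞) (j : Fin n) (e : (Fin n × Bool) ≃ (Fin n ⊕ Fin n))
    (hab : pairLabel e (Sum.inl j) ≠ pairLabel e (Sum.inr j)) (x : ℝ) (s : Fin n ⊕ Fin n)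
    (hs : s = Sum.inl j ∨ s = Sum.inr j) :
    halfEdgeFun D κ j (e (pairLabel e s, false)) x *
      halfEdgeFun D κ j (e (pairLabel e s, true)) x = D x * κ x := by
  rw [prod_bool_eq (fun β => halfEdgeFun D κ j (e (pairLabel e s, β)) x) (e.symm s).2]
  have e1 : e (pairLabel e s, (e.symm s).2) = s := e.apply_symm_apply _
  have l1 : pairLabel e (e (pairLabel e s, !(e.symm s).2)) = pairLabel e s := by simp [pairLabel]
  have hne : e (pairLabel e s, !(e.symm s).2) ≠ s := by
    intro h
    have := congrArg Prod.snd (e.injective (h.trans e1.symm))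
    simp at this
  have k1 : halfEdgeFun D κ j (e (pairLabel e s, !(e.symm s).2)) = κ := by
    rcases hq : e (pairLabel e s, !(e.symm s).2) with l | l <;> rw [hq] at hne l1
    · have : l ≠ j := by
        rintro rfl
        rcases hs with rfl | rfl
        · exact hne rfl
        · exact hab l1
      simp [halfEdgeFun, this]
    · have : l ≠ j := by
        rintro rfl
        rcases hs with rfl | rfl
        · exact hab l1.symm
        · exact hne rfl
      simp [halfEdgeFun, this]
  rw [k1, e1]
  rcases hs with rfl | rfl <;> simp [halfEdgeFun]

open Classical in
/-- The function `D (y j) ∏_{l ≠ j} κ (y l)`, restricted to the part of `(0, t)^n` where the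
`j`-th coordinate is minimal. -/
def minRegionProd (D κ : ℝ → ℝ≥0∞) (j : Fin n) (t : ℝ) (y : Fin n → ℝ) : ℝ≥0∞ :=
  if ∀ l, 0 < y l ∧ y l < t ∧ y j ≤ y l then ∏ l, (if l = j then D else κ) (y l) else 0

open Classical in
/-- What remains of the integrand of a pairing once the coordinates other than the two minimal ones
are integrated out: the product over the pairs of the two distinguished half-edges, restricted to
the constraints between the two minimal coordinates. If one of these pairs contains a half-edge of
the other copy, its variable is at least the minimum of that copy. -/
def pairingOuter (D κ : ℝ → ℝ≥0∞) (t : ℝ) (e : (Fin n × Bool) ≃ (Fin n ⊕ Fin n)) (j : Fin n)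
    (y : {c // c = pairLabel e (Sum.inl j) ∨ c = pairLabel e (Sum.inr j)} → ℝ) : ℝ≥0∞ :=
  if (∀ c, y c ∈ Set.Ioo 0 t) ∧
    ((∃ m, pairLabel e (Sum.inr m) = pairLabel e (Sum.inl j)) →
      y ⟨pairLabel e (Sum.inr j), Or.inr rfl⟩ ≤ y ⟨pairLabel e (Sum.inl j), Or.inl rfl⟩) ∧
    ((∃ m, pairLabel e (Sum.inl m) = pairLabel e (Sum.inr j)) →
      y ⟨pairLabel e (Sum.inl j), Or.inl rfl⟩ ≤ y ⟨pairLabel e (Sum.inr j), Or.inr rfl⟩)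
  then ∏ c : {c // c = pairLabel e (Sum.inl j) ∨ c = pairLabel e (Sum.inr j)},
    halfEdgeFun D κ j (e (c, false)) (y c) * halfEdgeFun D κ j (e (c, true)) (y c) else 0

/-- The weights that the integrated coordinates leave behind: one factor for every half-edge. -/
def pairingWeights (ρ : ℝ → ℝ≥0∞) (e : (Fin n × Bool) ≃ (Fin n ⊕ Fin n)) (j : Fin n)
    (y : {c // c = pairLabel e (Sum.inl j) ∨ c = pairLabel e (Sum.inr j)} → ℝ) : ℝ≥0∞ :=
  ∏ c ∈ Finset.univ.filter (fun c => ¬ (c = pairLabel e (Sum.inl j) ∨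
      c = pairLabel e (Sum.inr j))),
    (Sum.elim (fun _ => ρ (y ⟨pairLabel e (Sum.inl j), Or.inl rfl⟩))
        (fun _ => ρ (y ⟨pairLabel e (Sum.inr j), Or.inr rfl⟩)) (e (c, false)) *
      Sum.elim (fun _ => ρ (y ⟨pairLabel e (Sum.inl j), Or.inl rfl⟩))
        (fun _ => ρ (y ⟨pairLabel e (Sum.inr j), Or.inr rfl⟩)) (e (c, true)))

/-- In the integral that belongs to a pairing `e`, the variables other than the two minimal
coordinates are integrated out first. -/
lemma lintegral_minRegionProd_mul_le_outer {D κ ρ : ℝ → ℝ≥0∞} (hκ : Measurable κ)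
    {t : ℝ} (hanti : Antitone ρ) {M : ℝ≥0∞} (hM : 1 ≤ M)
    (hE1 : ∀ x, 0 < x → x < t → ∫⁻ y in Set.Ico x t, κ y ^ 2 ≤ M * ρ x ^ 2)
    (e : (Fin n × Bool) ≃ (Fin n ⊕ Fin n)) (j : Fin n) :
    ∫⁻ x : Fin n → ℝ, minRegionProd D κ j t (fun l => x (pairLabel e (Sum.inl l))) *
      minRegionProd D κ j t (fun l => x (pairLabel e (Sum.inr l))) ≤
      ∫⁻ y, pairingOuter D κ t e j y * (M ^ n * pairingWeights ρ e j y) := by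
  classical
  set a := pairLabel e (Sum.inl j) with ha
  set b := pairLabel e (Sum.inr j) with hb
  set p : Fin n → Prop := fun c => c = a ∨ c = b with hp
  set h := halfEdgeFun D κ j with hh
  set F : (Fin n → ℝ) → ℝ≥0∞ := fun x =>
    minRegionProd D κ j t (fun l => x (pairLabel e (Sum.inl l))) *
      minRegionProd D κ j t (fun l => x (pairLabel e (Sum.inr l))) with hF
  have pa : p a := Or.inl rfl
  have pb : p b := Or.inr rfl
  set Q := pairingOuter D κ t e j with hQ
  -- the minimal coordinate of the copy to which a half-edge belongs
  set lo : ({c // p c} → ℝ) → Fin n ⊕ Fin n → ℝ := fun y =>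
    Sum.elim (fun _ => y ⟨a, pa⟩) (fun _ => y ⟨b, pb⟩) with hlo
  set k : ({c // p c} → ℝ) → {c // ¬ p c} → ℝ → ℝ≥0∞ := fun y c =>
    (Set.Ico (max (lo y (e (c, false))) (lo y (e (c, true)))) t).indicator
      (fun u => κ u ^ 2) with hk
  have hother : ∀ c, ¬ p c → ∀ β, h (e (c, β)) = κ := fun c hc β =>
    halfEdgeFun_of_ne D κ j e (fun h => hc (Or.inl h)) (fun h => hc (Or.inr h)) β
  -- the integrand is dominated by a function that factorizes over the remaining coordinates
  have hbound : ∀ x : Fin n → ℝ,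
      F x ≤ Q (fun c => x c) * ∏ c : {c // ¬ p c}, k (fun c => x c) c (x c) := by
    intro x
    simp only [hF, minRegionProd]
    by_cases h1 : ∀ l, 0 < x (pairLabel e (Sum.inl l)) ∧ x (pairLabel e (Sum.inl l)) < t ∧
        x (pairLabel e (Sum.inl j)) ≤ x (pairLabel e (Sum.inl l))
    swap
    · rw [if_neg h1, zero_mul]
      exact zero_le
    by_cases h2 : ∀ l, 0 < x (pairLabel e (Sum.inr l)) ∧ x (pairLabel e (Sum.inr l)) < t ∧
        x (pairLabel e (Sum.inr j)) ≤ x (pairLabel e (Sum.inr l))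
    swap
    · rw [if_neg h2, mul_zero]
      exact zero_le
    rw [if_pos h1, if_pos h2]
    have hlow : ∀ c β, lo (fun c => x c) (e (c, β)) ≤ x c ∧ 0 < x c ∧ x c < t := by
      intro c β
      have hlab : pairLabel e (e (c, β)) = c := by simp [pairLabel]
      rcases hs : e (c, β) with l | l <;> rw [hs] at hlab
      · have := h1 l
        rw [hlab] at this
        exact ⟨this.2.2, this.1, this.2.1⟩
      · have := h2 l
        rw [hlab] at this
        exact ⟨this.2.2, this.1, this.2.1⟩
    have hQx : Q (fun c => x c) =
        ∏ c : {c // p c}, h (e (c, false)) (x c) * h (e (c, true)) (x c) := by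
      rw [hQ, pairingOuter, if_pos]
      refine ⟨fun c => ⟨(hlow c true).2.1, (hlow c true).2.2⟩, ?_, ?_⟩
      · rintro ⟨m, hm⟩
        have := (h2 m).2.2
        rwa [hm] at this
      · rintro ⟨m, hm⟩
        have := (h1 m).2.2
        rwa [hm] at this
    have hkx : ∀ c : {c // ¬ p c}, k (fun c => x c) c (x c) =
        h (e (c, false)) (x c) * h (e (c, true)) (x c) := by
      intro c
      rw [hother c c.2, hother c c.2, hk]
      simp only
      rw [Set.indicator_of_mem, sq]
      exact ⟨max_le (hlow c _).1 (hlow c _).1, (hlow c true).2.2⟩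
    rw [hQx, Finset.prod_congr rfl fun c _ => hkx c]
    have hsplit := Fintype.prod_subtype_mul_prod_subtype p
      (fun c => h (e (c, false)) (x c) * h (e (c, true)) (x c))
    rw [hsplit, prod_pairs e (fun s c => h s (x c))]
    exact le_rfl
  have hsplit : ∫⁻ x : Fin n → ℝ, F x ≤
      ∫⁻ y : {c // p c} → ℝ, Q y * ∏ c : {c // ¬ p c}, ∫⁻ u, k y c u := by
    calc ∫⁻ x : Fin n → ℝ, F x
        ≤ ∫⁻ x : Fin n → ℝ, Q (fun c => x c) * ∏ c : {c // ¬ p c}, k (fun c => x c) c (x c) :=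
          lintegral_mono hbound
      _ = ∫⁻ yz : ({c // p c} → ℝ) × ({c // ¬ p c} → ℝ),
            Q yz.1 * ∏ c : {c // ¬ p c}, k yz.1 c (yz.2 c) := by
          rw [← (volume_preserving_piEquivPiSubtypeProd (fun _ : Fin n => ℝ) p).lintegral_comp_emb
            (MeasurableEquiv.measurableEmbedding _)]
          rfl
      -- this half of Tonelli's theorem does not need measurability of `Q`
      _ ≤ ∫⁻ y : {c // p c} → ℝ, ∫⁻ z : {c // ¬ p c} → ℝ,
            Q y * ∏ c : {c // ¬ p c}, k y c (z c) := lintegral_prod_le _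
      _ = _ := by
          refine lintegral_congr fun y => ?_
          have hkm : ∀ c, Measurable (k y c) := fun c =>
            (hκ.pow_const 2).indicator measurableSet_Ico
          have hkm' : Measurable fun z : {c // ¬ p c} → ℝ => ∏ c, k y c (z c) :=
            Finset.measurable_fun_prod _ fun c _ => (hkm c).comp (measurable_pi_apply c)
          rw [lintegral_const_mul _ hkm', lintegral_fintype_prod_eq_prod _ hkm]
  refine hsplit.trans ?_
  have hinner : ∀ y : {c // p c} → ℝ, (∀ c, y c ∈ Set.Ioo 0 t) →
      ∏ c : {c // ¬ p c}, ∫⁻ u, k y c u ≤ M ^ n *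
        pairingWeights ρ e j y := by
    intro y hy
    have hlo' : ∀ s, lo y s ∈ Set.Ioo 0 t := by
      rintro (s | s)
      · exact hy _
      · exact hy _
    have hρlo : ∀ s, ρ (lo y s) =
        Sum.elim (fun _ => ρ (y ⟨a, pa⟩)) (fun _ => ρ (y ⟨b, pb⟩)) s := by
      rintro (s | s) <;> rfl
    have h1 : ∀ c : {c // ¬ p c}, ∫⁻ u, k y c u ≤
        M * (ρ (lo y (e (c, false))) * ρ (lo y (e (c, true)))) := by
      intro c
      rw [hk]
      simp only
      rw [lintegral_indicator measurableSet_Ico]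
      refine (hE1 _ (lt_max_of_lt_left (hlo' _).1) (max_lt (hlo' _).2 (hlo' _).2)).trans ?_
      -- `ρ` at the larger lower bound is at most `ρ` at either of them
      rw [sq]
      gcongr
      · exact hanti (le_max_left _ _)
      · exact hanti (le_max_right _ _)
    refine (Finset.prod_le_prod' fun c _ => h1 c).trans ?_
    rw [Finset.prod_mul_distrib, Finset.prod_const, Finset.card_univ]
    refine mul_le_mul' (pow_le_pow_right₀ hM ?_) (le_of_eq ?_)
    · exact (Fintype.card_subtype_le _).trans (Fintype.card_fin n).le
    · rw [pairingWeights, ← Finset.prod_subtype_eq_prod_filter, Finset.subtype_univ]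
      exact Finset.prod_congr rfl fun c _ => by rw [hρlo, hρlo]
  refine lintegral_mono fun y => ?_
  by_cases hy : ∀ c, y c ∈ Set.Ioo 0 t
  · exact mul_le_mul' le_rfl (hinner y hy)
  · have : Q y = 0 := by
      rw [hQ, pairingOuter, if_neg fun h => hy h.1]
    rw [this, zero_mul]
    exact zero_le

/-- Bound for the integral that belongs to a pairing `e`. If the two distinguished half-edges are
paired with each other, one variable is left and `hE2` applies; otherwise two variables are left,
the bound factorizes over them, and `hE3` applies to each. -/
lemma lintegral_minRegionProd_mul_le {D κ ρ : ℝ → ℝ≥0∞} (hD : Measurable D) (hκ : Measurable κ)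
    (hρ : Measurable ρ) {t : ℝ} (hρ0 : ∀ x < t, ρ x ≠ 0) (hρt : ∀ x, ρ x ≠ ∞) (hanti : Antitone ρ)
    {M B : ℝ≥0∞} (hM : 1 ≤ M)
    (hE1 : ∀ x, 0 < x → x < t → ∫⁻ y in Set.Ico x t, κ y ^ 2 ≤ M * ρ x ^ 2)
    (hE2 : ∫⁻ x in Set.Ioo 0 t, D x ^ 2 * ρ x ^ (2 * (n - 1)) ≤ B ^ 2)
    (hE3 : 2 ≤ n → ∫⁻ x in Set.Ioo 0 t, D x * κ x * ρ x ^ (n - 2) ≤ B)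
    (e : (Fin n × Bool) ≃ (Fin n ⊕ Fin n)) (j : Fin n) :
    ∫⁻ x : Fin n → ℝ, minRegionProd D κ j t (fun l => x (pairLabel e (Sum.inl l))) *
      minRegionProd D κ j t (fun l => x (pairLabel e (Sum.inr l))) ≤ M ^ n * B ^ 2 := by
  refine (lintegral_minRegionProd_mul_le_outer hκ hanti hM hE1 e j).trans ?_
  by_cases hab : pairLabel e (Sum.inl j) = pairLabel e (Sum.inr j)
  · set q : ℝ → ℝ≥0∞ := (Set.Ioo 0 t).indicator
      (fun u => D u ^ 2 * ρ u ^ (2 * (n - 1))) with hq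
    have hqm : Measurable q :=
      ((hD.pow_const 2).mul (hρ.pow_const _)).indicator measurableSet_Ioo
    have hpa : ∀ c, (c = pairLabel e (Sum.inl j) ∨ c = pairLabel e (Sum.inr j)) ↔
        c = pairLabel e (Sum.inl j) := fun c => by rw [← hab, or_self]
    have huniq : ∀ c : {c // c = pairLabel e (Sum.inl j) ∨ c = pairLabel e (Sum.inr j)},
        c = ⟨pairLabel e (Sum.inl j), Or.inl rfl⟩ := fun c => Subtype.ext ((hpa c).1 c.2)
    have huniv : (Finset.univ :
        Finset {c // c = pairLabel e (Sum.inl j) ∨ c = pairLabel e (Sum.inr j)}) =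
        {⟨pairLabel e (Sum.inl j), Or.inl rfl⟩} :=
      Finset.eq_singleton_iff_unique_mem.2 ⟨Finset.mem_univ _, fun c _ => huniq c⟩
    have hle : ∀ y, pairingOuter D κ t e j y * (M ^ n * pairingWeights ρ e j y) ≤
        M ^ n * q (y ⟨pairLabel e (Sum.inl j), Or.inl rfl⟩) := by
      intro y
      rw [pairingOuter]
      split_ifs with hy
      swap
      · rw [zero_mul]
        exact zero_le
      have hyb : y ⟨pairLabel e (Sum.inr j), Or.inr rfl⟩ =
          y ⟨pairLabel e (Sum.inl j), Or.inl rfl⟩ := congrArg y (huniq _)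
      rw [huniv, Finset.prod_singleton, halfEdgeFun_mul_of_eq D κ j e hab, hq,
        Set.indicator_of_mem (hy.1 _), pairingWeights, hyb]
      have h3 : ∀ (A : ℝ≥0∞) (s : Fin n ⊕ Fin n), Sum.elim (fun _ => A) (fun _ => A) s = A := by
        rintro A (s | s) <;> rfl
      simp_rw [h3]
      rw [Finset.prod_const, ← sq, ← pow_mul]
      have hcard : (Finset.univ.filter fun c => ¬ (c = pairLabel e (Sum.inl j) ∨
          c = pairLabel e (Sum.inr j))).card = n - 1 := by
        simp_rw [hpa]
        rw [Finset.filter_ne', Finset.card_erase_of_mem (Finset.mem_univ _),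
          Finset.card_univ, Fintype.card_fin]
      rw [hcard]
      exact le_of_eq (by ring)
    refine (lintegral_mono hle).trans ?_
    have hint : ∫⁻ y : {c // c = pairLabel e (Sum.inl j) ∨ c = pairLabel e (Sum.inr j)} → ℝ,
        q (y ⟨pairLabel e (Sum.inl j), Or.inl rfl⟩) = ∫⁻ u, q u := by
      have := lintegral_fintype_prod_eq_prod
        (fun _ : {c // c = pairLabel e (Sum.inl j) ∨ c = pairLabel e (Sum.inr j)} => q)
        fun _ => hqm
      simpa only [huniv, Finset.prod_singleton] using this
    have hqm' : Measurable
        fun y : {c // c = pairLabel e (Sum.inl j) ∨ c = pairLabel e (Sum.inr j)} → ℝ =>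
          q (y ⟨pairLabel e (Sum.inl j), Or.inl rfl⟩) := hqm.comp (measurable_pi_apply _)
    rw [lintegral_const_mul _ hqm', hint, hq,
      lintegral_indicator measurableSet_Ioo]
    gcongr
  · have hn : 2 ≤ n := by
      have h3 : (pairLabel e (Sum.inl j) : ℕ) ≠ pairLabel e (Sum.inr j) :=
        fun h => hab (Fin.ext h)
      have := (pairLabel e (Sum.inl j)).2
      have := (pairLabel e (Sum.inr j)).2
      omega
    set q : ℝ → ℝ≥0∞ := (Set.Ioo 0 t).indicator
      (fun u => D u * κ u * ρ u ^ (n - 2)) with hq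
    have hqm : Measurable q :=
      ((hD.mul hκ).mul (hρ.pow_const _)).indicator measurableSet_Ioo
    have hne : (⟨pairLabel e (Sum.inl j), Or.inl rfl⟩ :
        {c // c = pairLabel e (Sum.inl j) ∨ c = pairLabel e (Sum.inr j)}) ≠
        ⟨pairLabel e (Sum.inr j), Or.inr rfl⟩ := fun h => hab (congrArg Subtype.val h)
    have huniv : (Finset.univ :
        Finset {c // c = pairLabel e (Sum.inl j) ∨ c = pairLabel e (Sum.inr j)}) =
        {⟨pairLabel e (Sum.inl j), Or.inl rfl⟩, ⟨pairLabel e (Sum.inr j), Or.inr rfl⟩} := by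
      ext ⟨c, hc⟩
      simpa [Subtype.ext_iff] using hc
    have hle : ∀ y, pairingOuter D κ t e j y * (M ^ n * pairingWeights ρ e j y) ≤
        M ^ n * ∏ c : {c // c = pairLabel e (Sum.inl j) ∨ c = pairLabel e (Sum.inr j)},
          q (y c) := by
      intro y
      rw [pairingOuter]
      split_ifs with hy
      swap
      · rw [zero_mul]
        exact zero_le
      rw [huniv, Finset.prod_pair hne, Finset.prod_pair hne,
        halfEdgeFun_mul_of_ne D κ j e hab _ _ (Or.inl rfl),
        halfEdgeFun_mul_of_ne D κ j e hab _ _ (Or.inr rfl), hq, Set.indicator_of_mem (hy.1 _),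
        Set.indicator_of_mem (hy.1 _)]
      have hw : pairingWeights ρ e j y ≤ _ :=
        prod_weights_erase_le (e := e) (j := j) hab (hρ0 _ (hy.1 _).2) (hρt _)
        (hρ0 _ (hy.1 _).2) (hρt _) (fun h => hanti (hy.2.1 h)) (fun h => hanti (hy.2.2 h))
      refine (mul_le_mul' le_rfl (mul_le_mul' le_rfl hw)).trans (le_of_eq ?_)
      ring
    refine (lintegral_mono hle).trans ?_
    have hqm' : Measurable
        fun y : {c // c = pairLabel e (Sum.inl j) ∨ c = pairLabel e (Sum.inr j)} → ℝ =>
          ∏ c, q (y c) :=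
      Finset.measurable_fun_prod _ fun c _ => hqm.comp (measurable_pi_apply c)
    rw [lintegral_const_mul _ hqm', lintegral_fintype_prod_eq_prod (fun _ => q) fun _ => hqm,
      huniv, Finset.prod_pair hne, hq, lintegral_indicator measurableSet_Ioo, ← sq]
    gcongr
    exact hE3 hn

end PairingIntegral

/-! ### The Volterra kernel -/

section Kernel

variable {H c : ℝ}

/-- The integral `∫_u^r v^{H-3/2} (v-u)^{H-1/2} dv` in the Volterra kernel. -/
def kernelIntegral (H u r : ℝ) : ℝ := ∫ v in u..r, v ^ (H - 3 / 2) * (v - u) ^ (H - 1 / 2)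

lemma intervalIntegrable_kernelIntegral (hH0 : 0 < H) {u r : ℝ} (hu : 0 < u) (hr : u ≤ r) :
    IntervalIntegrable (fun v => v ^ (H - 3 / 2) * (v - u) ^ (H - 1 / 2)) volume u r := by
  have h1 : IntervalIntegrable (fun v : ℝ => (v - u) ^ (H - 1 / 2)) volume u r := by
    have := (intervalIntegral.intervalIntegrable_rpow' (a := 0) (b := r - u)
      (show -1 < H - 1 / 2 by linarith)).comp_sub_right u
    simpa using this
  refine h1.continuousOn_mul ?_
  rw [Set.uIcc_of_le hr]
  exact ContinuousOn.rpow_const continuousOn_id fun x hx => Or.inl (hu.trans_le hx.1).ne'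

lemma hasDerivAt_kernelIntegral (hH0 : 0 < H) {u r : ℝ} (hu : 0 < u) (hr : u < r) :
    HasDerivAt (kernelIntegral H u) (r ^ (H - 3 / 2) * (r - u) ^ (H - 1 / 2)) r := by
  refine intervalIntegral.integral_hasDerivAt_right
    (intervalIntegrable_kernelIntegral hH0 hu hr.le) ?_ ?_
  · exact (Measurable.stronglyMeasurable (by fun_prop)).stronglyMeasurableAtFilter
  · refine ContinuousAt.mul ?_ ?_
    · exact Real.continuousAt_rpow_const _ _ (Or.inl (hu.trans hr).ne')
    · exact ContinuousAt.rpow_const (by fun_prop) (Or.inl (sub_pos.2 hr).ne')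

/-- The integral in the kernel is homogeneous of degree `2H - 1`. -/
lemma kernelIntegral_eq_scale (H : ℝ) {u t : ℝ} (hu : 0 < u) (ht : u < t) :
    kernelIntegral H u t = u ^ (2 * H - 1) * kernelIntegral H 1 (t / u) := by
  have h1 := intervalIntegral.integral_comp_mul_left (a := 1) (b := t / u)
    (fun v => v ^ (H - 3 / 2) * (v - u) ^ (H - 1 / 2)) hu.ne'
  rw [mul_one, mul_div_cancel₀ _ hu.ne'] at h1
  have h2 : ∫ x in (1 : ℝ)..t / u, (u * x) ^ (H - 3 / 2) * (u * x - u) ^ (H - 1 / 2) =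
      u ^ (2 * H - 2) * kernelIntegral H 1 (t / u) := by
    rw [kernelIntegral, ← intervalIntegral.integral_const_mul]
    refine intervalIntegral.integral_congr fun x hx => ?_
    rw [Set.uIcc_of_le ((one_le_div hu).2 ht.le)] at hx
    have hx1 : 0 ≤ x - 1 := by linarith [hx.1]
    have e1 : u * x - u = u * (x - 1) := by ring
    rw [e1, Real.mul_rpow hu.le (by linarith), Real.mul_rpow hu.le hx1]
    have e2 : u ^ (2 * H - 2) = u ^ (H - 3 / 2) * u ^ (H - 1 / 2) := by
      rw [← Real.rpow_add hu]
      congr 1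
      ring
    rw [e2]
    ring
  rw [h2, smul_eq_mul] at h1
  have h3 : u ^ (2 * H - 1) = u * u ^ (2 * H - 2) := by
    rw [show 2 * H - 1 = 1 + (2 * H - 2) by ring, Real.rpow_add hu, Real.rpow_one]
  rw [h3, mul_assoc, h1, ← mul_assoc, mul_inv_cancel₀ hu.ne', one_mul]
  rfl

/-- The integral in the kernel is bounded for `u = 1`: the integrand is integrable at `1` since `0
< H` and at infinity since `H < 1/2`. -/
lemma exists_kernelIntegral_one_le (hH0 : 0 < H) (hH : H < 1 / 2) :
    ∃ A, 0 ≤ A ∧ ∀ z, 1 ≤ z → 0 ≤ kernelIntegral H 1 z ∧ kernelIntegral H 1 z ≤ A := by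
  set F : ℝ → ℝ := fun v => v ^ (H - 3 / 2) * (v - 1) ^ (H - 1 / 2) with hF
  have hF0 : ∀ v, 1 ≤ v → 0 ≤ F v := fun v hv =>
    mul_nonneg (Real.rpow_nonneg (by linarith) _) (Real.rpow_nonneg (by linarith) _)
  have hi : ∀ z, 1 ≤ z → IntervalIntegrable F volume 1 z := fun z hz =>
    intervalIntegrable_kernelIntegral hH0 one_pos hz
  have hpos : ∀ z, 1 ≤ z → 0 ≤ kernelIntegral H 1 z := fun z hz =>
    intervalIntegral.integral_nonneg hz fun v hv => hF0 v hv.1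
  refine ⟨kernelIntegral H 1 2 + 1 / (1 - 2 * H), add_nonneg (hpos 2 (by norm_num))
    (div_nonneg zero_le_one (by linarith)), fun z hz => ⟨hpos z hz, ?_⟩⟩
  have h12 : 0 ≤ 1 / (1 - 2 * H) := div_nonneg zero_le_one (by linarith)
  rcases le_total z 2 with h | h
  · have : kernelIntegral H 1 z ≤ kernelIntegral H 1 2 := by
      refine intervalIntegral.integral_mono_interval le_rfl hz h ?_ (hi 2 (by norm_num))
      refine (ae_restrict_iff' measurableSet_Ioc).2 (Eventually.of_forall fun v hv => ?_)
      exact hF0 v hv.1.le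
    linarith
  · have hiz : IntervalIntegrable F volume 2 z :=
      (hi 2 (by norm_num)).symm.trans (hi z hz)
    have h1 : kernelIntegral H 1 z = kernelIntegral H 1 2 + ∫ v in (2 : ℝ)..z, F v :=
      (intervalIntegral.integral_add_adjacent_intervals (hi 2 (by norm_num)) hiz).symm
    rw [h1]
    gcongr
    have h0 : (0 : ℝ) ∉ Set.uIcc (2 - 1) (z - 1) := by
      rw [Set.uIcc_of_le (by linarith)]
      intro h'
      linarith [h'.1]
    have hint : IntervalIntegrable (fun v : ℝ => (v - 1) ^ (2 * H - 2)) volume 2 z := by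
      have := (intervalIntegral.intervalIntegrable_rpow (μ := volume) (r := 2 * H - 2)
        (Or.inr h0)).comp_sub_right 1
      simpa using this
    have h2 : ∫ v in (2 : ℝ)..z, F v ≤ ∫ v in (2 : ℝ)..z, (v - 1) ^ (2 * H - 2) := by
      refine intervalIntegral.integral_mono_on h hiz hint fun v hv => ?_
      have hv1 : 0 < v - 1 := by linarith [hv.1]
      have e2 : (v - 1) ^ (2 * H - 2) = (v - 1) ^ (H - 3 / 2) * (v - 1) ^ (H - 1 / 2) := by
        rw [← Real.rpow_add hv1]
        congr 1
        ring
      rw [e2]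
      refine mul_le_mul_of_nonneg_right ?_ (Real.rpow_nonneg hv1.le _)
      exact Real.rpow_le_rpow_of_nonpos hv1 (by linarith) (by linarith)
    refine h2.trans ?_
    rw [intervalIntegral.integral_comp_sub_right (fun v : ℝ => v ^ (2 * H - 2)) 1,
      integral_rpow (Or.inr ⟨by linarith, h0⟩)]
    have e3 : 2 * H - 2 + 1 = -(1 - 2 * H) := by ring
    have e4 : (2 : ℝ) - 1 = 1 := by norm_num
    rw [e3, e4, Real.one_rpow, div_neg, ← neg_div]
    have h5 : 0 ≤ (z - 1) ^ (-(1 - 2 * H)) := Real.rpow_nonneg (by linarith) _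
    exact div_le_div_of_nonneg_right (by linarith) (by linarith)

lemma fbmKernel_eq_zero {t u : ℝ} (h : ¬ (0 < u ∧ u < t)) : fbmKernel H c t u = 0 := if_neg h

lemma fbmKernel_eq {t u : ℝ} (hu : 0 < u) (ht : u < t) :
    fbmKernel H c t u = c * ((u / t) ^ (1 / 2 - H) * (t - u) ^ (H - 1 / 2) +
      (1 / 2 - H) * u ^ (1 / 2 - H) * kernelIntegral H u t) := if_pos ⟨hu, ht⟩

lemma fbmKernel_eq_scale {t u : ℝ} (hu : 0 < u) (ht : u < t) :
    fbmKernel H c t u = c * ((u / t) ^ (1 / 2 - H) * (t - u) ^ (H - 1 / 2) +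
      (1 / 2 - H) * u ^ (H - 1 / 2) * kernelIntegral H 1 (t / u)) := by
  rw [fbmKernel_eq hu ht, kernelIntegral_eq_scale H hu ht]
  have : u ^ (H - 1 / 2) = u ^ (1 / 2 - H) * u ^ (2 * H - 1) := by
    rw [← Real.rpow_add hu]
    congr 1
    ring
  rw [this]
  ring

lemma fbmKernel_nonneg (hH0 : 0 < H) (hH : H < 1 / 2) (hc : 0 < c) (t u : ℝ) :
    0 ≤ fbmKernel H c t u := by
  by_cases h : 0 < u ∧ u < t
  · rw [fbmKernel_eq_scale h.1 h.2]
    obtain ⟨A, -, hA⟩ := exists_kernelIntegral_one_le hH0 hH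
    have h1 := (hA (t / u) ((one_le_div h.1).2 h.2.le)).1
    have h2 : 0 < t := h.1.trans h.2
    have h3 : 0 ≤ (u / t) ^ (1 / 2 - H) := Real.rpow_nonneg (div_nonneg h.1.le h2.le) _
    have h4 : 0 ≤ (t - u) ^ (H - 1 / 2) := Real.rpow_nonneg (by linarith [h.2]) _
    have h5 : 0 ≤ u ^ (H - 1 / 2) := Real.rpow_nonneg h.1.le _
    have h6 : 0 ≤ 1 / 2 - H := by linarith
    positivity
  · rw [fbmKernel_eq_zero h]

lemma exists_fbmKernel_le (hH0 : 0 < H) (hH : H < 1 / 2) (hc : 0 < c) :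
    ∃ A, 0 < A ∧ ∀ t u, 0 < u → u < t →
      fbmKernel H c t u ≤ A * ((t - u) ^ (H - 1 / 2) + u ^ (H - 1 / 2)) := by
  obtain ⟨A, hA0, hA⟩ := exists_kernelIntegral_one_le hH0 hH
  refine ⟨c * (1 + (1 / 2 - H) * A), mul_pos hc (add_pos_of_pos_of_nonneg one_pos
    (mul_nonneg (by linarith) hA0)), fun t u hu ht => ?_⟩
  rw [fbmKernel_eq_scale hu ht]
  have h1 := (hA (t / u) ((one_le_div hu).2 ht.le)).2
  have h2 : 0 < t := hu.trans ht
  have h3 : (u / t) ^ (1 / 2 - H) ≤ 1 :=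
    Real.rpow_le_one (div_nonneg hu.le h2.le) ((div_le_one h2).2 ht.le) (by linarith)
  have h4 : 0 ≤ (t - u) ^ (H - 1 / 2) := Real.rpow_nonneg (by linarith) _
  have h5 : 0 ≤ u ^ (H - 1 / 2) := Real.rpow_nonneg hu.le _
  have h6 : 0 ≤ 1 / 2 - H := by linarith
  rw [mul_assoc c (1 + _)]
  refine mul_le_mul_of_nonneg_left ?_ hc.le
  have h7 : (u / t) ^ (1 / 2 - H) * (t - u) ^ (H - 1 / 2) ≤ 1 * (t - u) ^ (H - 1 / 2) :=
    mul_le_mul_of_nonneg_right h3 h4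
  have h8 : (1 / 2 - H) * u ^ (H - 1 / 2) * kernelIntegral H 1 (t / u) ≤
      (1 / 2 - H) * u ^ (H - 1 / 2) * A := mul_le_mul_of_nonneg_left h1 (mul_nonneg h6 h5)
  have h9 : 0 ≤ (1 / 2 - H) * A * (t - u) ^ (H - 1 / 2) := by positivity
  nlinarith

/-- The derivative of the kernel in its first variable. The contributions of the integral and of
the factor `t ^ (H - 1/2)` cancel. -/
lemma hasDerivAt_fbmKernel (hH0 : 0 < H) {u r : ℝ} (hu : 0 < u) (hr : u < r) :
    HasDerivAt (fun r => fbmKernel H c r u)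
      (-(c * (1 / 2 - H) * (u / r) ^ (1 / 2 - H) * (r - u) ^ (H - 3 / 2))) r := by
  have hr0 : 0 < r := hu.trans hr
  have hru : 0 < r - u := sub_pos.2 hr
  have h1 : HasDerivAt (fun r : ℝ => r ^ (H - 1 / 2)) ((H - 1 / 2) * r ^ (H - 1 / 2 - 1)) r :=
    Real.hasDerivAt_rpow_const (Or.inl hr0.ne')
  have h2 : HasDerivAt (fun r : ℝ => (r - u) ^ (H - 1 / 2))
      (1 * (H - 1 / 2) * (r - u) ^ (H - 1 / 2 - 1)) r :=
    ((hasDerivAt_id r).sub_const u).rpow_const (Or.inl hru.ne')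
  have h3 := ((((h1.mul h2).const_mul (u ^ (1 / 2 - H))).add
    ((hasDerivAt_kernelIntegral hH0 hu hr).const_mul ((1 / 2 - H) * u ^ (1 / 2 - H)))).const_mul c)
  have h4 : (fun r => fbmKernel H c r u) =ᶠ[𝓝 r] fun r =>
      c * (u ^ (1 / 2 - H) * (r ^ (H - 1 / 2) * (r - u) ^ (H - 1 / 2)) +
        (1 / 2 - H) * u ^ (1 / 2 - H) * kernelIntegral H u r) := by
    filter_upwards [lt_mem_nhds hr] with z hz
    rw [fbmKernel_eq hu hz, Real.div_rpow hu.le (hu.trans hz).le, div_eq_mul_inv,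
      ← Real.rpow_neg (hu.trans hz).le]
    have : -(1 / 2 - H) = H - 1 / 2 := by ring
    rw [this]
    ring
  refine (h3.congr_of_eventuallyEq h4).congr_deriv ?_
  have e1 : H - 1 / 2 - 1 = H - 3 / 2 := by ring
  have e2 : (u / r) ^ (1 / 2 - H) = u ^ (1 / 2 - H) * r ^ (H - 1 / 2) := by
    rw [Real.div_rpow hu.le hr0.le, div_eq_mul_inv, ← Real.rpow_neg hr0.le]
    congr 2
    ring
  rw [e1, e2]
  ring

lemma fbmKernel_antitone (hH0 : 0 < H) (hH : H < 1 / 2) (hc : 0 < c) {u s t : ℝ} (hu : 0 < u)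
    (hs : u < s) (hst : s ≤ t) : fbmKernel H c t u ≤ fbmKernel H c s u := by
  have h : AntitoneOn (fun r => fbmKernel H c r u) (Set.Ioi u) := by
    refine antitoneOn_of_deriv_nonpos (convex_Ioi u)
      (fun r hr => (hasDerivAt_fbmKernel hH0 hu hr).continuousAt.continuousWithinAt) ?_ ?_
    · rw [interior_Ioi]
      exact fun r hr => (hasDerivAt_fbmKernel hH0 hu hr).differentiableAt.differentiableWithinAt
    · rw [interior_Ioi]
      intro r hr
      rw [(hasDerivAt_fbmKernel hH0 hu hr).deriv]
      have h1 : 0 ≤ (u / r) ^ (1 / 2 - H) := Real.rpow_nonneg (div_nonneg hu.le (hu.trans hr).le) _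
      have h2 : 0 ≤ (r - u) ^ (H - 3 / 2) := Real.rpow_nonneg (sub_pos.2 hr).le _
      have h3 : 0 ≤ 1 / 2 - H := by linarith
      have : 0 ≤ c * (1 / 2 - H) * (u / r) ^ (1 / 2 - H) * (r - u) ^ (H - 3 / 2) := by positivity
      linarith
  exact h hs (hs.trans_le hst) hst

/-- The decay of the kernel in its first variable is at most that of `c (r - u) ^ (H - 1/2)`,
because the factor `(u / r) ^ (1/2 - H)` in its derivative is at most `1`. -/
lemma fbmKernel_sub_le (hH0 : 0 < H) (hH : H < 1 / 2) (hc : 0 < c) {u s t : ℝ} (hu : 0 < u)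
    (hs : u < s) (hst : s ≤ t) : fbmKernel H c s u - fbmKernel H c t u ≤
      c * ((s - u) ^ (H - 1 / 2) - (t - u) ^ (H - 1 / 2)) := by
  have hd : ∀ r, u < r → HasDerivAt (fun r => fbmKernel H c r u - c * (r - u) ^ (H - 1 / 2))
      (-(c * (1 / 2 - H) * (u / r) ^ (1 / 2 - H) * (r - u) ^ (H - 3 / 2)) -
        c * (1 * (H - 1 / 2) * (r - u) ^ (H - 1 / 2 - 1))) r := by
    intro r hr
    exact (hasDerivAt_fbmKernel hH0 hu hr).sub ((((hasDerivAt_id r).sub_const u).rpow_const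
      (Or.inl (sub_pos.2 hr).ne')).const_mul c)
  have h : MonotoneOn (fun r => fbmKernel H c r u - c * (r - u) ^ (H - 1 / 2)) (Set.Ioi u) := by
    refine monotoneOn_of_deriv_nonneg (convex_Ioi u)
      (fun r hr => (hd r hr).continuousAt.continuousWithinAt) ?_ ?_
    · rw [interior_Ioi]
      exact fun r hr => (hd r hr).differentiableAt.differentiableWithinAt
    · rw [interior_Ioi]
      intro r hr
      rw [(hd r hr).deriv]
      have hr0 : 0 < r := hu.trans hr
      have h1 : (u / r) ^ (1 / 2 - H) ≤ 1 := Real.rpow_le_one (div_nonneg hu.le hr0.le)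
        ((div_le_one hr0).2 (le_of_lt hr)) (by linarith)
      have h2 : 0 ≤ (r - u) ^ (H - 3 / 2) := Real.rpow_nonneg (sub_pos.2 hr).le _
      have h3 : 0 ≤ 1 / 2 - H := by linarith
      have e1 : H - 1 / 2 - 1 = H - 3 / 2 := by ring
      rw [e1]
      have h4 : 0 ≤ c * (1 / 2 - H) * (r - u) ^ (H - 3 / 2) * (1 - (u / r) ^ (1 / 2 - H)) :=
        mul_nonneg (by positivity) (by linarith)
      linarith
  have := h hs (hs.trans_le hst) hst
  simp only at this
  linarith

/-- For `u < s`, the increment of the kernel decays like `1 / (t - u)`, beyond its singularity at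
`s`. This follows from `z ≤ z ^ (1/2 - H)` for `z = (s - u) / (t - u)`. -/
lemma abs_fbmKernel_sub_le (hH0 : 0 < H) (hH : H < 1 / 2) (hc : 0 < c) {u s t : ℝ} (hu : 0 < u)
    (hs : u < s) (hst : s ≤ t) : |fbmKernel H c t u - fbmKernel H c s u| ≤
      c * (t - s) * ((s - u) ^ (H - 1 / 2) * (t - u) ^ (-1 : ℝ)) := by
  rw [abs_sub_comm, abs_of_nonneg (sub_nonneg.2 (fbmKernel_antitone hH0 hH hc hu hs hst))]
  refine (fbmKernel_sub_le hH0 hH hc hu hs hst).trans ?_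
  rw [mul_assoc]
  refine mul_le_mul_of_nonneg_left ?_ hc.le
  have hsu : 0 < s - u := sub_pos.2 hs
  have htu : 0 < t - u := by linarith
  have h1 : (s - u) / (t - u) ≤ ((s - u) / (t - u)) ^ (1 / 2 - H) :=
    Real.self_le_rpow_of_le_one (div_nonneg hsu.le htu.le)
      ((div_le_one htu).2 (by linarith)) (by linarith)
  have h2 : (t - u) ^ (H - 1 / 2) = (s - u) ^ (H - 1 / 2) *
      ((s - u) / (t - u)) ^ (1 / 2 - H) := by
    rw [Real.div_rpow hsu.le htu.le, div_eq_mul_inv ((s - u) ^ (1 / 2 - H)),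
      ← Real.rpow_neg htu.le, ← mul_assoc,
      ← Real.rpow_add hsu]
    have e1 : H - 1 / 2 + (1 / 2 - H) = 0 := by ring
    have e2 : -(1 / 2 - H) = H - 1 / 2 := by ring
    rw [e1, e2, Real.rpow_zero, one_mul]
  have h3 : 0 ≤ (s - u) ^ (H - 1 / 2) := Real.rpow_nonneg hsu.le _
  rw [h2, Real.rpow_neg_one]
  have h4 : (t - s) * ((s - u) ^ (H - 1 / 2) * (t - u)⁻¹) =
      (s - u) ^ (H - 1 / 2) * (1 - (s - u) / (t - u)) := by
    field_simp
    ring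
  rw [h4]
  have := mul_le_mul_of_nonneg_left h1 h3
  linarith

lemma continuousOn_fbmKernel (hH0 : 0 < H) (c t : ℝ) :
    ContinuousOn (fbmKernel H c t) (Set.Ioo 0 t) := by
  have h : ContinuousOn (fun u => c * ((u / t) ^ (1 / 2 - H) * (t - u) ^ (H - 1 / 2) +
      (1 / 2 - H) * u ^ (H - 1 / 2) * kernelIntegral H 1 (t / u))) (Set.Ioo 0 t) := by
    intro u hu
    have ht : 0 < t := hu.1.trans hu.2
    refine ContinuousAt.continuousWithinAt ?_
    refine continuousAt_const.mul (ContinuousAt.add (ContinuousAt.mul ?_ ?_)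
      (ContinuousAt.mul (continuousAt_const.mul ?_) ?_))
    · exact ContinuousAt.rpow_const (by fun_prop) (Or.inl (div_pos hu.1 ht).ne')
    · exact ContinuousAt.rpow_const (by fun_prop) (Or.inl (sub_pos.2 hu.2).ne')
    · exact Real.continuousAt_rpow_const _ _ (Or.inl hu.1.ne')
    · have h1 : ContinuousAt (kernelIntegral H 1) (t / u) :=
        (hasDerivAt_kernelIntegral hH0 one_pos ((one_lt_div hu.1).2 hu.2)).continuousAt
      exact ContinuousAt.comp (f := fun u => t / u) h1
        (continuousAt_const.div continuousAt_id hu.1.ne')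
  exact h.congr fun u hu => fbmKernel_eq_scale hu.1 hu.2

lemma continuousAt_fbmKernel (hH0 : 0 < H) (c : ℝ) {t u : ℝ} (hu : 0 < u) (hut : u ≠ t) :
    ContinuousAt (fbmKernel H c t) u := by
  rcases lt_or_gt_of_ne hut with h | h
  · exact (continuousOn_fbmKernel hH0 c t).continuousAt (Ioo_mem_nhds hu h)
  · refine (continuousAt_const (y := (0 : ℝ))).congr ?_
    filter_upwards [lt_mem_nhds h] with z hz
    exact (fbmKernel_eq_zero fun h' => absurd h'.2 (not_lt.2 hz.le)).symm

lemma measurable_fbmKernel (hH0 : 0 < H) (c t : ℝ) : Measurable (fbmKernel H c t) := by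
  classical
  have : fbmKernel H c t = (Set.Ioo 0 t).piecewise (fbmKernel H c t) 0 := by
    ext u
    by_cases hu : u ∈ Set.Ioo 0 t
    · rw [Set.piecewise_eq_of_mem _ _ _ hu]
    · rw [Set.piecewise_eq_of_notMem _ _ _ hu]
      exact fbmKernel_eq_zero hu
  rw [this]
  exact (continuousOn_fbmKernel hH0 c t).measurable_piecewise continuousOn_const
    measurableSet_Ioo

end Kernel

/-! ### One-dimensional integrals of the kernel -/

section OneDimensional

variable {H c : ℝ}

lemma lintegral_Ioo_sub_left (F : ℝ → ℝ≥0∞) (a b : ℝ) :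
    ∫⁻ x in Set.Ioo a b, F (b - x) = ∫⁻ x in Set.Ioo 0 (b - a), F x := by
  rw [← lintegral_indicator measurableSet_Ioo, ← lintegral_indicator measurableSet_Ioo,
    ← lintegral_sub_left_eq_self ((Set.Ioo 0 (b - a)).indicator F) b]
  refine lintegral_congr fun x => ?_
  have : x ∈ Set.Ioo a b ↔ b - x ∈ Set.Ioo 0 (b - a) := by
    simp only [Set.mem_Ioo]
    constructor <;> rintro ⟨h1, h2⟩ <;> constructor <;> linarith
  by_cases h : x ∈ Set.Ioo a b
  · rw [Set.indicator_of_mem h, Set.indicator_of_mem (this.1 h)]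
  · rw [Set.indicator_of_notMem h, Set.indicator_of_notMem fun h' => h (this.2 h')]

lemma lintegral_Ioo_sub_right (F : ℝ → ℝ≥0∞) (a b : ℝ) :
    ∫⁻ x in Set.Ioo a b, F (x - a) = ∫⁻ x in Set.Ioo 0 (b - a), F x := by
  rw [← lintegral_indicator measurableSet_Ioo, ← lintegral_indicator measurableSet_Ioo,
    ← lintegral_sub_right_eq_self ((Set.Ioo 0 (b - a)).indicator F) a]
  refine lintegral_congr fun x => ?_
  have : x ∈ Set.Ioo a b ↔ x - a ∈ Set.Ioo 0 (b - a) := by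
    simp only [Set.mem_Ioo]
    constructor <;> rintro ⟨h1, h2⟩ <;> constructor <;> linarith
  by_cases h : x ∈ Set.Ioo a b
  · rw [Set.indicator_of_mem h, Set.indicator_of_mem (this.1 h)]
  · rw [Set.indicator_of_notMem h, Set.indicator_of_notMem fun h' => h (this.2 h')]

lemma lintegral_Ioo_rpow {p b : ℝ} (hp : -1 < p) (hb : 0 ≤ b) :
    ∫⁻ x in Set.Ioo 0 b, ENNReal.ofReal (x ^ p) = ENNReal.ofReal (b ^ (p + 1) / (p + 1)) := by
  have hi : IntegrableOn (fun x : ℝ => x ^ p) (Set.Ioc 0 b) :=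
    (intervalIntegrable_iff_integrableOn_Ioc_of_le hb).1
      (intervalIntegral.intervalIntegrable_rpow' hp)
  rw [setLIntegral_congr Ioo_ae_eq_Ioc, ← ofReal_integral_eq_lintegral_ofReal hi,
    ← intervalIntegral.integral_of_le hb, integral_rpow (Or.inl hp),
    Real.zero_rpow (by linarith), sub_zero]
  exact (ae_restrict_iff' measurableSet_Ioc).2
    (Eventually.of_forall fun x hx => Real.rpow_nonneg hx.1.le _)

lemma sq_rpow_sub_half {x : ℝ} (hx : 0 ≤ x) : (x ^ (H - 1 / 2)) ^ 2 = x ^ (2 * H - 1) := by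
  rw [← Real.rpow_natCast, ← Real.rpow_mul hx]
  congr 1
  push_cast
  ring

/-- The tail integral that converges because `2H < β`. -/
lemma lintegral_rpow_mul_add_rpow_le (hH0 : 0 < H) {β τ : ℝ} (hβ : 2 * H < β) (hτ : 0 < τ) :
    ∫⁻ r in Set.Ioi 0, ENNReal.ofReal (r ^ (2 * H - 1) * (r + τ) ^ (-β)) ≤
      ENNReal.ofReal ((1 / (2 * H) + 1 / (β - 2 * H)) * τ ^ (2 * H - β)) := by
  have h1 : ∫⁻ r in Set.Ioo 0 τ, ENNReal.ofReal (r ^ (2 * H - 1) * (r + τ) ^ (-β)) ≤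
      ENNReal.ofReal (1 / (2 * H) * τ ^ (2 * H - β)) := by
    calc _ ≤ ∫⁻ r in Set.Ioo 0 τ, ENNReal.ofReal (r ^ (2 * H - 1)) * ENNReal.ofReal (τ ^ (-β)) := by
          refine setLIntegral_mono' measurableSet_Ioo fun r hr => ?_
          rw [← ENNReal.ofReal_mul (Real.rpow_nonneg hr.1.le _)]
          refine ENNReal.ofReal_le_ofReal (mul_le_mul_of_nonneg_left ?_
            (Real.rpow_nonneg hr.1.le _))
          exact Real.rpow_le_rpow_of_nonpos hτ (by linarith [hr.1]) (by linarith)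
      _ = ENNReal.ofReal (τ ^ (2 * H - 1 + 1) / (2 * H - 1 + 1)) * ENNReal.ofReal (τ ^ (-β)) := by
          rw [lintegral_mul_const _ (by fun_prop), lintegral_Ioo_rpow (by linarith) hτ.le]
      _ = _ := by
          rw [sub_add_cancel, ← ENNReal.ofReal_mul (by positivity), sub_eq_add_neg,
            Real.rpow_add hτ]
          congr 1
          ring
  have h2 : ∫⁻ r in Set.Ici τ, ENNReal.ofReal (r ^ (2 * H - 1) * (r + τ) ^ (-β)) ≤
      ENNReal.ofReal (1 / (β - 2 * H) * τ ^ (2 * H - β)) := by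
    have hlt : 2 * H - 1 - β < -1 := by linarith
    calc _ ≤ ∫⁻ r in Set.Ici τ, ENNReal.ofReal (r ^ (2 * H - 1 - β)) := by
          refine setLIntegral_mono' measurableSet_Ici fun r hr => ?_
          have hr0 : 0 < r := hτ.trans_le hr
          refine ENNReal.ofReal_le_ofReal ?_
          rw [sub_eq_add_neg _ β, Real.rpow_add hr0]
          refine mul_le_mul_of_nonneg_left ?_ (Real.rpow_nonneg hr0.le _)
          exact Real.rpow_le_rpow_of_nonpos hr0 (by linarith) (by linarith)
      _ = ENNReal.ofReal (∫ r in Set.Ioi τ, r ^ (2 * H - 1 - β)) := by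
          rw [setLIntegral_congr Ioi_ae_eq_Ici.symm, ofReal_integral_eq_lintegral_ofReal
            (integrableOn_Ioi_rpow_of_lt hlt hτ)]
          exact (ae_restrict_iff' measurableSet_Ioi).2
            (Eventually.of_forall fun x hx => Real.rpow_nonneg (hτ.trans hx).le _)
      _ = _ := by
          rw [integral_Ioi_rpow_of_lt hlt hτ]
          have e1 : 2 * H - 1 - β + 1 = -(β - 2 * H) := by ring
          have e2 : 2 * H - β = -(β - 2 * H) := by ring
          rw [e1, e2, neg_div_neg_eq]
          congr 1
          ring
  have hset : Set.Ioi (0 : ℝ) = Set.Ioo 0 τ ∪ Set.Ici τ := (Set.Ioo_union_Ici_eq_Ioi hτ).symm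
  rw [hset]
  refine (lintegral_union_le _ _ _).trans ((add_le_add h1 h2).trans (le_of_eq ?_))
  have h3 : 0 < β - 2 * H := by linarith
  rw [← ENNReal.ofReal_add (by positivity) (by positivity)]
  congr 1
  ring

lemma exists_lintegral_fbmKernel_sq_le (hH0 : 0 < H) (hH : H < 1 / 2) (hc : 0 < c) :
    ∃ M, 0 < M ∧ ∀ x r, 0 ≤ x → x ≤ r →
      ∫⁻ y in Set.Ico x r, ENNReal.ofReal (fbmKernel H c r y) ^ 2 ≤
        ENNReal.ofReal (M * (r - x) ^ (2 * H)) := by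
  obtain ⟨A, hA0, hA⟩ := exists_fbmKernel_le hH0 hH hc
  refine ⟨2 * A ^ 2 / H, by positivity, fun x r hx hxr => ?_⟩
  rw [setLIntegral_congr Ioo_ae_eq_Ico.symm]
  have hpt : ∀ y ∈ Set.Ioo x r, ENNReal.ofReal (fbmKernel H c r y) ^ 2 ≤
      ENNReal.ofReal (2 * A ^ 2) * (ENNReal.ofReal ((r - y) ^ (2 * H - 1)) +
        ENNReal.ofReal ((y - x) ^ (2 * H - 1))) := by
    intro y hy
    have hy0 : 0 < y := hx.trans_lt hy.1
    have h1 : 0 ≤ (r - y) ^ (H - 1 / 2) := Real.rpow_nonneg (by linarith [hy.2]) _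
    have h2 : 0 ≤ y ^ (H - 1 / 2) := Real.rpow_nonneg hy0.le _
    rw [← ENNReal.ofReal_pow (fbmKernel_nonneg hH0 hH hc _ _), ← ENNReal.ofReal_add
      (Real.rpow_nonneg (by linarith [hy.2]) _) (Real.rpow_nonneg (by linarith [hy.1]) _),
      ← ENNReal.ofReal_mul (by positivity)]
    refine ENNReal.ofReal_le_ofReal ?_
    have h3 : y ^ (2 * H - 1) ≤ (y - x) ^ (2 * H - 1) :=
      Real.rpow_le_rpow_of_nonpos (by linarith [hy.1]) (by linarith) (by linarith)
    calc fbmKernel H c r y ^ 2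
        ≤ (A * ((r - y) ^ (H - 1 / 2) + y ^ (H - 1 / 2))) ^ 2 :=
          pow_le_pow_left₀ (fbmKernel_nonneg hH0 hH hc _ _) (hA r y hy0 hy.2) 2
      _ ≤ 2 * A ^ 2 * (((r - y) ^ (H - 1 / 2)) ^ 2 + (y ^ (H - 1 / 2)) ^ 2) := by
          have : 0 ≤ A ^ 2 * ((r - y) ^ (H - 1 / 2) - y ^ (H - 1 / 2)) ^ 2 := by positivity
          linarith
      _ ≤ 2 * A ^ 2 * ((r - y) ^ (2 * H - 1) + (y - x) ^ (2 * H - 1)) := by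
          rw [sq_rpow_sub_half (by linarith [hy.2]), sq_rpow_sub_half hy0.le]
          gcongr
  refine (setLIntegral_mono' measurableSet_Ioo hpt).trans ?_
  rw [lintegral_const_mul _ (by fun_prop), lintegral_add_left (by fun_prop),
    lintegral_Ioo_sub_left (fun z => ENNReal.ofReal (z ^ (2 * H - 1))),
    lintegral_Ioo_sub_right (fun z => ENNReal.ofReal (z ^ (2 * H - 1))),
    lintegral_Ioo_rpow (by linarith) (sub_nonneg.2 hxr), sub_add_cancel]
  have h4 : 0 ≤ (r - x) ^ (2 * H) := Real.rpow_nonneg (sub_nonneg.2 hxr) _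
  rw [← ENNReal.ofReal_add (by positivity) (by positivity), ← ENNReal.ofReal_mul (by positivity)]
  refine ENNReal.ofReal_le_ofReal (le_of_eq ?_)
  field_simp
  ring

/-- The increment `|K(t, y) - K(s, y)|` of the kernel, as an extended nonnegative number. -/
def kernelIncr (H c s t y : ℝ) : ℝ≥0∞ := ENNReal.ofReal |fbmKernel H c t y - fbmKernel H c s y|

/-- A common majorant of `K(s, y)` and `K(t, y)`. -/
def kernelSum (H c s t y : ℝ) : ℝ≥0∞ := ENNReal.ofReal (fbmKernel H c s y + fbmKernel H c t y)

/-- The weight `(t - x)₊ ^ H`. -/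
def distWeight (H t x : ℝ) : ℝ≥0∞ := ENNReal.ofReal (max (t - x) 0 ^ H)

lemma measurable_kernelIncr (hH0 : 0 < H) (c s t : ℝ) : Measurable (kernelIncr H c s t) :=
  ((measurable_fbmKernel hH0 c t).sub (measurable_fbmKernel hH0 c s)).abs.ennreal_ofReal

lemma measurable_kernelSum (hH0 : 0 < H) (c s t : ℝ) : Measurable (kernelSum H c s t) :=
  ((measurable_fbmKernel hH0 c s).add (measurable_fbmKernel hH0 c t)).ennreal_ofReal

lemma measurable_distWeight (H t : ℝ) : Measurable (distWeight H t) := by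
  unfold distWeight
  fun_prop

lemma antitone_distWeight (hH0 : 0 < H) (t : ℝ) : Antitone (distWeight H t) := fun x y hxy =>
  ENNReal.ofReal_le_ofReal (Real.rpow_le_rpow (le_max_right _ _)
    (max_le_max (by linarith) le_rfl) hH0.le)

lemma distWeight_pow {t x : ℝ} (hx : x ≤ t) (m : ℕ) :
    distWeight H t x ^ m = ENNReal.ofReal ((t - x) ^ (H * m)) := by
  have h : 0 ≤ t - x := sub_nonneg.2 hx
  rw [distWeight, max_eq_left h, ← ENNReal.ofReal_pow (Real.rpow_nonneg h _),
    Real.rpow_mul_natCast h]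

lemma exists_lintegral_kernelSum_sq_le (hH0 : 0 < H) (hH : H < 1 / 2) (hc : 0 < c) :
    ∃ M, 1 ≤ M ∧ ∀ s t, s < t → ∀ x, 0 < x → x < t →
      ∫⁻ y in Set.Ico x t, kernelSum H c s t y ^ 2 ≤ ENNReal.ofReal M * distWeight H t x ^ 2 := by
  obtain ⟨M, hM0, hM⟩ := exists_lintegral_fbmKernel_sq_le hH0 hH hc
  refine ⟨4 * M + 1, by linarith, fun s t hst x hx hxt => ?_⟩
  have hpt : ∀ y, kernelSum H c s t y ^ 2 ≤
      2 * (ENNReal.ofReal (fbmKernel H c s y) ^ 2 + ENNReal.ofReal (fbmKernel H c t y) ^ 2) := by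
    intro y
    have h1 := fbmKernel_nonneg hH0 hH hc s y
    have h2 := fbmKernel_nonneg hH0 hH hc t y
    have e : (2 : ℝ≥0∞) = ENNReal.ofReal 2 := by simp
    rw [kernelSum, e, ← ENNReal.ofReal_pow h1, ← ENNReal.ofReal_pow h2,
      ← ENNReal.ofReal_add (by positivity) (by positivity), ← ENNReal.ofReal_mul (by norm_num),
      ← ENNReal.ofReal_pow (by positivity)]
    refine ENNReal.ofReal_le_ofReal ?_
    nlinarith [sq_nonneg (fbmKernel H c s y - fbmKernel H c t y)]
  have hs : ∫⁻ y in Set.Ico x t, ENNReal.ofReal (fbmKernel H c s y) ^ 2 ≤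
      ENNReal.ofReal (M * (t - x) ^ (2 * H)) := by
    rcases le_total s x with h | h
    · have : ∫⁻ y in Set.Ico x t, ENNReal.ofReal (fbmKernel H c s y) ^ 2 = 0 := by
        refine setLIntegral_eq_zero measurableSet_Ico fun y hy => ?_
        rw [fbmKernel_eq_zero fun h' => absurd h'.2 (not_lt.2 (h.trans hy.1))]
        simp
      rw [this]
      exact zero_le
    · have hsub : Set.Ico x t = Set.Ico x s ∪ Set.Ico s t :=
        (Set.Ico_union_Ico_eq_Ico h hst.le).symm
      rw [hsub]
      refine (lintegral_union_le _ _ _).trans ?_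
      have : ∫⁻ y in Set.Ico s t, ENNReal.ofReal (fbmKernel H c s y) ^ 2 = 0 := by
        refine setLIntegral_eq_zero measurableSet_Ico fun y hy => ?_
        rw [fbmKernel_eq_zero fun h' => absurd h'.2 (not_lt.2 hy.1)]
        simp
      rw [this, add_zero]
      refine (hM x s hx.le h).trans (ENNReal.ofReal_le_ofReal ?_)
      refine mul_le_mul_of_nonneg_left ?_ hM0.le
      exact Real.rpow_le_rpow (by linarith) (by linarith) (by linarith)
  have hmeas : ∀ r, Measurable fun y => ENNReal.ofReal (fbmKernel H c r y) ^ 2 := fun r =>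
    (measurable_fbmKernel hH0 c r).ennreal_ofReal.pow_const 2
  calc ∫⁻ y in Set.Ico x t, kernelSum H c s t y ^ 2
      ≤ ∫⁻ y in Set.Ico x t, 2 * (ENNReal.ofReal (fbmKernel H c s y) ^ 2 +
          ENNReal.ofReal (fbmKernel H c t y) ^ 2) := lintegral_mono fun y => hpt y
    _ = 2 * ((∫⁻ y in Set.Ico x t, ENNReal.ofReal (fbmKernel H c s y) ^ 2) +
          ∫⁻ y in Set.Ico x t, ENNReal.ofReal (fbmKernel H c t y) ^ 2) := by
        have hadd : Measurable fun y => ENNReal.ofReal (fbmKernel H c s y) ^ 2 +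
          ENNReal.ofReal (fbmKernel H c t y) ^ 2 := (hmeas s).add (hmeas t)
        rw [lintegral_const_mul _ hadd, lintegral_add_left (hmeas s)]
    _ ≤ 2 * (ENNReal.ofReal (M * (t - x) ^ (2 * H)) + ENNReal.ofReal (M * (t - x) ^ (2 * H))) := by
        gcongr
        exact hM x t hx.le hxt.le
    _ = ENNReal.ofReal (4 * M) * ENNReal.ofReal ((t - x) ^ (2 * H)) := by
        have h0 : 0 ≤ (t - x) ^ (2 * H) := Real.rpow_nonneg (by linarith) _
        have e : (2 : ℝ≥0∞) = ENNReal.ofReal 2 := by simp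
        rw [e, ← ENNReal.ofReal_add (by positivity) (by positivity),
          ← ENNReal.ofReal_mul (by norm_num), ← ENNReal.ofReal_mul (by positivity)]
        congr 1
        ring
    _ ≤ _ := by
        rw [distWeight_pow hxt.le, mul_comm 2 H]
        push_cast
        gcongr
        linarith

/-- The part of the integrals above `s`, where the increment of the kernel is `K(t, ·)`. -/
lemma lintegral_Ico_fbmKernel_sq_mul_le (hH0 : 0 < H) {M s t : ℝ} (hM0 : 0 ≤ M)
    (hst : s < t)
    (hM : ∫⁻ y in Set.Ico s t, ENNReal.ofReal (fbmKernel H c t y) ^ 2 ≤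
        ENNReal.ofReal (M * (t - s) ^ (2 * H))) (m : ℕ) :
    ∫⁻ y in Set.Ico s t, ENNReal.ofReal (fbmKernel H c t y) ^ 2 * distWeight H t y ^ m ≤
      ENNReal.ofReal (M * (t - s) ^ (H * (m + 2))) := by
  have hτ : 0 < t - s := sub_pos.2 hst
  calc _ ≤ ∫⁻ y in Set.Ico s t, ENNReal.ofReal (fbmKernel H c t y) ^ 2 * distWeight H t s ^ m := by
        refine setLIntegral_mono' measurableSet_Ico fun y hy => ?_
        gcongr
        exact antitone_distWeight hH0 t hy.1
    _ ≤ ENNReal.ofReal (M * (t - s) ^ (2 * H)) * distWeight H t s ^ m := by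
        rw [lintegral_mul_const _ ((measurable_fbmKernel hH0 c t).ennreal_ofReal.pow_const 2)]
        gcongr
    _ = _ := by
        rw [distWeight_pow hst.le, ← ENNReal.ofReal_mul (by positivity), mul_assoc,
          ← Real.rpow_add hτ]
        congr 3
        ring

lemma kernelIncr_of_le {s t y : ℝ} (hH0 : 0 < H) (hH : H < 1 / 2) (hc : 0 < c) (hy : s ≤ y) :
    kernelIncr H c s t y = ENNReal.ofReal (fbmKernel H c t y) := by
  rw [kernelIncr, fbmKernel_eq_zero (t := s) fun h => absurd h.2 (not_lt.2 hy), sub_zero,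
    abs_of_nonneg (fbmKernel_nonneg hH0 hH hc _ _)]

lemma kernelSum_of_le {s t y : ℝ} (hy : s ≤ y) :
    kernelSum H c s t y = ENNReal.ofReal (fbmKernel H c t y) := by
  rw [kernelSum, fbmKernel_eq_zero (t := s) fun h => absurd h.2 (not_lt.2 hy), zero_add]

/-- The weighted mean square of the increment of the kernel. The assumption on `m` makes the
integral converge far below `s`, uniformly in `s`; for `m = 2 (n - 1)` it says that `nH < 1`. -/
lemma exists_lintegral_kernelIncr_sq_le (hH0 : 0 < H) (hH : H < 1 / 2) (hc : 0 < c) (m : ℕ)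
    (hm : H * (m + 2) < 2) :
    ∃ b, 0 < b ∧ ∀ s t, 0 ≤ s → s < t →
      ∫⁻ x in Set.Ioo 0 t, kernelIncr H c s t x ^ 2 * distWeight H t x ^ m ≤
        ENNReal.ofReal (b * (t - s) ^ (H * (m + 2))) := by
  obtain ⟨M, hM0, hM⟩ := exists_lintegral_fbmKernel_sq_le hH0 hH hc
  set β : ℝ := 2 - H * m with hβ
  have hβ2 : 2 * H < β := by
    rw [hβ]
    linarith
  have hβ3 : 0 < β - 2 * H := by linarith
  refine ⟨c ^ 2 * (1 / (2 * H) + 1 / (β - 2 * H)) + M, by positivity, fun s t hs hst => ?_⟩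
  have hτ : 0 < t - s := sub_pos.2 hst
  have hsub : Set.Ioo 0 t ⊆ Set.Ioo 0 s ∪ Set.Ico s t := by
    intro x hx
    rcases lt_or_ge x s with h | h
    · exact Or.inl ⟨hx.1, h⟩
    · exact Or.inr ⟨h, hx.2⟩
  refine (lintegral_mono_set hsub).trans ((lintegral_union_le _ _ _).trans ?_)
  have h1 : ∫⁻ x in Set.Ioo 0 s, kernelIncr H c s t x ^ 2 * distWeight H t x ^ m ≤
      ENNReal.ofReal (c ^ 2 * (1 / (2 * H) + 1 / (β - 2 * H)) * (t - s) ^ (H * (m + 2))) := by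
    have hpt : ∀ x ∈ Set.Ioo 0 s, kernelIncr H c s t x ^ 2 * distWeight H t x ^ m ≤
        ENNReal.ofReal (c ^ 2 * (t - s) ^ 2) *
          ENNReal.ofReal ((s - x) ^ (2 * H - 1) * ((s - x) + (t - s)) ^ (-β)) := by
      intro x hx
      have htx : 0 < t - x := by linarith [hx.2]
      have hsx : 0 < s - x := by linarith [hx.2]
      rw [distWeight_pow (by linarith), kernelIncr, ← ENNReal.ofReal_pow (abs_nonneg _),
        ← ENNReal.ofReal_mul (by positivity), ← ENNReal.ofReal_mul (by positivity)]
      refine ENNReal.ofReal_le_ofReal ?_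
      have h2 := pow_le_pow_left₀ (abs_nonneg _)
        (abs_fbmKernel_sub_le hH0 hH hc hx.1 hx.2 hst.le) 2
      calc _ ≤ (c * (t - s) * ((s - x) ^ (H - 1 / 2) * (t - x) ^ (-1 : ℝ))) ^ 2 *
            (t - x) ^ (H * m) := mul_le_mul_of_nonneg_right h2 (Real.rpow_nonneg htx.le _)
        _ = c ^ 2 * (t - s) ^ 2 * (((s - x) ^ (H - 1 / 2)) ^ 2 *
            (((t - x) ^ (-1 : ℝ)) ^ 2 * (t - x) ^ (H * m))) := by ring
        _ = _ := by
            rw [sq_rpow_sub_half hsx.le, ← Real.rpow_natCast ((t - x) ^ (-1 : ℝ)) 2,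
              ← Real.rpow_mul htx.le, ← Real.rpow_add htx]
            have e1 : s - x + (t - s) = t - x := by ring
            rw [e1, hβ]
            congr 3
            push_cast
            ring
    refine (setLIntegral_mono' measurableSet_Ioo hpt).trans ?_
    rw [lintegral_const_mul _ (by fun_prop), lintegral_Ioo_sub_left
      (fun r => ENNReal.ofReal (r ^ (2 * H - 1) * (r + (t - s)) ^ (-β)))]
    refine (mul_le_mul' le_rfl ((lintegral_mono_set Set.Ioo_subset_Ioi_self).trans
      (lintegral_rpow_mul_add_rpow_le hH0 hβ2 hτ))).trans (le_of_eq ?_)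
    rw [← ENNReal.ofReal_mul (by positivity)]
    congr 1
    have e2 : (t - s) ^ (H * (m + 2)) = (t - s) ^ 2 * (t - s) ^ (2 * H - β) := by
      rw [← Real.rpow_natCast (t - s) 2, ← Real.rpow_add hτ, hβ]
      congr 1
      push_cast
      ring
    rw [e2]
    ring
  have h2 : ∫⁻ x in Set.Ico s t, kernelIncr H c s t x ^ 2 * distWeight H t x ^ m ≤
      ENNReal.ofReal (M * (t - s) ^ (H * (m + 2))) := by
    rw [setLIntegral_congr_fun measurableSet_Ico fun y hy => by
      rw [kernelIncr_of_le hH0 hH hc hy.1]]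
    exact lintegral_Ico_fbmKernel_sq_mul_le hH0 hM0.le hst (hM s t hs hst.le) m
  refine (add_le_add h1 h2).trans (le_of_eq ?_)
  rw [← ENNReal.ofReal_add (by positivity) (by positivity)]
  congr 1
  ring

/-- The weighted integral of the increment times the kernel. For `m = n - 2` the assumption on `m`
says that `nH < 1`. -/
lemma exists_lintegral_kernelIncr_mul_kernelSum_le (hH0 : 0 < H) (hH : H < 1 / 2) (hc : 0 < c)
    (m : ℕ) (hm : H * (m + 2) < 1) :
    ∃ b, 0 < b ∧ ∀ s t, 0 ≤ s → s < t →
      ∫⁻ x in Set.Ioo 0 t, kernelIncr H c s t x * kernelSum H c s t x * distWeight H t x ^ m ≤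
        ENNReal.ofReal (b * (t - s) ^ (H * (m + 2))) := by
  obtain ⟨M, hM0, hM⟩ := exists_lintegral_fbmKernel_sq_le hH0 hH hc
  obtain ⟨A, hA0, hA⟩ := exists_fbmKernel_le hH0 hH hc
  set β : ℝ := 1 - H * m with hβ
  have hβ2 : 2 * H < β := by
    rw [hβ]
    linarith
  have hβ3 : 0 < β - 2 * H := by linarith
  set J : ℝ := 1 / (2 * H) + 1 / (β - 2 * H) with hJ
  have hJ0 : 0 < J := by positivity
  refine ⟨6 * A * c * J + M, by positivity, fun s t hs hst => ?_⟩
  have hτ : 0 < t - s := sub_pos.2 hst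
  have hsub : Set.Ioo 0 t ⊆ Set.Ioo 0 s ∪ Set.Ico s t := by
    intro x hx
    rcases lt_or_ge x s with h | h
    · exact Or.inl ⟨hx.1, h⟩
    · exact Or.inr ⟨h, hx.2⟩
  refine (lintegral_mono_set hsub).trans ((lintegral_union_le _ _ _).trans ?_)
  have h1 : ∫⁻ x in Set.Ioo 0 s, kernelIncr H c s t x * kernelSum H c s t x *
      distWeight H t x ^ m ≤
      ENNReal.ofReal (6 * A * c * J * (t - s) ^ (H * (m + 2))) := by
    set q : ℝ → ℝ := fun r => r ^ (H - 1 / 2) * (r + (t - s)) ^ (-β) with hq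
    have hq0 : ∀ r, 0 < r → 0 ≤ q r := fun r hr =>
      mul_nonneg (Real.rpow_nonneg hr.le _) (Real.rpow_nonneg (by linarith) _)
    have hqanti : ∀ r r', 0 < r → r ≤ r' → q r' ≤ q r := by
      intro r r' hr hrr'
      refine mul_le_mul (Real.rpow_le_rpow_of_nonpos hr hrr' (by linarith))
        (Real.rpow_le_rpow_of_nonpos (by linarith) (by linarith) (by linarith))
        (Real.rpow_nonneg (by linarith) _) (Real.rpow_nonneg hr.le _)
    have hqr : ∀ r, 0 < r → q r * r ^ (H - 1 / 2) =
        r ^ (2 * H - 1) * (r + (t - s)) ^ (-β) := by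
      intro r hr
      rw [← sq_rpow_sub_half hr.le, hq]
      ring
    -- The product of the singularities at `s` and at `0` is at most the sum of the two products in
    -- which both factors are singular at the same point, since both factors are antitone.
    have hmix : ∀ x ∈ Set.Ioo 0 s, q (s - x) * x ^ (H - 1 / 2) ≤
        q (s - x) * (s - x) ^ (H - 1 / 2) + q x * x ^ (H - 1 / 2) := by
      intro x hx
      have hsx : 0 < s - x := by linarith [hx.2]
      have hp1 := mul_nonneg (hq0 _ hsx) (Real.rpow_nonneg hsx.le (H - 1 / 2))
      have hp2 := mul_nonneg (hq0 _ hx.1) (Real.rpow_nonneg hx.1.le (H - 1 / 2))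
      rcases le_total (s - x) x with h | h
      · have := mul_le_mul_of_nonneg_left
          (Real.rpow_le_rpow_of_nonpos hsx h (show H - 1 / 2 ≤ 0 by linarith)) (hq0 _ hsx)
        linarith
      · have := mul_le_mul_of_nonneg_right (hqanti _ _ hx.1 h)
          (Real.rpow_nonneg hx.1.le (H - 1 / 2))
        linarith
    have hpt : ∀ x ∈ Set.Ioo 0 s, kernelIncr H c s t x * kernelSum H c s t x *
        distWeight H t x ^ m ≤ ENNReal.ofReal (2 * A * c * (t - s)) *
          (2 * ENNReal.ofReal ((s - x) ^ (2 * H - 1) * ((s - x) + (t - s)) ^ (-β)) +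
            ENNReal.ofReal (x ^ (2 * H - 1) * (x + (t - s)) ^ (-β))) := by
      intro x hx
      have htx : 0 < t - x := by linarith [hx.2]
      have hsx : 0 < s - x := by linarith [hx.2]
      have hsum0 : 0 ≤ fbmKernel H c s x + fbmKernel H c t x :=
        add_nonneg (fbmKernel_nonneg hH0 hH hc _ _) (fbmKernel_nonneg hH0 hH hc _ _)
      have e : (2 : ℝ≥0∞) = ENNReal.ofReal 2 := by simp
      rw [← hqr _ hsx, ← hqr _ hx.1]
      have hp1 := mul_nonneg (hq0 _ hsx) (Real.rpow_nonneg hsx.le (H - 1 / 2))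
      have hp2 := mul_nonneg (hq0 _ hx.1) (Real.rpow_nonneg hx.1.le (H - 1 / 2))
      rw [distWeight_pow (by linarith), kernelIncr, kernelSum, e,
        ← ENNReal.ofReal_mul (abs_nonneg _), ← ENNReal.ofReal_mul (by positivity),
        ← ENNReal.ofReal_mul (by norm_num), ← ENNReal.ofReal_add (by positivity) hp2,
        ← ENNReal.ofReal_mul (by positivity)]
      refine ENNReal.ofReal_le_ofReal ?_
      have h2 := abs_fbmKernel_sub_le hH0 hH hc hx.1 hx.2 hst.le
      have h3 : fbmKernel H c s x + fbmKernel H c t x ≤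
          2 * (A * ((s - x) ^ (H - 1 / 2) + x ^ (H - 1 / 2))) := by
        have := hA s x hx.1 hx.2
        have := fbmKernel_antitone hH0 hH hc hx.1 hx.2 hst.le
        linarith
      have hqs : q (s - x) = (s - x) ^ (H - 1 / 2) * (t - x) ^ (-1 : ℝ) * (t - x) ^ (H * m) := by
        have e1 : s - x + (t - s) = t - x := by ring
        rw [hq]
        simp only
        rw [e1, mul_assoc, ← Real.rpow_add htx, hβ]
        congr 2
        ring
      have h4 := Real.rpow_nonneg hsx.le (H - 1 / 2)
      have h5 := Real.rpow_nonneg htx.le (-1)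
      calc _ ≤ c * (t - s) * ((s - x) ^ (H - 1 / 2) * (t - x) ^ (-1 : ℝ)) *
            (2 * (A * ((s - x) ^ (H - 1 / 2) + x ^ (H - 1 / 2)))) * (t - x) ^ (H * m) := by
            refine mul_le_mul_of_nonneg_right (mul_le_mul h2 h3 hsum0 ?_)
              (Real.rpow_nonneg htx.le _)
            positivity
        _ = 2 * A * c * (t - s) * (q (s - x) * (s - x) ^ (H - 1 / 2) +
            q (s - x) * x ^ (H - 1 / 2)) := by
            rw [hqs]
            ring
        _ ≤ _ := by
            refine mul_le_mul_of_nonneg_left ?_ (by positivity)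
            have := hmix x hx
            linarith
    refine (setLIntegral_mono' measurableSet_Ioo hpt).trans ?_
    rw [lintegral_const_mul _ (by fun_prop), lintegral_add_left (by fun_prop),
      lintegral_const_mul _ (by fun_prop), lintegral_Ioo_sub_left
      (fun r => ENNReal.ofReal (r ^ (2 * H - 1) * (r + (t - s)) ^ (-β))), sub_zero]
    have hJle := (lintegral_mono_set (μ := volume) (f := fun r : ℝ =>
      ENNReal.ofReal (r ^ (2 * H - 1) * (r + (t - s)) ^ (-β)))
      (Set.Ioo_subset_Ioi_self (α := ℝ) (b := 0) (a := s))).trans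
      (lintegral_rpow_mul_add_rpow_le hH0 hβ2 hτ)
    refine (mul_le_mul' le_rfl (add_le_add (mul_le_mul' le_rfl hJle) hJle)).trans (le_of_eq ?_)
    have e : (2 : ℝ≥0∞) = ENNReal.ofReal 2 := by simp
    rw [e, ← ENNReal.ofReal_mul (by norm_num), ← ENNReal.ofReal_add (by positivity) (by positivity),
      ← ENNReal.ofReal_mul (by positivity)]
    congr 1
    have e2 : (t - s) ^ (H * (m + 2)) = (t - s) * (t - s) ^ (2 * H - β) := by
      conv_rhs => rw [← Real.rpow_one (t - s), ← Real.rpow_mul hτ.le, one_mul]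
      rw [← Real.rpow_add hτ, hβ]
      congr 1
      ring
    rw [e2]
    ring
  have h2 : ∫⁻ x in Set.Ico s t, kernelIncr H c s t x * kernelSum H c s t x *
      distWeight H t x ^ m ≤ ENNReal.ofReal (M * (t - s) ^ (H * (m + 2))) := by
    rw [setLIntegral_congr_fun measurableSet_Ico fun y hy => by
      rw [kernelIncr_of_le hH0 hH hc hy.1, kernelSum_of_le hy.1, ← sq]]
    exact lintegral_Ico_fbmKernel_sq_mul_le hH0 hM0.le hst (hM s t hs hst.le) m
  refine (add_le_add h1 h2).trans (le_of_eq ?_)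
  rw [← ENNReal.ofReal_add (by positivity) (by positivity)]
  congr 1
  ring

end OneDimensional

/-! ### Power weights -/

section PowerWeight

lemma intervalIntegrable_abs_rpow {e : ℝ} (he : -1 < e) (a b : ℝ) :
    IntervalIntegrable (fun u : ℝ => |u| ^ e) volume a b := by
  have h1 : ∀ b : ℝ, 0 ≤ b → IntervalIntegrable (fun u : ℝ => |u| ^ e) volume 0 b := by
    intro b hb
    refine (intervalIntegral.intervalIntegrable_rpow' he).congr fun u hu => ?_
    rw [Set.uIoc_of_le hb] at hu
    rw [abs_of_pos hu.1]
  have h2 : ∀ b : ℝ, IntervalIntegrable (fun u : ℝ => |u| ^ e) volume 0 b := by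
    intro b
    rcases le_total 0 b with hb | hb
    · exact h1 b hb
    · have := (IntervalIntegrable.iff_comp_neg).1 (h1 (-b) (by linarith))
      simpa using this
  exact (h2 a).symm.trans (h2 b)

lemma integrableOn_abs_sub_rpow {e : ℝ} (he : -1 < e) (p a b : ℝ) :
    IntegrableOn (fun u : ℝ => |u - p| ^ e) (Set.Ioc a b) := by
  have h := (intervalIntegrable_abs_rpow he (a - p) (b - p)).comp_sub_right p
  simp only [sub_add_cancel] at h
  rcases le_total a b with hab | hab
  · exact (intervalIntegrable_iff_integrableOn_Ioc_of_le hab).1 h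
  · rw [Set.Ioc_eq_empty (not_lt.2 hab)]
    exact integrableOn_empty

lemma integral_abs_sub_rpow_ball {e r : ℝ} (he : -1 < e) (hr : 0 ≤ r) (p : ℝ) :
    ∫ u in Set.Ioc (p - r) (p + r), |u - p| ^ e = 2 * (r ^ (e + 1) / (e + 1)) := by
  have h1 : ∫ u in (0 : ℝ)..r, |u| ^ e = r ^ (e + 1) / (e + 1) := by
    have : ∫ u in (0 : ℝ)..r, |u| ^ e = ∫ u in (0 : ℝ)..r, u ^ e := by
      refine intervalIntegral.integral_congr fun u hu => ?_
      rw [Set.uIcc_of_le hr] at hu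
      rw [abs_of_nonneg hu.1]
    rw [this, integral_rpow (Or.inl he), Real.zero_rpow (by linarith), sub_zero]
  have h2 : ∫ u in (-r)..0, |u| ^ e = r ^ (e + 1) / (e + 1) := by
    have := intervalIntegral.integral_comp_neg (a := 0) (b := r) (fun u : ℝ => |u| ^ e)
    simp only [abs_neg, neg_zero] at this
    rw [← this, h1]
  rw [← intervalIntegral.integral_of_le (by linarith),
    intervalIntegral.integral_comp_sub_right (fun u : ℝ => |u| ^ e) p]
  have e1 : p - r - p = -r := by ring
  have e2 : p + r - p = r := by ring
  rw [e1, e2, ← intervalIntegral.integral_add_adjacent_intervals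
    (intervalIntegrable_abs_rpow he _ 0) (intervalIntegrable_abs_rpow he 0 _), h1, h2]
  ring

/-- Negative powers of the distance to a point are Muckenhoupt `A₁` weights: the average over an
interval is at most a constant times the value at any point of the interval. -/
lemma setIntegral_abs_sub_rpow_le {e : ℝ} (he : -1 < e) (he0 : e ≤ 0) {p a b x : ℝ}
    (hx : x ∈ Set.Ioc a b) (hxp : x ≠ p) :
    ∫ u in Set.Ioc a b, |u - p| ^ e ≤
      (b - a) * ((1 / 2) ^ e * (1 + 2 / (e + 1)) * |x - p| ^ e) := by
  set r : ℝ := |x - p| / 2 with hr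
  have hxp0 : 0 < |x - p| := abs_pos.2 (sub_ne_zero.2 hxp)
  have hr0 : 0 < r := by positivity
  have hab : a < b := hx.1.trans_le hx.2
  have hre : r ^ e = (1 / 2) ^ e * |x - p| ^ e := by
    rw [← Real.mul_rpow (by norm_num) (abs_nonneg _), hr]
    congr 1
    ring
  have he1 : 0 < e + 1 := by linarith
  have hrpos : 0 < r ^ e := Real.rpow_pos_of_pos hr0 _
  have hfar : ∀ u, r ≤ |u - p| → |u - p| ^ e ≤ r ^ e := fun u hu =>
    Real.rpow_le_rpow_of_nonpos hr0 hu he0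
  have hconst : ∫ _ in Set.Ioc a b, r ^ e = (b - a) * r ^ e := by
    rw [setIntegral_const, measureReal_def, Real.volume_Ioc,
      ENNReal.toReal_ofReal (by linarith), smul_eq_mul]
  have hconsti : IntegrableOn (fun _ : ℝ => r ^ e) (Set.Ioc a b) :=
    integrableOn_const (by simp)
  -- A short interval stays away from `p`. In a long one, the singular part of the integral is at
  -- most the integral over a ball of radius `r ≤ b - a`.
  rcases lt_or_ge (b - a) r with h | h
  · have h1 : ∫ u in Set.Ioc a b, |u - p| ^ e ≤ ∫ _ in Set.Ioc a b, r ^ e := by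
      refine setIntegral_mono_on (integrableOn_abs_sub_rpow he p a b) hconsti measurableSet_Ioc
        fun u hu => hfar u ?_
      have h2 : |x - p| ≤ |u - p| + |x - u| := by
        have := abs_add_le (u - p) (x - u)
        rwa [show u - p + (x - u) = x - p by ring] at this
      have h3 : |x - u| ≤ b - a := by
        rw [abs_le]
        constructor <;> linarith [hu.1, hu.2, hx.1, hx.2]
      linarith
    rw [hconst, hre] at h1
    refine h1.trans (mul_le_mul_of_nonneg_left ?_ (by linarith))
    have h4 : 0 ≤ (1 / 2 : ℝ) ^ e * (2 / (e + 1)) * |x - p| ^ e := by positivity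
    linarith
  · set N : ℝ → ℝ := (Set.Ioc (p - r) (p + r)).indicator (fun u => |u - p| ^ e) with hN
    have hNi : Integrable N := by
      rw [hN, integrable_indicator_iff measurableSet_Ioc]
      exact integrableOn_abs_sub_rpow he p _ _
    have hN0 : ∀ u, 0 ≤ N u := fun u =>
      Set.indicator_nonneg (fun u _ => Real.rpow_nonneg (abs_nonneg _) _) u
    have h1 : ∫ u in Set.Ioc a b, |u - p| ^ e ≤ ∫ u in Set.Ioc a b, (r ^ e + N u) := by
      refine setIntegral_mono_on (integrableOn_abs_sub_rpow he p a b)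
        (hconsti.add hNi.integrableOn) measurableSet_Ioc fun u _ => ?_
      by_cases hu : u ∈ Set.Ioc (p - r) (p + r)
      · rw [hN, Set.indicator_of_mem hu]
        linarith
      · have := hfar u (by
          by_contra! hlt
          rw [abs_lt] at hlt
          exact hu ⟨by linarith, by linarith⟩)
        linarith [hN0 u]
    have h2 : ∫ u in Set.Ioc a b, N u ≤ 2 * (r ^ (e + 1) / (e + 1)) := by
      refine (setIntegral_le_integral hNi (Eventually.of_forall hN0)).trans (le_of_eq ?_)
      rw [hN, integral_indicator measurableSet_Ioc, integral_abs_sub_rpow_ball he hr0.le]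
    rw [integral_add hconsti hNi.integrableOn, hconst] at h1
    have h3 : r ^ (e + 1) = r * r ^ e := by
      rw [Real.rpow_add hr0, Real.rpow_one, mul_comm]
    have h4 : 2 * (r ^ (e + 1) / (e + 1)) ≤ (b - a) * (2 / (e + 1) * r ^ e) := by
      rw [h3]
      have : r * (2 / (e + 1) * r ^ e) ≤ (b - a) * (2 / (e + 1) * r ^ e) :=
        mul_le_mul_of_nonneg_right h (by positivity)
      refine le_trans (le_of_eq ?_) this
      ring
    have h5 : (1 / 2 : ℝ) ^ e * (1 + 2 / (e + 1)) * |x - p| ^ e =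
        r ^ e + 2 / (e + 1) * r ^ e := by
      rw [hre]
      ring
    rw [h5, mul_add]
    linarith

end PowerWeight

/-! ### The integrand -/

section Integrand

variable {H c : ℝ} {n : ℕ}

/-- A majorant of `K(s, ·)` and `K(t, ·)` that is a sum of powers of the distance to a point. -/
def kernelMajorant (H A s t u : ℝ) : ℝ :=
  A * (|u - t| ^ (H - 1 / 2) + |u - s| ^ (H - 1 / 2) + |u - 0| ^ (H - 1 / 2))

lemma kernelMajorant_nonneg {A : ℝ} (hA : 0 ≤ A) (H s t u : ℝ) :
    0 ≤ kernelMajorant H A s t u := by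
  unfold kernelMajorant
  positivity

lemma integrableOn_kernelMajorant (hH0 : 0 < H) (A s t a b : ℝ) :
    IntegrableOn (kernelMajorant H A s t) (Set.Ioc a b) := by
  have he : -1 < H - 1 / 2 := by linarith
  exact (((integrableOn_abs_sub_rpow he t a b).add (integrableOn_abs_sub_rpow he s a b)).add
    (integrableOn_abs_sub_rpow he 0 a b)).const_mul A

lemma integrableOn_kernelMajorant_sq (hH0 : 0 < H) (A s t : ℝ) (T : ℝ) :
    IntegrableOn (fun u => kernelMajorant H A s t u ^ 2) (Set.Icc 0 T) := by
  have he : -1 < 2 * H - 1 := by linarith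
  rw [integrableOn_Icc_iff_integrableOn_Ioc]
  have hi := (((integrableOn_abs_sub_rpow he t 0 T).add
    (integrableOn_abs_sub_rpow he s 0 T)).add
    (integrableOn_abs_sub_rpow he 0 0 T)).const_mul (3 * A ^ 2)
  refine Integrable.mono' hi ?_ (Eventually.of_forall fun u => ?_)
  · refine Measurable.aestronglyMeasurable ?_
    unfold kernelMajorant
    fun_prop
  · rw [Real.norm_eq_abs, abs_of_nonneg (sq_nonneg _), kernelMajorant]
    simp only [Pi.add_apply]
    rw [← sq_rpow_sub_half (abs_nonneg (u - t)), ← sq_rpow_sub_half (abs_nonneg (u - s)),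
      ← sq_rpow_sub_half (abs_nonneg (u - 0)), mul_pow, mul_comm (3 : ℝ), mul_assoc]
    refine mul_le_mul_of_nonneg_left ?_ (sq_nonneg A)
    set x := |u - t| ^ (H - 1 / 2)
    set y := |u - s| ^ (H - 1 / 2)
    set z := |u - 0| ^ (H - 1 / 2)
    nlinarith [sq_nonneg (x - y), sq_nonneg (y - z), sq_nonneg (x - z)]

lemma setIntegral_kernelMajorant_le (hH0 : 0 < H) (hH : H < 1 / 2) {A : ℝ} (hA : 0 ≤ A)
    (s t a b x : ℝ) (hx : x ∈ Set.Ioc a b) (hbad : x ∉ ({0, s, t} : Set ℝ)) :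
    ∫ u in Set.Ioc a b, kernelMajorant H A s t u ≤
      (b - a) * (((1 / 2) ^ (H - 1 / 2) * (1 + 2 / (H - 1 / 2 + 1))) *
        kernelMajorant H A s t x) := by
  have he : -1 < H - 1 / 2 := by linarith
  have he0 : H - 1 / 2 ≤ 0 := by linarith
  simp only [Set.mem_insert_iff, Set.mem_singleton_iff, not_or] at hbad
  have i0 := integrableOn_abs_sub_rpow he 0 a b
  have is := integrableOn_abs_sub_rpow he s a b
  have it := integrableOn_abs_sub_rpow he t a b
  have his : IntegrableOn (fun u => |u - t| ^ (H - 1 / 2) + |u - s| ^ (H - 1 / 2))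
    (Set.Ioc a b) := it.add is
  unfold kernelMajorant
  rw [integral_const_mul, integral_add his i0, integral_add it is]
  have h0 := setIntegral_abs_sub_rpow_le he he0 hx hbad.1
  have h1 := setIntegral_abs_sub_rpow_le he he0 hx hbad.2.1
  have h2 := setIntegral_abs_sub_rpow_le he he0 hx hbad.2.2
  refine (mul_le_mul_of_nonneg_left (add_le_add (add_le_add h2 h1) h0) hA).trans (le_of_eq ?_)
  ring

lemma fbmKernel_le_kernelMajorant {A : ℝ} (hA0 : 0 ≤ A)
    (hA : ∀ t u, 0 < u → u < t →
      fbmKernel H c t u ≤ A * ((t - u) ^ (H - 1 / 2) + u ^ (H - 1 / 2))) (s t u : ℝ) :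
    fbmKernel H c t u ≤ kernelMajorant H A s t u ∧
      fbmKernel H c s u ≤ kernelMajorant H A s t u := by
  have hp : ∀ p : ℝ, 0 ≤ |u - p| ^ (H - 1 / 2) := fun p => Real.rpow_nonneg (abs_nonneg _) _
  have key : ∀ r, fbmKernel H c r u ≤ A * (|u - r| ^ (H - 1 / 2) + |u - 0| ^ (H - 1 / 2)) := by
    intro r
    by_cases h : 0 < u ∧ u < r
    · rw [abs_sub_comm u r, abs_of_pos (sub_pos.2 h.2), sub_zero, abs_of_pos h.1]
      exact hA r u h.1 h.2
    · rw [fbmKernel_eq_zero h]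
      exact mul_nonneg hA0 (add_nonneg (hp r) (hp 0))
  constructor
  · refine (key t).trans (mul_le_mul_of_nonneg_left ?_ hA0)
    linarith [hp s]
  · refine (key s).trans (mul_le_mul_of_nonneg_left ?_ hA0)
    linarith [hp t]

lemma measurableSet_regionA (j : Fin n) (t : ℝ) : MeasurableSet (regionA j t) := by
  have : regionA j t = (⋂ l, {u : Fin n → ℝ | u l ∈ Set.Icc 0 t}) ∩
      ((⋂ l, {u : Fin n → ℝ | u j ≤ u l}) ∩
      ((⋂ l, ⋂ m, ⋂ (_ : l < m), ⋂ (_ : m < j), {u : Fin n → ℝ | u m < u l}) ∩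
        ⋂ l, ⋂ m, ⋂ (_ : j < l), ⋂ (_ : l < m), {u : Fin n → ℝ | u l < u m})) := by
    ext u
    simp only [regionA, Set.mem_inter_iff, Set.mem_iInter]
    rfl
  rw [this]
  refine (MeasurableSet.iInter fun l => measurable_pi_apply l measurableSet_Icc).inter
    ((MeasurableSet.iInter fun l => measurableSet_le (measurable_pi_apply j)
      (measurable_pi_apply l)).inter ((MeasurableSet.iInter fun l => MeasurableSet.iInter fun m =>
      MeasurableSet.iInter fun _ => MeasurableSet.iInter fun _ => ?_).inter
      (MeasurableSet.iInter fun l => MeasurableSet.iInter fun m =>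
      MeasurableSet.iInter fun _ => MeasurableSet.iInter fun _ => ?_)))
  · exact measurableSet_lt (measurable_pi_apply m) (measurable_pi_apply l)
  · exact measurableSet_lt (measurable_pi_apply l) (measurable_pi_apply m)

/-- The integrand without the indicator function of the region `A_j^n`. -/
def volterraProd (H c : ℝ) (j : Fin n) (s t : ℝ) (u : Fin n → ℝ) : ℝ :=
  (∏ l ∈ Finset.Iio j, fbmKernel H c s (u l)) *
    (fbmKernel H c t (u j) - fbmKernel H c s (u j)) *
    ∏ l ∈ Finset.Ioi j, fbmKernel H c t (u l)

lemma measurable_volterraProd (hH0 : 0 < H) (c : ℝ) (j : Fin n) (s t : ℝ) :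
    Measurable (volterraProd H c j s t) := by
  have hm : ∀ r l, Measurable fun u : Fin n → ℝ => fbmKernel H c r (u l) := fun r l =>
    (measurable_fbmKernel hH0 c r).comp (measurable_pi_apply l)
  exact ((Finset.measurable_fun_prod _ fun l _ => hm s l).mul ((hm t j).sub (hm s j))).mul
    (Finset.measurable_fun_prod _ fun l _ => hm t l)

lemma measurable_volterraIntegrand (hH0 : 0 < H) (c : ℝ) (j : Fin n) (s t : ℝ) :
    Measurable (volterraIntegrand H c j s t) := by
  classical
  exact Measurable.ite (measurableSet_regionA j t) (measurable_volterraProd hH0 c j s t)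
    measurable_const

lemma continuousAt_volterraProd (hH0 : 0 < H) (c : ℝ) (j : Fin n) {s t : ℝ} {y : Fin n → ℝ}
    (hy : ∀ l, 0 < y l ∧ y l ≠ s ∧ y l ≠ t) : ContinuousAt (volterraProd H c j s t) y := by
  have ht : ∀ l, ContinuousAt (fun u : Fin n → ℝ => fbmKernel H c t (u l)) y := fun l =>
    ContinuousAt.comp (f := fun u : Fin n → ℝ => u l)
      (continuousAt_fbmKernel hH0 c (hy l).1 (hy l).2.2) (continuous_apply l).continuousAt
  have hs : ∀ l, ContinuousAt (fun u : Fin n → ℝ => fbmKernel H c s (u l)) y := fun l =>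
    ContinuousAt.comp (f := fun u : Fin n → ℝ => u l)
      (continuousAt_fbmKernel hH0 c (hy l).1 (hy l).2.1) (continuous_apply l).continuousAt
  exact ((tendsto_finsetProd _ fun l _ => hs l).mul ((ht j).sub (hs j))).mul
    (tendsto_finsetProd _ fun l _ => ht l)

lemma prod_Iio_mul_mul_prod_Ioi {M : Type*} [CommMonoid M] (j : Fin n) (F : Fin n → M) :
    (∏ l ∈ Finset.Iio j, F l) * F j * ∏ l ∈ Finset.Ioi j, F l = ∏ l, F l := by
  have h1 : (Finset.univ : Finset (Fin n)) = Finset.Iio j ∪ Finset.Ici j := by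
    ext l
    simp [lt_or_ge]
  have h2 : Disjoint (Finset.Iio j) (Finset.Ici j) := by
    rw [Finset.disjoint_left]
    intro l hl hl'
    exact absurd (Finset.mem_Iio.1 hl) (not_lt.2 (Finset.mem_Ici.1 hl'))
  have h3 : Finset.Ici j = insert j (Finset.Ioi j) := (Finset.Ioi_insert j).symm
  rw [h1, Finset.prod_union h2, h3, Finset.prod_insert (by simp), mul_assoc]

lemma abs_volterraProd_le {F : Fin n → ℝ} {j : Fin n} {s t : ℝ} {u : Fin n → ℝ}
    (hs : ∀ l ∈ Finset.Iio j, |fbmKernel H c s (u l)| ≤ F l)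
    (hj : |fbmKernel H c t (u j) - fbmKernel H c s (u j)| ≤ F j)
    (ht : ∀ l ∈ Finset.Ioi j, |fbmKernel H c t (u l)| ≤ F l) :
    |volterraProd H c j s t u| ≤ ∏ l, F l := by
  rw [volterraProd, abs_mul, abs_mul, Finset.abs_prod, Finset.abs_prod,
    ← prod_Iio_mul_mul_prod_Ioi j F]
  have h1 := Finset.prod_le_prod (fun l _ => abs_nonneg _) hs
  have h2 := Finset.prod_le_prod (fun l _ => abs_nonneg _) ht
  have h3 : 0 ≤ ∏ l ∈ Finset.Iio j, F l :=
    Finset.prod_nonneg fun l hl => (abs_nonneg _).trans (hs l hl)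
  exact mul_le_mul (mul_le_mul h1 hj (abs_nonneg _) h3) h2
    (Finset.prod_nonneg fun l _ => abs_nonneg _) (mul_nonneg h3 ((abs_nonneg _).trans hj))

lemma ofReal_minRegionAbs_le (hH0 : 0 < H) (hH : H < 1 / 2) (hc : 0 < c) (j : Fin n) (s t : ℝ)
    (y : Fin n → ℝ) : ENNReal.ofReal (minRegionAbs (volterraProd H c j s t) j t y) ≤
      minRegionProd (kernelIncr H c s t) (kernelSum H c s t) j t y := by
  unfold minRegionAbs minRegionProd
  split_ifs
  · have h0 := fun r l => fbmKernel_nonneg hH0 hH hc r (y l)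
    have := abs_volterraProd_le (c := c) (H := H) (s := s) (t := t) (u := y) (j := j)
      (F := fun l => if l = j then |fbmKernel H c t (y l) - fbmKernel H c s (y l)| else
        fbmKernel H c s (y l) + fbmKernel H c t (y l)) (fun l hl => ?_) ?_ fun l hl => ?_
    · refine (ENNReal.ofReal_le_ofReal this).trans (le_of_eq ?_)
      rw [ENNReal.ofReal_prod_of_nonneg]
      · refine Finset.prod_congr rfl fun l _ => ?_
        split_ifs <;> rfl
      · intro l _
        split_ifs
        · exact abs_nonneg _
        · exact add_nonneg (h0 _ _) (h0 _ _)
    · rw [if_neg (Finset.mem_Iio.1 hl).ne, abs_of_nonneg (h0 _ _)]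
      linarith [h0 t l]
    · rw [if_pos rfl]
    · rw [if_neg (Finset.mem_Ioi.1 hl).ne', abs_of_nonneg (h0 _ _)]
      linarith [h0 s l]
  · simp

end Integrand

/-! ### The moment estimate -/

section Final

variable {H c : ℝ} {n : ℕ}

/-- The deterministic estimate: the integral belonging to a pairing is at most a constant times
`(t - s) ^ (2nH)`. -/
lemma exists_lintegral_pairing_le (hH0 : 0 < H) (hH : H < 1 / 2) (hc : 0 < c) (hn1 : 1 ≤ n)
    (hnH : n * H < 1) :
    ∃ b, 0 < b ∧ ∀ s t, 0 ≤ s → s < t → ∀ (j : Fin n) (e : (Fin n × Bool) ≃ (Fin n ⊕ Fin n)),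
      ∫⁻ x : Fin n → ℝ, ENNReal.ofReal
        (minRegionAbs (volterraProd H c j s t) j t (fun l => x (pairLabel e (Sum.inl l))) *
          minRegionAbs (volterraProd H c j s t) j t (fun l => x (pairLabel e (Sum.inr l)))) ≤
      ENNReal.ofReal (b * (t - s) ^ (2 * n * H)) := by
  obtain ⟨M, hM1, hM⟩ := exists_lintegral_kernelSum_sq_le hH0 hH hc
  have hcast2 : ((2 * (n - 1) : ℕ) : ℝ) + 2 = 2 * n := by
    rw [Nat.cast_mul, Nat.cast_sub hn1]
    push_cast
    ring
  obtain ⟨b₂, hb₂, hE2⟩ := exists_lintegral_kernelIncr_sq_le hH0 hH hc (2 * (n - 1)) (by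
    rw [hcast2]
    linarith)
  have hE3 : ∃ b₃, 0 < b₃ ∧ (2 ≤ n → ∀ s t, 0 ≤ s → s < t →
      ∫⁻ x in Set.Ioo 0 t, kernelIncr H c s t x * kernelSum H c s t x *
        distWeight H t x ^ (n - 2) ≤ ENNReal.ofReal (b₃ * (t - s) ^ (H * n))) := by
    by_cases hn2 : 2 ≤ n
    · have hcast3 : ((n - 2 : ℕ) : ℝ) + 2 = n := by
        rw [Nat.cast_sub hn2]
        push_cast
        ring
      obtain ⟨b₃, hb₃, h⟩ := exists_lintegral_kernelIncr_mul_kernelSum_le hH0 hH hc (n - 2) (by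
        rw [hcast3]
        linarith)
      rw [hcast3] at h
      exact ⟨b₃, hb₃, fun _ => h⟩
    · exact ⟨1, one_pos, fun h => absurd h hn2⟩
  obtain ⟨b₃, hb₃, hE3⟩ := hE3
  rw [hcast2] at hE2
  set β := 1 + b₂ + b₃ with hβ
  refine ⟨M ^ n * β ^ 2, by positivity, fun s t hs hst j e => ?_⟩
  have hτ : 0 < t - s := sub_pos.2 hst
  have hpow : ((t - s) ^ (H * n)) ^ 2 = (t - s) ^ (2 * n * H) := by
    rw [← Real.rpow_mul_natCast hτ.le]
    congr 1
    push_cast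
    ring
  have hmain := lintegral_minRegionProd_mul_le (n := n) (measurable_kernelIncr hH0 c s t)
    (measurable_kernelSum hH0 c s t) (measurable_distWeight H t) (t := t)
    (fun x hx => by
      have h1 : 0 < max (t - x) 0 := lt_max_of_lt_left (sub_pos.2 hx)
      exact (ENNReal.ofReal_pos.2 (Real.rpow_pos_of_pos h1 _)).ne')
    (fun x => ENNReal.ofReal_ne_top) (antitone_distWeight hH0 t)
    (M := ENNReal.ofReal M) (B := ENNReal.ofReal (β * (t - s) ^ (H * n)))
    (by rw [← ENNReal.ofReal_one]; exact ENNReal.ofReal_le_ofReal hM1)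
    (hM s t hst)
    (by
      refine (hE2 s t hs hst).trans ?_
      rw [← ENNReal.ofReal_pow (by positivity)]
      refine ENNReal.ofReal_le_ofReal ?_
      rw [mul_pow, hpow, show H * (2 * n) = 2 * n * H by ring]
      refine mul_le_mul_of_nonneg_right ?_ (by positivity)
      nlinarith)
    (fun hn2 => by
      refine (hE3 hn2 s t hs hst).trans (ENNReal.ofReal_le_ofReal ?_)
      refine mul_le_mul_of_nonneg_right ?_ (by positivity)
      linarith) e j
  have hM0 : 0 ≤ M := by linarith
  refine (lintegral_mono fun x => ?_).trans (hmain.trans (le_of_eq ?_))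
  · rw [ENNReal.ofReal_mul (minRegionAbs_nonneg _ _ _ _)]
    exact mul_le_mul' (ofReal_minRegionAbs_le hH0 hH hc j s t _)
      (ofReal_minRegionAbs_le hH0 hH hc j s t _)
  · rw [← ENNReal.ofReal_pow hM0, ← ENNReal.ofReal_pow (by positivity),
      ← ENNReal.ofReal_mul (by positivity), mul_pow, hpow]
    congr 1
    ring

lemma exists_isStratonovichIntegral_volterraIntegrand (hH0 : 0 < H) (hH : H < 1 / 2) (hc : 0 < c)
    {b : ℝ} (hb : 0 < b)
    (hbound : ∀ s t, 0 ≤ s → s < t → ∀ (j : Fin n) (e : (Fin n × Bool) ≃ (Fin n ⊕ Fin n)),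
      ∫⁻ x : Fin n → ℝ, ENNReal.ofReal
        (minRegionAbs (volterraProd H c j s t) j t (fun l => x (pairLabel e (Sum.inl l))) *
          minRegionAbs (volterraProd H c j s t) j t (fun l => x (pairLabel e (Sum.inr l)))) ≤
      ENNReal.ofReal (b * (t - s) ^ (2 * n * H)))
    {Ω : Type*} [MeasurableSpace Ω] {P : Measure Ω} {d : ℕ} {W : Fin d → ℝ≥0 → Ω → ℝ}
    (hW : IsWienerProcess W P) {T : ℝ≥0} {s t : ℝ} (hs : 0 ≤ s) (hst : s < t) (htT : t ≤ T)
    (j : Fin n) (i : Fin n → Fin d) :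
    ∃ I, IsStratonovichIntegral P W T i (volterraIntegrand H c j s t) I ∧ ∫ ω, I ω ^ 2 ∂P ≤
      wickConst n * (Fintype.card ((Fin n × Bool) ≃ (Fin n ⊕ Fin n)) *
        (b * (t - s) ^ (2 * n * H))) := by
  have hT : 0 < T := by
    have : (0 : ℝ) < T := (hs.trans_lt hst).trans_le htT
    exact_mod_cast this
  obtain ⟨A, hA0, hA⟩ := exists_fbmKernel_le hH0 hH hc
  have hG0 := fun u => kernelMajorant_nonneg hA0.le H s t u
  have hmaj := fbmKernel_le_kernelMajorant hA0.le hA s t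
  have h0 := fun r u => fbmKernel_nonneg hH0 hH hc r u
  refine exists_stratonovichIntegral_le (g := volterraProd H c j s t) (j := j) (t := t)
    (G := kernelMajorant H A s t) (bad := {0, s, t}) hW hT i
    (measurable_volterraIntegrand hH0 c j s t) (fun u => rfl) hG0
    (integrableOn_kernelMajorant hH0 A s t) (integrableOn_kernelMajorant_sq hH0 A s t T)
    (fun u => ?_) (setIntegral_kernelMajorant_le hH0 hH hA0.le s t) (Set.toFinite _).countable
    (by simp) (fun y hy => ?_) ?_ (hbound s t hs hst j)
  · have hpr : |volterraProd H c j s t u| ≤ ∏ l, kernelMajorant H A s t (u l) := by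
      refine abs_volterraProd_le (fun l _ => ?_) ?_ fun l _ => ?_
      · rw [abs_of_nonneg (h0 _ _)]
        exact (hmaj _).2
      · rw [abs_le]
        have h1 := hmaj (u j)
        have h2 := h0 s (u j)
        have h3 := h0 t (u j)
        constructor <;> linarith [h1.1, h1.2]
      · rw [abs_of_nonneg (h0 _ _)]
        exact (hmaj _).1
    unfold volterraIntegrand
    split_ifs
    · exact hpr
    · rw [abs_zero]
      exact Finset.prod_nonneg fun l _ => hG0 _
  · refine continuousAt_volterraProd hH0 c j fun l => ⟨(hy l).1, ?_⟩
    have := (hy l).2.2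
    simp only [Set.mem_insert_iff, Set.mem_singleton_iff, not_or] at this
    exact this.2
  · exact mul_nonneg hb.le (Real.rpow_nonneg (sub_pos.2 hst).le _)

end Final

end

theorem mainTheorem2 (H c : ℝ) (hH0 : 0 < H) (hH : H < 1 / 2) (hc : 0 < c)
    (d n : ℕ) (hn1 : 1 ≤ n) (hn : n ≤ ⌊1 / H⌋₊) (hne : (n : ℝ) ≠ 1 / H) :
    ∃ C : ℝ, 0 < C ∧
      ∀ (Ω : Type*) [MeasurableSpace Ω] (P : Measure Ω) [IsProbabilityMeasure P]
        (W : Fin d → ℝ≥0 → Ω → ℝ), IsWienerProcess W P →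
      ∀ (T : ℝ≥0) (s t : ℝ), 0 ≤ s → s < t → t ≤ T →
        (∀ (j : Fin n) (i : Fin n → Fin d),
          StratonovichIntegrable P W T i (volterraIntegrand H c j s t)) ∧
        (∀ i : Fin n → Fin d, MemLp (roughIncrement P W T H c s t i) 2 P) ∧
        ∫ ω, ∑ i : Fin n → Fin d, (roughIncrement P W T H c s t i ω) ^ 2 ∂P
          ≤ C * (t - s) ^ (2 * n * H) := by
  have hnH : n * H < 1 := by
    have h1 : (n : ℝ) ≤ 1 / H := (Nat.le_floor_iff (by positivity)).1 hn
    have h2 : (n : ℝ) < 1 / H := lt_of_le_of_ne h1 hne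
    rwa [lt_div_iff₀ hH0] at h2
  obtain ⟨b, hb, hbound⟩ := exists_lintegral_pairing_le hH0 hH hc hn1 hnH
  set Q : ℝ := wickConst n * (Fintype.card ((Fin n × Bool) ≃ (Fin n ⊕ Fin n)) * b) with hQ
  have hQ0 : 0 ≤ Q := mul_nonneg (wickConst_nonneg n) (by positivity)
  -- the summand `1` keeps the constant positive for `d = 0`
  refine ⟨(Fintype.card (Fin n → Fin d) : ℝ) * (n * (n * Q)) + 1, by positivity, ?_⟩
  intro Ω _ P _ W hW T s t hs hst htT
  have hT : 0 < T := by
    have : (0 : ℝ) < T := (hs.trans_lt hst).trans_le htT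
    exact_mod_cast this
  have hτ : 0 ≤ (t - s) ^ (2 * n * H) := Real.rpow_nonneg (sub_pos.2 hst).le _
  choose I hI hIle using fun (j : Fin n) (i : Fin n → Fin d) =>
    exists_isStratonovichIntegral_volterraIntegrand hH0 hH hc hb hbound hW hs hst htT j i
  have hint : ∀ (j : Fin n) (i : Fin n → Fin d),
      StratonovichIntegrable P W T i (volterraIntegrand H c j s t) :=
    fun j i => ⟨I j i, hI j i⟩
  have hspec : ∀ (j : Fin n) (i : Fin n → Fin d), IsStratonovichIntegral P W T i
      (volterraIntegrand H c j s t)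
      (stratonovichIntegral P W T i (volterraIntegrand H c j s t)) := by
    intro j i
    rw [stratonovichIntegral, dif_pos (hint j i)]
    exact (hint j i).choose_spec
  have hat2 : ∀ (j : Fin n) (i : Fin n → Fin d), MemLp (hatIncrement P W T H c j s t i) 2 P :=
    fun j i => (hspec j i).2.1.const_mul ((-1) ^ (j : ℕ))
  have hatle : ∀ (j : Fin n) (i : Fin n → Fin d), ∫ ω, hatIncrement P W T H c j s t i ω ^ 2 ∂P ≤
      Q * (t - s) ^ (2 * n * H) := by
    intro j i
    have h1 : ∫ ω, hatIncrement P W T H c j s t i ω ^ 2 ∂P = ∫ ω, I j i ω ^ 2 ∂P := by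
      refine integral_congr_ae ?_
      filter_upwards [(hspec j i).ae_eq hW hT (hI j i)] with ω hω
      rw [hatIncrement, hω, mul_pow, ← pow_mul, mul_comm (j : ℕ) 2, pow_mul]
      norm_num
    rw [h1]
    refine (hIle j i).trans (le_of_eq ?_)
    rw [hQ]
    ring
  have hrough2 : ∀ i : Fin n → Fin d, MemLp (roughIncrement P W T H c s t i) 2 P := fun i =>
    memLp_finsetSum _ fun j _ => hat2 j i
  refine ⟨hint, hrough2, ?_⟩
  have hroughle : ∀ i : Fin n → Fin d, ∫ ω, roughIncrement P W T H c s t i ω ^ 2 ∂P ≤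
      n * (n * Q) * (t - s) ^ (2 * n * H) := by
    intro i
    have hsq : ∀ j, Integrable (fun ω => hatIncrement P W T H c j s t i ω ^ 2) P := fun j =>
      (hat2 j i).integrable_sq
    calc ∫ ω, roughIncrement P W T H c s t i ω ^ 2 ∂P
        ≤ ∫ ω, (n : ℝ) * ∑ j : Fin n, hatIncrement P W T H c j s t i ω ^ 2 ∂P := by
          refine integral_mono (hrough2 i).integrable_sq
            ((integrable_finsetSum _ fun j _ => hsq j).const_mul _) fun ω => ?_
          have := sq_sum_le_card_mul_sum_sq (s := (Finset.univ : Finset (Fin n)))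
            (f := fun j => hatIncrement P W T H c j s t i ω)
          simpa [roughIncrement] using this
      _ = n * ∑ j : Fin n, ∫ ω, hatIncrement P W T H c j s t i ω ^ 2 ∂P := by
          rw [integral_const_mul, integral_finsetSum _ fun j _ => hsq j]
      _ ≤ n * ∑ _j : Fin n, Q * (t - s) ^ (2 * n * H) := by
          gcongr with j
          exact hatle j i
      _ = _ := by
          rw [Finset.sum_const, Finset.card_univ, Fintype.card_fin, nsmul_eq_mul]
          ring
  rw [integral_finsetSum _ fun i _ => (hrough2 i).integrable_sq]
  calc _ ≤ ∑ _i : Fin n → Fin d, n * (n * Q) * (t - s) ^ (2 * n * H) :=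
        Finset.sum_le_sum fun i _ => hroughle i
    _ = (Fintype.card (Fin n → Fin d) : ℝ) * (n * (n * Q)) * (t - s) ^ (2 * n * H) := by
        rw [Finset.sum_const, Finset.card_univ, nsmul_eq_mul]
        ring
    _ ≤ _ := by
        rw [add_mul, one_mul]
        linarith
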